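/- For $n\ge 1$ and $\omega\in\{1,-1\}^n$ let $M_n=\omega_1+\dots+\omega_n$ and $\bar\omega_+=|\{i:\omega_i=1\}|/n$, so that $M_n/n=2\bar\omega_+-1$. For $\beta>0$, $h\in\mathbb R$ the cubic mean-field Ising model is the probability measure $$\mu_n(\omega)\propto\exp\big(n f_{\beta,h}(\bar\omega_+)\big),\qquad f_{\beta,h}(a)=\beta(2a-1)^3+h(2a-1)^2 ,$$ with expectation $\mathbb E$. Let $A=f_{\beta,h}+I$ on $[0,1]$, where $I(a)=-a\log a-(1-a)\log(1-a)$. A maximizer $a\in(0,1)$ of $A$ is $2$-regular if $A'(a)=0$ and $A''(a)<0$. For probability measures on $\mathbb R$ with finite first moment, $d_W(\mu,\nu)=\sup\{|\int f\,d\mu-\int f\,d\nu| : f \text{ is } 1\text{-Lipschitz}\}$. $N(m,v)$ is the normal law with mean $m$ and variance $v$. Write $\beta$-statistic $f_\beta(a)=(2a-1)^3$ and $h$-statistic $f_h(a)=(2a-1)^2$. A maximum likelihood estimator $\hat\beta_n$ of $\beta$ (with $h$ known) is any function of $\omega$ such that $b=\hat\beta_n(\omega)$ solves the likelihood equation $\mathbb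 E_{\mu_n^{b,h}} f_\beta(\bar\omega_+)=f_\beta(\bar\omega_+(\omega))$ whenever this equation in $b$ has a solution (its value is arbitrary otherwise); $\hat h_n$ (with $\beta$ known) is defined in the same way with $f_h$. **Theorem.** There is a function $g$, continuous on $(0,\infty)$, such that with the curve $\gamma=\{(\beta,h):\beta>0,\ h=g(\beta)\}$ the following holds for all $\beta>0$, $h\in\mathbb R$. Constants may depend on $\beta,h$ and on the parameters quantified before them. (i) If $(\beta,h)\notin\gamma$, then $A$ has exactly one maximizer $a_*$ on $[0,1]$; it lies in $(0,1)$ and is $2$-regular, $a_*=1/2$ if $h<g(\beta)$, and $a_*>1/2$ if $h>g(\beta)$. Put $z_*=2a_*-1$. - Concentration: $M_n/n\to z_*$ in law under $\mu_n$, and for every $\delta>0$ there is $c>0$ with $\mu_n(|M_n/n-z_*|>\delta)\le e^{-cn}$ for all large $n$. - Central limit theorem with rate: for every $l\in\mathbb N$, $\mathbb E|M_n/n-z_*|^l=O(n^{-l/2})$, and $$d_W\Big(\mathcal L\Big(\frac{M_n-nz_*}{\sqrt n}\Big),\,N\big(0,4/|A''(a_*)|\big)\Big)=O(n^{-1/2}),\qquad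 n\ge1 .$$ - Maximum likelihood estimators: if moreover $a_*\ne 1/2$ (that is, $h>g(\beta)$), then for any maximum likelihood estimators, under $\mu_n$, $$\sqrt n(\hat\beta_n-\beta)\to N\Big(0,\frac{|A''(a_*)|}{f_\beta'(a_*)^2}\Big),\qquad \sqrt n(\hat h_n-h)\to N\Big(0,\frac{|A''(a_*)|}{f_h'(a_*)^2}\Big)\quad\text{in law.}$$ (ii) If $(\beta,h)\in\gamma$, then $A$ has exactly two maximizers on $[0,1]$, $a_-=1/2$ and $a_+\in(1/2,1)$, and both are $2$-regular. Put $z_\pm=2a_\pm-1$ (so $z_-=0$), $w_\pm=\big(|A''(a_\pm)|\,a_\pm(1-a_\pm)\big)^{-1/2}$ and $p_\pm=w_\pm/(w_-+w_+)$. - Concentration: $M_n/n\to p_-\delta_{z_-}+p_+\delta_{z_+}$ in law; for every $\delta>0$ there is $c>0$ with $\mu_n(|M_n/n-z_-|>\delta \text{ and } |M_n/n-z_+|>\delta)\le e^{-cn}$ for all large $n$; and for every $0<\varepsilon<z_+$ and each sign, $\mu_n(|M_n/n-z_\pm|\le\varepsilon)=p_\pm+O\big((\log n)^3/\sqrt n\big)$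 for $n\ge2$. - Conditional central limit theorems with rate: for every $0<\varepsilon<z_+$ and each sign, conditionally on $|M_n/n-z_\pm|\le\varepsilon$ and for all large $n$, one has $\mathbb E\big[|M_n/n-z_\pm|^l\,\big|\,|M_n/n-z_\pm|\le\varepsilon\big]=O(n^{-l/2})$ for every $l\in\mathbb N$, and $$d_W\Big(\mathcal L\Big(\frac{M_n-nz_\pm}{\sqrt n}\,\Big|\,|M_n/n-z_\pm|\le\varepsilon\Big),\,N\big(0,4/|A''(a_\pm)|\big)\Big)=O(n^{-1/2}).$$ -/

import Mathlib

open MeasureTheory ProbabilityTheory Filter Topology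

noncomputable section

namespace CubicIsing

/-- Spin configurations on `n` sites; the spin space `ℤˣ` is exactly `{1, -1}`. -/
abbrev Config (n : ℕ) : Type := Fin n → ℤˣ

instance instMeasurableSingletonClassSpin : MeasurableSingletonClass ℤˣ where
  measurableSet_singleton u := by
    refine ⟨{(u : ℤ)}, trivial, ?_⟩
    ext v
    simp [Units.ext_iff]

/-- The magnetization `M_n = ω_1 + ⋯ + ω_n`. -/
def magnetization {n : ℕ} (ω : Config n) : ℝ := ∑ i, ((ω i : ℤ) : ℝ)

/-- The proportion of `+1` spins. -/
def plusFraction {n : ℕ} (ω : Config n) : ℝ :=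
  ((Finset.univ.filter fun i => ω i = 1).card : ℝ) / n

/-- The partition function of the Hamiltonian `n F(plusFraction ω)`. -/
def partition (n : ℕ) (F : ℝ → ℝ) : ℝ :=
  ∑ ω : Config n, Real.exp (n * F (plusFraction ω))

/-- The Gibbs measure with weights proportional to `exp (n F(plusFraction ω))`. -/
def gibbs (n : ℕ) (F : ℝ → ℝ) : Measure (Config n) :=
  ∑ ω : Config n,
    ENNReal.ofReal (Real.exp (n * F (plusFraction ω)) / partition n F) • Measure.dirac ω

lemma partition_pos (n : ℕ) (F : ℝ → ℝ) : 0 < partition n F :=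
  Finset.sum_pos (fun _ _ => Real.exp_pos _) Finset.univ_nonempty

instance instIsProbabilityMeasureGibbs (n : ℕ) (F : ℝ → ℝ) :
    IsProbabilityMeasure (gibbs n F) where
  measure_univ := by
    have h : ∀ ω : Config n, 0 ≤ Real.exp (n * F (plusFraction ω)) / partition n F :=
      fun ω => div_nonneg (Real.exp_pos _).le (partition_pos n F).le
    simp only [gibbs, Measure.coe_finsetSum, Finset.sum_apply, Measure.smul_apply,
      measure_univ, smul_eq_mul, mul_one]
    rw [← ENNReal.ofReal_sum_of_nonneg fun ω _ => h ω, ← Finset.sum_div]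
    change ENNReal.ofReal (partition n F / partition n F) = 1
    rw [div_self (partition_pos n F).ne', ENNReal.ofReal_one]

/-- The function multiplying `β` in the cubic model. -/
def cube (a : ℝ) : ℝ := (2 * a - 1) ^ 3

/-- The function multiplying `h` in the cubic model. -/
def square (a : ℝ) : ℝ := (2 * a - 1) ^ 2

/-- The cubic energy `f_{β,h}(a) = β (2a-1)^3 + h (2a-1)^2`. -/
def energy (β h a : ℝ) : ℝ := β * cube a + h * square a

/-- `A = f_{β,h} + I`, with `I(a) = -a log a - (1-a) log (1-a)`. -/
def assoc (β h a : ℝ) : ℝ := energy β h a + Real.binEntropy a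

/-- The global maximizers of `A` on `[0,1]`. -/
def maximizers (A : ℝ → ℝ) : Set ℝ :=
  {a | a ∈ Set.Icc (0 : ℝ) 1 ∧ IsMaxOn A (Set.Icc (0 : ℝ) 1) a}

/-- `2`-regularity of an interior maximizer. -/
def IsTwoRegular (A : ℝ → ℝ) (a : ℝ) : Prop := deriv A a = 0 ∧ iteratedDeriv 2 A a < 0

/-- The Wasserstein distance, as a supremum over `1`-Lipschitz test functions
(meant for measures with a finite first moment). -/
def wasserstein (μ ν : Measure ℝ) : ENNReal :=
  ⨆ (f : ℝ → ℝ) (_ : LipschitzWith 1 f), ENNReal.ofReal |(∫ x, f x ∂μ) - ∫ x, f x ∂ν|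

/-- The rescaled magnetization `(M_n - n z) / √n`. -/
def fluctuation {n : ℕ} (z : ℝ) (ω : Config n) : ℝ := (magnetization ω - n * z) / √(n : ℝ)

/-- The event that `M_n / n` is within `ε` of `z`. -/
def window (n : ℕ) (z ε : ℝ) : Set (Config n) := {ω | |magnetization ω / n - z| ≤ ε}

/-- The centred Gaussian law with variance `4 / |A''(a)|`. -/
def limitGaussian (A : ℝ → ℝ) (a : ℝ) : Measure ℝ :=
  gaussianReal 0 (4 / |iteratedDeriv 2 A a|).toNNReal

/-- Unnormalised limiting mass of the maximizer `a`. -/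
def weight (A : ℝ → ℝ) (a : ℝ) : ℝ := 1 / √(|iteratedDeriv 2 A a| * (a * (1 - a)))

/-- Expected value of the sufficient statistic `f(plusFraction ω)` in the one-parameter model
with Hamiltonian `n (b f + g)`. -/
def meanStat (n : ℕ) (f g : ℝ → ℝ) (b : ℝ) : ℝ :=
  ∫ ω, f (plusFraction ω) ∂(gibbs n fun a => b * f a + g a)

/-- `est` is a maximum likelihood estimator of `b` in the model with Hamiltonian `n (b f + g)`:
it solves the likelihood equation whenever that equation is solvable. On the remaining
configurations its value is arbitrary. -/
def IsMLE (n : ℕ) (f g : ℝ → ℝ) (est : Config n → ℝ) : Prop :=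
  ∀ ω, (∃ b, meanStat n f g b = f (plusFraction ω)) →
    meanStat n f g (est ω) = f (plusFraction ω)

end CubicIsing

end

/-! The Hamiltonian depends only on the proportion `x = k/n` of plus spins, so every expectation is
a ratio of sums over `k` of `n.choose k * exp (n F(k/n))`. By Stirling's formula such a term is `exp
(n A(x)) / √(2π n x(1-x))` up to a relative error `O(1/n)`, as long as `x` stays away from 0 and 1.
Let `a` be a 2-regular maximizer, `lam = |A''(a)|/2` and `y = √n (x - a)`. After division by `exp (n
A(a))` the terms near `a` become `W √(lam/(πn)) exp (-lam y²)` with `W = weight A a`, up to an error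
`(C/n) exp (-c y²)`; this is `gaussianLike_peakWeight`. The points `y` form a lattice of mesh
`1/√n`, so summing against a locally Lipschitz function of exponential growth gives `W` times a
Gaussian integral, with an error `O(1/√n)` that is uniform over a class of such functions
(`GaussianLike.abs_sum_sub_integral_le`). Peak masses, moments and Wasserstein bounds are ratios of
these sums. Levels away from the maximizers lose a factor `exp (-cn)`, and two maximizers of equal
height share the mass in proportion to their weights.

For the estimators, a change of the parameter by `t/√n` tilts the weights by `exp (t √n (f(x) -
f(a)))`. The same Gaussian asymptotics show that `√n` times the shift of the mean of `f` is `t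
f'(a)²/(2 lam) + O(1/√n)`, uniformly for bounded `t` (`exists_abs_meanStat_sub_le`). The mean is
monotone in the parameter, so every solution of the likelihood equation is trapped near the value
predicted by this linear response (`eventually_abs_mle_sub_le`), and the estimator inherits the
central limit theorem of the statistic.

The phase diagram is a calculus problem for `G(z) = βz³ + hz² - L(z)`, the gain of `A` over its
value at `1/2`, where `z = 2a - 1` and `L` is the entropy loss. Since `β > 0` and `L` is even, only
`z ≥ 0` competes, and for `z > 0` the sign of `G(z)` is that of `h - (L(z)/z² - βz)`. The curve is
therefore the infimum of `L(z)/z² - βz` over `(0,1]`. The bound `L(z) ≥ z²/2`, together with the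
fact that the curve lies below `1/2`, shows that this infimum is attained at a positive `z`: the
transition is discontinuous. For uniqueness and nondegeneracy, `(G'/z)' = V/z²` with `V = zG'' - G'`
and `V' = zG'''`, and `G'''` is strictly decreasing on `[0,1)`; hence `V` changes sign at most once,
from plus to minus. At a positive critical point with `G ≥ 0` this forces `V < 0`, that is `G'' <
0`, and `G` decreases strictly beyond that point (`gainDeriv2_neg_of_critical`), so two positive
maximizers cannot coexist. -/

namespace CubicIsing

/-! ### Binomial coefficients and entropy -/

/-- Stirling's formula with Robbins' error bound. -/
lemma log_factorial_sub_bounds {n : ℕ} (hn : n ≠ 0) :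
    0 ≤ Real.log n.factorial - (n * Real.log n - n + Real.log n / 2 + Real.log (2 * Real.pi) / 2) ∧
    Real.log n.factorial - (n * Real.log n - n + Real.log n / 2 + Real.log (2 * Real.pi) / 2)
      ≤ 1 / (12 * n) := by
  refine ⟨sub_nonneg.2 (Stirling.le_log_factorial_stirling hn), ?_⟩
  have hn0 : (0 : ℝ) < n := by positivity
  have hpi := Real.pi_pos
  -- One step of the logarithm of the Stirling sequence drops by at most `1/(12m(m+1))`, the
  -- increment of `-1/(12m)`. So `u` increases, and its limit `log √π` bounds its first term from
  -- above.
  set u : ℕ → ℝ := fun k => Real.log (Stirling.stirlingSeq (n + k)) - 1 / (12 * ((n + k : ℕ) : ℝ))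
    with hu
  have hmono : Monotone u := by
    refine monotone_nat_of_le_succ fun k => ?_
    have h := Stirling.log_stirlingSeq_sdiff_le (n + k)
    have hk : (0 : ℝ) < ((n + k : ℕ) : ℝ) := by
      have : 0 < n + k := by omega
      exact_mod_cast this
    have e : 1 / (12 * ((n + k : ℕ) : ℝ)) - 1 / (12 * (((n + k : ℕ) : ℝ) + 1))
        = 1 / (12 * ((n + k : ℕ) : ℝ) * (((n + k : ℕ) : ℝ) + 1)) := by
      field_simp; ring
    have e2 : ((n + (k + 1) : ℕ) : ℝ) = ((n + k : ℕ) : ℝ) + 1 := by push_cast; ring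
    simp only [hu, e2]
    rw [show n + (k + 1) = n + k + 1 by ring]
    linarith
  have hlim : Tendsto u atTop (𝓝 (Real.log √Real.pi - 0)) := by
    have hs : Tendsto (fun k : ℕ => n + k) atTop atTop :=
      tendsto_atTop_mono (fun k => Nat.le_add_left k n) tendsto_id
    refine Tendsto.sub ?_ ?_
    · exact ((Real.continuousAt_log (by positivity)).tendsto.comp
        Stirling.tendsto_stirlingSeq_sqrt_pi).comp hs
    · have : Tendsto (fun k : ℕ => 1 / (12 * (k : ℝ))) atTop (𝓝 0) := by
        have := (tendsto_one_div_atTop_nhds_zero_nat (𝕜 := ℝ)).const_mul (1 / 12)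
        simpa [mul_comm] using this
      exact this.comp hs
  have h0 := hmono.ge_of_tendsto hlim 0
  simp only [hu, add_zero, sub_zero, Stirling.log_stirlingSeq_formula] at h0
  rw [Real.log_div hn0.ne' (Real.exp_pos 1).ne', Real.log_exp,
    Real.log_mul two_ne_zero hn0.ne', Real.log_sqrt hpi.le] at h0
  rw [Real.log_mul two_ne_zero hpi.ne']
  linarith

/-- The right side is what remains of the leading terms of `log (k+m)! - log k! - log m!`, the
linear terms having cancelled. -/
lemma mul_binEntropy_div {k m : ℝ} (hk : 0 < k) (hm : 0 < m) :
    (k + m) * Real.binEntropy (k / (k + m))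
      = (k + m) * Real.log (k + m) - k * Real.log k - m * Real.log m := by
  have h1 : 1 - k / (k + m) = m / (k + m) := by field_simp; ring
  have hkm : 0 < k + m := by positivity
  rw [Real.binEntropy, h1, Real.log_inv, Real.log_inv, Real.log_div hk.ne' hkm.ne',
    Real.log_div hm.ne' hkm.ne']
  field_simp
  ring

/-- The logarithm of a binomial coefficient up to an error `O(1/k + 1/(n-k))`. -/
lemma abs_log_choose_sub_le {n k : ℕ} (hk : 0 < k) (hkn : k < n) :
    |Real.log (n.choose k) - (n * Real.binEntropy (k / n)
      - Real.log (2 * Real.pi * n) / 2 - Real.log ((k / n) * (1 - k / n)) / 2)|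
      ≤ 1 / k + 1 / ((n : ℝ) - k) := by
  obtain ⟨m, rfl⟩ := Nat.exists_eq_add_of_lt hkn
  set M := m + 1 with hM
  have e : k + m + 1 = k + M := by omega
  rw [e]
  have hk0 : (0 : ℝ) < k := by positivity
  have hm0 : (0 : ℝ) < M := by positivity
  obtain ⟨a1, a2⟩ := log_factorial_sub_bounds (n := k + M) (by omega)
  obtain ⟨b1, b2⟩ := log_factorial_sub_bounds (n := k) (by omega)
  obtain ⟨c1, c2⟩ := log_factorial_sub_bounds (n := M) (by omega)
  have hlog : Real.log ((k + M).choose k) = Real.log (k + M).factorial - Real.log k.factorial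
      - Real.log M.factorial := by
    have h : ((k + M).choose k : ℝ) * k.factorial * M.factorial = (k + M).factorial := by
      have := Nat.choose_mul_factorial_mul_factorial (Nat.le_add_right k M)
      rw [Nat.add_sub_cancel_left] at this
      exact_mod_cast this
    have hc : ((k + M).choose k : ℝ) ≠ 0 := by
      exact_mod_cast (Nat.choose_pos (Nat.le_add_right k M)).ne'
    rw [← h, Real.log_mul (by positivity) (by positivity), Real.log_mul hc (by positivity)]
    ring
  have hent := mul_binEntropy_div hk0 hm0
  have hx : (k : ℝ) / (k + M) * (1 - k / (k + M)) = k * M / ((k + M) * (k + M)) := by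
    field_simp; ring
  have hpi := Real.pi_pos
  have hkm : (0 : ℝ) < k + M := by positivity
  have i1 : 1 / (12 * ((k : ℝ) + M)) ≤ 1 / k + 1 / M := by
    have : 1 / (12 * ((k : ℝ) + M)) ≤ 1 / k := one_div_le_one_div_of_le hk0 (by linarith)
    have : 0 < 1 / (M : ℝ) := by positivity
    linarith
  have i2 : 1 / (12 * (k : ℝ)) ≤ 1 / k := one_div_le_one_div_of_le hk0 (by linarith)
  have i3 : 1 / (12 * (M : ℝ)) ≤ 1 / M := one_div_le_one_div_of_le hm0 (by linarith)
  push_cast at *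
  rw [hent, hx, hlog, Real.log_div (by positivity) (by positivity), Real.log_mul hk0.ne' hm0.ne',
    Real.log_mul hkm.ne' hkm.ne', Real.log_mul (x := 2 * Real.pi) (by positivity) hkm.ne']
  rw [add_sub_cancel_left, abs_le]
  constructor <;> linarith

/-- A single term of the binomial expansion of `(p + (1 - p))^n = 1` at `p = k/n` is at most 1. The
bound lacks the factor `n^{-1/2}` but holds up to the endpoints, where the Stirling error is
useless. -/
lemma choose_le_exp_binEntropy {n k : ℕ} (hn : 0 < n) (hkn : k ≤ n) :
    (n.choose k : ℝ) ≤ Real.exp (n * Real.binEntropy (k / n)) := by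
  rcases Nat.eq_zero_or_pos k with rfl | hk
  · simp
  rcases hkn.eq_or_lt with rfl | hlt
  · have : (k : ℝ) ≠ 0 := by positivity
    simp [div_self this]
  obtain ⟨M, rfl⟩ := Nat.exists_eq_add_of_le hkn
  have hM : 0 < M := by omega
  have hk0 : (0 : ℝ) < k := by positivity
  have hm0 : (0 : ℝ) < M := by positivity
  have hkm : (0 : ℝ) < k + M := by positivity
  push_cast
  rw [mul_binEntropy_div hk0 hm0]
  have hb : ((k : ℝ) / (k + M)) ^ k * ((M : ℝ) / (k + M)) ^ M * ((k + M).choose k) ≤ 1 := by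
    have h := add_pow ((k : ℝ) / (k + M)) ((M : ℝ) / (k + M)) (k + M)
    rw [← add_div, div_self hkm.ne', one_pow] at h
    rw [h]
    have := Finset.single_le_sum (f := fun m => ((k : ℝ) / (k + M)) ^ m *
      ((M : ℝ) / (k + M)) ^ (k + M - m) * ((k + M).choose m)) (s := Finset.range (k + M + 1))
      (fun i _ => by positivity) (Finset.mem_range.2 (by omega : k < k + M + 1))
    simpa using this
  have he : Real.exp ((k + M) * Real.log (k + M) - k * Real.log k - M * Real.log M)
      = (((k : ℝ) / (k + M)) ^ k * ((M : ℝ) / (k + M)) ^ M)⁻¹ := by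
    rw [← Real.exp_log (x := (((k : ℝ) / (k + M)) ^ k * ((M : ℝ) / (k + M)) ^ M)⁻¹) (by positivity),
      Real.log_inv, Real.log_mul (by positivity) (by positivity), Real.log_pow, Real.log_pow,
      Real.log_div hk0.ne' hkm.ne', Real.log_div hm0.ne' hkm.ne']
    congr 1; ring
  rw [he, ← one_div, le_div_iff₀ (by positivity), mul_comm]
  exact hb

/-! ### Reduction to sums over the number of plus spins -/

lemma magnetization_div {n : ℕ} (hn : n ≠ 0) (ω : Config n) :
    magnetization ω / n = 2 * plusFraction ω - 1 := by
  have h : magnetization ω = ∑ i, ((if ω i = 1 then 2 else 0 : ℝ) - 1) := by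
    refine Finset.sum_congr rfl fun i _ => ?_
    rcases Int.units_eq_one_or (ω i) with h | h <;> (simp [h]; try norm_num)
  have hn' : (n : ℝ) ≠ 0 := by exact_mod_cast hn
  rw [h, Finset.sum_sub_distrib, ← Finset.sum_filter, plusFraction]
  simp only [Finset.sum_const, Finset.card_univ, Fintype.card_fin, nsmul_eq_mul]
  field_simp

lemma plusFraction_mem {n : ℕ} (ω : Config n) : plusFraction ω ∈ Set.Icc (0 : ℝ) 1 := by
  refine ⟨by unfold plusFraction; positivity, ?_⟩
  refine div_le_one_of_le₀ ?_ (by positivity)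
  have := Finset.card_filter_le (Finset.univ : Finset (Fin n)) (fun i => ω i = 1)
  simp only [Finset.card_univ, Fintype.card_fin] at this
  exact_mod_cast this

/-- A configuration is the same thing as its set of plus sites, and the summand sees only the
cardinality of that set. -/
lemma sum_config_eq (n : ℕ) (Ψ : ℝ → ℝ) :
    ∑ ω : Config n, Ψ (plusFraction ω) = ∑ k ∈ Finset.range (n + 1), n.choose k * Ψ (k / n) := by
  classical
  have e : ∑ ω : Config n, Ψ (plusFraction ω)
      = ∑ s : Finset (Fin n), Ψ ((s.card : ℝ) / n) := by
    refine Finset.sum_bij' (fun ω _ => Finset.univ.filter fun i => ω i = 1)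
      (fun s _ i => if i ∈ s then 1 else -1) (fun _ _ => Finset.mem_univ _)
      (fun _ _ => Finset.mem_univ _) ?_ ?_ (fun _ _ => rfl)
    · intro ω _
      funext i
      rcases Int.units_eq_one_or (ω i) with h | h <;> simp [h]
    · intro s _
      ext i
      by_cases h : i ∈ s <;> simp [h]
  rw [e, ← Finset.powerset_univ, Finset.sum_powerset_apply_card (fun k => Ψ ((k : ℝ) / n))]
  simp [nsmul_eq_mul]

/-- The unnormalised mass of the configurations with `k` plus spins. -/
noncomputable def levelWeight (n : ℕ) (F : ℝ → ℝ) (k : ℕ) : ℝ :=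
  n.choose k * Real.exp (n * F (k / n))

lemma levelWeight_nonneg (n : ℕ) (F : ℝ → ℝ) (k : ℕ) : 0 ≤ levelWeight n F k := by
  unfold levelWeight; positivity

lemma partition_eq (n : ℕ) (F : ℝ → ℝ) :
    partition n F = ∑ k ∈ Finset.range (n + 1), levelWeight n F k :=
  sum_config_eq n fun x => Real.exp (n * F x)

lemma integrable_gibbs (n : ℕ) (F : ℝ → ℝ) (Φ : Config n → ℝ) : Integrable Φ (gibbs n F) :=
  Integrable.of_finite

lemma integral_gibbs_eq_sum (n : ℕ) (F : ℝ → ℝ) (Φ : Config n → ℝ) :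
    ∫ ω, Φ ω ∂(gibbs n F)
      = ∑ ω, Real.exp (n * F (plusFraction ω)) / partition n F * Φ ω := by
  have hZ := (partition_pos n F).le
  rw [gibbs, integral_finsetSum_measure
    fun _ _ => Integrable.of_finite.smul_measure ENNReal.ofReal_ne_top]
  refine Finset.sum_congr rfl fun ω _ => ?_
  rw [integral_smul_measure, integral_dirac, ENNReal.toReal_ofReal (by positivity), smul_eq_mul]

lemma integral_gibbs (n : ℕ) (F Φ : ℝ → ℝ) :
    ∫ ω, Φ (plusFraction ω) ∂(gibbs n F)
      = (∑ k ∈ Finset.range (n + 1), levelWeight n F k * Φ (k / n))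
        / ∑ k ∈ Finset.range (n + 1), levelWeight n F k := by
  rw [integral_gibbs_eq_sum, sum_config_eq n fun x => Real.exp (n * F x) / partition n F * Φ x,
    partition_eq, Finset.sum_div]
  refine Finset.sum_congr rfl fun k _ => ?_
  rw [levelWeight]; ring

end CubicIsing

/-! ### Gaussian sums over the rescaled lattice -/

namespace CubicIsing

/-- The rescaled lattice point `√n (k/n - a)`. -/
noncomputable def latticePoint (a : ℝ) (n k : ℕ) : ℝ := √(n : ℝ) * (k / n - a)

lemma latticePoint_succ (a : ℝ) {n : ℕ} (hn : 0 < n) (k : ℕ) :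
    latticePoint a n (k + 1) = latticePoint a n k + 1 / √(n : ℝ) := by
  have hn0 : (0 : ℝ) < n := by exact_mod_cast hn
  have hs : 0 < √(n : ℝ) := Real.sqrt_pos.2 hn0
  have h : √(n : ℝ) * √(n : ℝ) = n := Real.mul_self_sqrt hn0.le
  unfold latticePoint
  push_cast
  have : √(n : ℝ) * (1 / n) = 1 / √(n : ℝ) := by
    field_simp; nlinarith
  rw [← this]; ring

lemma one_div_sqrt_le_one {n : ℕ} (hn : 0 < n) : 1 / √(n : ℝ) ≤ 1 := by
  have h1 : (1 : ℝ) ≤ n := by exact_mod_cast hn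
  have : 1 ≤ √(n : ℝ) := Real.one_le_sqrt.2 h1
  exact div_le_one_of_le₀ this (by positivity)

lemma one_div_le_one_div_sqrt {n : ℕ} (hn : 0 < n) : 1 / (n : ℝ) ≤ 1 / √(n : ℝ) := by
  have h1 : (1 : ℝ) ≤ n := by exact_mod_cast hn
  have h2 : 1 ≤ √(n : ℝ) := Real.one_le_sqrt.2 h1
  have h : √(n : ℝ) * √(n : ℝ) = n := Real.mul_self_sqrt (by linarith)
  exact one_div_le_one_div_of_le (by positivity) (by nlinarith)

/-- Completing the square: exponential growth is absorbed at the price of half of the Gaussian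
exponent. -/
lemma exp_abs_mul_exp_neg_le {c : ℝ} (hc : 0 < c) (s y : ℝ) :
    Real.exp (s * |y|) * Real.exp (-c * y ^ 2)
      ≤ Real.exp (s ^ 2 / (2 * c)) * Real.exp (-(c / 2) * y ^ 2) := by
  rw [← Real.exp_add, ← Real.exp_add, Real.exp_le_exp]
  have h : s ^ 2 / (2 * c) + -(c / 2) * y ^ 2 - (s * |y| + -c * y ^ 2)
      = (s - c * |y|) ^ 2 / (2 * c) := by
    rw [← sq_abs y]; field_simp; ring
  have : 0 ≤ (s - c * |y|) ^ 2 / (2 * c) := by positivity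
  linarith

lemma abs_pow_le_factorial_mul_exp (y : ℝ) (l : ℕ) : |y| ^ l ≤ l.factorial * Real.exp |y| := by
  have := Real.pow_div_factorial_le_exp |y| (abs_nonneg y) l
  rwa [div_le_iff₀ (by positivity), mul_comm] at this

/-- This is `y² ≤ 2x² + 2`. It lets the base point move within a lattice cell, again at the price of
half of the exponent. -/
lemma exp_neg_sq_le_of_abs_sub_le {c : ℝ} (hc : 0 < c) {x y : ℝ} (h : |y - x| ≤ 1) :
    Real.exp (-c * x ^ 2) ≤ Real.exp c * Real.exp (-(c / 2) * y ^ 2) := by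
  rw [← Real.exp_add, Real.exp_le_exp]
  have h1 : (y - x) ^ 2 ≤ 1 := by rw [← sq_abs]; nlinarith [abs_nonneg (y - x)]
  nlinarith [sq_nonneg (x + (x - y)), mul_le_mul_of_nonneg_left h1 hc.le,
    mul_nonneg hc.le (sq_nonneg (2 * x - y))]

/-- The mesh is `1/√n ≤ 1`, so each term times the mesh is at most a constant times the integral of
a wider Gaussian over the cell to its right; these cells are disjoint. -/
lemma sum_exp_neg_latticePoint_le {c : ℝ} (hc : 0 < c) (a : ℝ) :
    ∃ C : ℝ, 0 < C ∧ ∀ n : ℕ, 0 < n →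
      ∑ k ∈ Finset.range (n + 1), Real.exp (-c * latticePoint a n k ^ 2) ≤ C * √(n : ℝ) := by
  set I := ∫ y : ℝ, Real.exp (-(c / 2) * y ^ 2) with hI
  have hint : Integrable fun y : ℝ => Real.exp (-(c / 2) * y ^ 2) :=
    integrable_exp_neg_mul_sq (by positivity)
  have hI0 : 0 ≤ I := integral_nonneg fun y => (Real.exp_pos _).le
  refine ⟨Real.exp c * I + 1, by positivity, fun n hn => ?_⟩
  have hs : 0 < √(n : ℝ) := Real.sqrt_pos.2 (by exact_mod_cast hn)
  have hstep : ∀ k ∈ Finset.range (n + 1), 1 / √(n : ℝ) * Real.exp (-c * latticePoint a n k ^ 2)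
      ≤ Real.exp c * ∫ y in (latticePoint a n k)..(latticePoint a n (k + 1)),
        Real.exp (-(c / 2) * y ^ 2) := by
    intro k _
    rw [← intervalIntegral.integral_const_mul]
    have hle : latticePoint a n k ≤ latticePoint a n (k + 1) := by
      rw [latticePoint_succ a hn]; have : 0 < 1 / √(n : ℝ) := by positivity
      linarith
    have h := intervalIntegral.integral_mono_on (μ := volume) hle
      (f := fun _ => Real.exp (-c * latticePoint a n k ^ 2))
      (g := fun y => Real.exp c * Real.exp (-(c / 2) * y ^ 2)) (by simp)
      (hint.const_mul _).intervalIntegrable (fun y hy => by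
        refine exp_neg_sq_le_of_abs_sub_le hc ?_
        rw [latticePoint_succ a hn] at hy
        rw [abs_le]; have := one_div_sqrt_le_one hn
        constructor <;> linarith [hy.1, hy.2])
    rw [intervalIntegral.integral_const, latticePoint_succ a hn, add_sub_cancel_left,
      smul_eq_mul, ← latticePoint_succ a hn] at h
    exact h
  have hsum := Finset.sum_le_sum hstep
  rw [← Finset.mul_sum, ← Finset.mul_sum, intervalIntegral.sum_integral_adjacent_intervals
    (fun k _ => hint.intervalIntegrable)] at hsum
  have hle : latticePoint a n 0 ≤ latticePoint a n (n + 1) := by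
    unfold latticePoint
    refine mul_le_mul_of_nonneg_left ?_ hs.le
    have : (0 : ℝ) ≤ ((n + 1 : ℕ) : ℝ) / n := by positivity
    simp only [Nat.cast_zero, zero_div]; linarith
  rw [intervalIntegral.integral_of_le hle] at hsum
  have hset : ∫ y in Set.Ioc (latticePoint a n 0) (latticePoint a n (n + 1)),
      Real.exp (-(c / 2) * y ^ 2) ≤ I :=
    setIntegral_le_integral hint (Eventually.of_forall fun y => (Real.exp_pos _).le)
  have h1 : 1 / √(n : ℝ) * ∑ k ∈ Finset.range (n + 1), Real.exp (-c * latticePoint a n k ^ 2)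
      ≤ Real.exp c * I :=
    hsum.trans (mul_le_mul_of_nonneg_left hset (Real.exp_pos c).le)
  rw [one_div, inv_mul_le_iff₀ hs] at h1
  nlinarith

/-- Riemann sums over the rescaled lattice, with error `O(1/√n)`. -/
lemma abs_riemannSum_sub_integral_le {a : ℝ} (ha : a ∈ Set.Ioo (0 : ℝ) 1) {c : ℝ} (hc : 0 < c)
    (C₁ : ℝ) : ∃ C : ℝ, ∀ G : ℝ → ℝ, Continuous G →
      (∀ y, |G y| ≤ C₁ * Real.exp (-c * y ^ 2)) →
      (∀ x y, |y - x| ≤ 1 → |G y - G x| ≤ C₁ * |y - x| * Real.exp (-c * x ^ 2)) →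
      ∀ n : ℕ, 0 < n →
      |1 / √(n : ℝ) * ∑ k ∈ Finset.range (n + 1), G (latticePoint a n k) - ∫ y, G y|
        ≤ C / √(n : ℝ) := by
  obtain ⟨C₂, hC₂, hsum⟩ := sum_exp_neg_latticePoint_le hc a
  set m := min a (1 - a) with hm
  have hm0 : 0 < m := lt_min ha.1 (by linarith [ha.2])
  set T := ∫ y : ℝ, |y| * Real.exp (-c * y ^ 2) with hT
  have hintT : Integrable fun y : ℝ => |y| * Real.exp (-c * y ^ 2) := by
    have := (integrable_mul_exp_neg_mul_sq hc).norm
    refine this.congr (Eventually.of_forall fun y => ?_)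
    simp
  refine ⟨C₁ * C₂ + C₁ / m * T, fun G hG hbd hlip n hn => ?_⟩
  have hC₁ : 0 ≤ C₁ := by
    have := (abs_nonneg _).trans (hbd 0); simpa using this
  have hs : 0 < √(n : ℝ) := Real.sqrt_pos.2 (by exact_mod_cast hn)
  have hn0 : (0 : ℝ) < n := by exact_mod_cast hn
  have hint : Integrable G := by
    refine ((integrable_exp_neg_mul_sq hc).const_mul C₁).mono' hG.aestronglyMeasurable
      (Eventually.of_forall fun y => ?_)
    rw [Real.norm_eq_abs]; exact hbd y
  have hsq : √(n : ℝ) * √(n : ℝ) = n := Real.mul_self_sqrt hn0.le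
  have hle : latticePoint a n 0 ≤ latticePoint a n (n + 1) := by
    unfold latticePoint
    refine mul_le_mul_of_nonneg_left ?_ hs.le
    have : (0 : ℝ) ≤ ((n + 1 : ℕ) : ℝ) / n := by positivity
    simp only [Nat.cast_zero, zero_div]; linarith
  -- On a cell `G` varies by at most `C₁/√n` times a Gaussian, and the cell has length `1/√n`. Each
  -- of the `n + 1` points owns the cell to its right, so the cells end at the point of index `n +
  -- 1`.
  have hstep : ∀ k ∈ Finset.range (n + 1), |1 / √(n : ℝ) * G (latticePoint a n k) -
      ∫ y in (latticePoint a n k)..(latticePoint a n (k + 1)), G y|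
      ≤ C₁ / n * Real.exp (-c * latticePoint a n k ^ 2) := by
    intro k _
    have hd : latticePoint a n (k + 1) - latticePoint a n k = 1 / √(n : ℝ) := by
      rw [latticePoint_succ a hn]; ring
    have hp : 0 < 1 / √(n : ℝ) := by positivity
    have e : 1 / √(n : ℝ) * G (latticePoint a n k) -
        ∫ y in (latticePoint a n k)..(latticePoint a n (k + 1)), G y
        = ∫ y in (latticePoint a n k)..(latticePoint a n (k + 1)), (G (latticePoint a n k) - G y) := by
      rw [intervalIntegral.integral_sub (by simp) (hG.intervalIntegrable _ _),
        intervalIntegral.integral_const, hd, smul_eq_mul]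
    rw [e, ← Real.norm_eq_abs]
    have := intervalIntegral.norm_integral_le_of_norm_le_const
      (f := fun y => G (latticePoint a n k) - G y) (a := latticePoint a n k)
      (b := latticePoint a n (k + 1))
      (C := C₁ * (1 / √(n : ℝ)) * Real.exp (-c * latticePoint a n k ^ 2)) (fun y hy => by
        rw [Set.uIoc_of_le (by linarith)] at hy
        have h1 : |y - latticePoint a n k| ≤ 1 / √(n : ℝ) := by
          rw [abs_le]; constructor <;> linarith [hy.1, hy.2]
        rw [Real.norm_eq_abs, abs_sub_comm]
        refine (hlip _ _ (h1.trans (one_div_sqrt_le_one hn))).trans ?_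
        gcongr)
    refine this.trans (le_of_eq ?_)
    rw [hd, abs_of_pos hp]
    field_simp
    rw [sq, hsq]
  have h1 : |1 / √(n : ℝ) * ∑ k ∈ Finset.range (n + 1), G (latticePoint a n k) -
      ∫ y in (latticePoint a n 0)..(latticePoint a n (n + 1)), G y| ≤ C₁ * C₂ / √(n : ℝ) := by
    rw [← intervalIntegral.sum_integral_adjacent_intervals (fun k _ => hint.intervalIntegrable),
      Finset.mul_sum, ← Finset.sum_sub_distrib]
    refine (Finset.abs_sum_le_sum_abs _ _).trans ((Finset.sum_le_sum hstep).trans ?_)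
    rw [← Finset.mul_sum]
    calc C₁ / n * ∑ k ∈ Finset.range (n + 1), Real.exp (-c * latticePoint a n k ^ 2)
        ≤ C₁ / n * (C₂ * √(n : ℝ)) := by gcongr; exact hsum n hn
      _ = C₁ * C₂ / √(n : ℝ) := by
        field_simp; rw [sq, hsq]
  have h2 : |(∫ y in (latticePoint a n 0)..(latticePoint a n (n + 1)), G y) - ∫ y, G y|
      ≤ C₁ / m * T / √(n : ℝ) := by
    rw [intervalIntegral.integral_of_le hle, ← integral_add_compl (measurableSet_Ioc) hint,
      sub_add_cancel_left, abs_neg]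
    -- Outside the range of the lattice `|y| ≥ m√n`; inserting the factor `|y|/(m√n) ≥ 1` bounds the
    -- tail by a first absolute moment divided by `√n`.
    have hb : ∀ y ∈ (Set.Ioc (latticePoint a n 0) (latticePoint a n (n + 1)))ᶜ,
        ‖G y‖ ≤ C₁ / (m * √(n : ℝ)) * (|y| * Real.exp (-c * y ^ 2)) := by
      intro y hy
      have hy' : m * √(n : ℝ) ≤ |y| := by
        rw [Set.mem_compl_iff, Set.mem_Ioc, not_and_or, not_lt, not_le] at hy
        rcases hy with hy | hy
        · have : latticePoint a n 0 = -(a * √(n : ℝ)) := by unfold latticePoint; simp; ring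
          rw [this] at hy
          have h3 : m * √(n : ℝ) ≤ a * √(n : ℝ) := by gcongr; exact min_le_left _ _
          linarith [neg_abs_le y]
        · have h3 : m * √(n : ℝ) ≤ (1 - a) * √(n : ℝ) := by gcongr; exact min_le_right _ _
          have h4 : (1 - a) * √(n : ℝ) ≤ latticePoint a n (n + 1) := by
            unfold latticePoint
            rw [mul_comm]
            refine mul_le_mul_of_nonneg_left ?_ hs.le
            have : (1 : ℝ) ≤ ((n + 1 : ℕ) : ℝ) / n := by
              rw [le_div_iff₀ hn0]; push_cast; linarith
            linarith
          linarith [le_abs_self y]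
      rw [Real.norm_eq_abs]
      refine (hbd y).trans ?_
      rw [← mul_assoc]
      refine mul_le_mul_of_nonneg_right ?_ (Real.exp_pos _).le
      rw [div_mul_eq_mul_div, le_div_iff₀ (by positivity)]
      gcongr
    rw [← Real.norm_eq_abs]
    have hintT' := hintT.const_mul (C₁ / (m * √(n : ℝ)))
    refine (norm_integral_le_of_norm_le hintT'.integrableOn
      (ae_restrict_of_forall_mem measurableSet_Ioc.compl hb)).trans ?_
    refine (setIntegral_le_integral hintT'
      (Eventually.of_forall fun y => by positivity)).trans (le_of_eq ?_)
    rw [integral_const_mul, ← hT]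
    field_simp
  calc _ ≤ _ := abs_sub_le _ (∫ y in (latticePoint a n 0)..(latticePoint a n (n + 1)), G y) _
    _ ≤ C₁ * C₂ / √(n : ℝ) + C₁ / m * T / √(n : ℝ) := add_le_add h1 h2
    _ = _ := by ring

end CubicIsing

/-! ### Test functions of exponential growth -/

namespace CubicIsing

lemma abs_exp_sub_exp_le {u v w : ℝ} (hu : u ≤ w) (hv : v ≤ w) :
    |Real.exp u - Real.exp v| ≤ |u - v| * Real.exp w := by
  wlog h : u ≤ v generalizing u v
  · rw [abs_sub_comm, abs_sub_comm u]; exact this hv hu (le_of_not_ge h)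
  rw [abs_sub_comm, abs_sub_comm u, abs_of_nonneg (sub_nonneg.2 (Real.exp_le_exp.2 h)),
    abs_of_nonneg (sub_nonneg.2 h)]
  have h1 : Real.exp u = Real.exp v * Real.exp (u - v) := by rw [← Real.exp_add]; congr 1; ring
  have h2 := Real.add_one_le_exp (u - v)
  have h3 := Real.exp_le_exp.2 hv
  have h4 := Real.exp_pos v
  calc Real.exp v - Real.exp u = Real.exp v * (1 - Real.exp (u - v)) := by rw [h1]; ring
    _ ≤ Real.exp v * (v - u) := mul_le_mul_of_nonneg_left (by linarith) h4.le
    _ ≤ (v - u) * Real.exp w := by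
      rw [mul_comm]; exact mul_le_mul_of_nonneg_left h3 (by linarith)

/-- Locally Lipschitz functions of at most exponential growth. -/
def ExpLipschitz (B s : ℝ) (φ : ℝ → ℝ) : Prop :=
  (∀ x y, |φ x - φ y| ≤ B * |x - y| * Real.exp (s * (|x| + |y|))) ∧ |φ 0| ≤ B

namespace ExpLipschitz

variable {B s : ℝ} {φ : ℝ → ℝ}

lemma nonneg (h : ExpLipschitz B s φ) : 0 ≤ B := (abs_nonneg _).trans h.2

lemma abs_le (h : ExpLipschitz B s φ) (hs : 0 ≤ s) (y : ℝ) :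
    |φ y| ≤ B * Real.exp ((s + 1) * |y|) := by
  have h1 := h.1 y 0
  simp only [sub_zero, abs_zero, add_zero] at h1
  have h2 := Real.add_one_le_exp |y|
  have h3 : 1 ≤ Real.exp (s * |y|) := Real.one_le_exp (by positivity)
  have hB := h.nonneg
  have h4 : |φ y| ≤ |φ y - φ 0| + |φ 0| := by
    simpa using abs_add_le (φ y - φ 0) (φ 0)
  rw [add_mul, one_mul, Real.exp_add]
  calc |φ y| ≤ B * |y| * Real.exp (s * |y|) + B * Real.exp (s * |y|) := by
        have := mul_le_mul_of_nonneg_left h3 hB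
        linarith [h.2]
    _ = B * Real.exp (s * |y|) * (|y| + 1) := by ring
    _ ≤ B * Real.exp (s * |y|) * Real.exp |y| := by gcongr
    _ = _ := by ring

lemma continuous (h : ExpLipschitz B s φ) : Continuous φ := by
  rw [continuous_iff_continuousAt]
  intro x
  rw [ContinuousAt, tendsto_iff_norm_sub_tendsto_zero]
  have hc : Continuous fun y => B * |y - x| * Real.exp (s * (|y| + |x|)) := by fun_prop
  have h0 := hc.tendsto x
  simp only [sub_self, abs_zero, mul_zero, zero_mul] at h0
  exact squeeze_zero (fun _ => norm_nonneg _) (fun y => h.1 y x) h0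

lemma mul_gaussian_abs_le (h : ExpLipschitz B s φ) (hs : 0 ≤ s) {lam : ℝ} (hl : 0 < lam) (y : ℝ) :
    |φ y * Real.exp (-lam * y ^ 2)|
      ≤ B * Real.exp ((s + 1) ^ 2 / (2 * lam)) * Real.exp (-(lam / 2) * y ^ 2) := by
  rw [abs_mul, abs_of_pos (Real.exp_pos _)]
  calc |φ y| * Real.exp (-lam * y ^ 2)
      ≤ B * Real.exp ((s + 1) * |y|) * Real.exp (-lam * y ^ 2) := by gcongr; exact h.abs_le hs y
    _ ≤ B * (Real.exp ((s + 1) ^ 2 / (2 * lam)) * Real.exp (-(lam / 2) * y ^ 2)) := by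
      rw [mul_assoc]
      exact mul_le_mul_of_nonneg_left (exp_abs_mul_exp_neg_le hl _ _) h.nonneg
    _ = _ := by ring

/-- Vary first `φ`, then the Gaussian. Half of the exponent is lost in moving from `y` to `x` and
half of the rest in absorbing the growth, whence `lam/4`. With `mul_gaussian_abs_le` this supplies
the hypotheses of `abs_riemannSum_sub_integral_le`, with constants that see `φ` only through `B` and
`s`. -/
lemma mul_gaussian_sub_le (h : ExpLipschitz B s φ) (hs : 0 ≤ s) {lam : ℝ} (hl : 0 < lam)
    {x y : ℝ} (hxy : |y - x| ≤ 1) :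
    |φ y * Real.exp (-lam * y ^ 2) - φ x * Real.exp (-lam * x ^ 2)|
      ≤ Real.exp lam * (B * Real.exp s + B * lam) * Real.exp ((2 * s + 3) ^ 2 / lam) * |y - x| *
        Real.exp (-(lam / 4) * x ^ 2) := by
  have hB := h.nonneg
  have hyx : |y| ≤ |x| + 1 := by
    have := abs_add_le (y - x) x; rw [sub_add_cancel] at this; linarith
  have e1 : Real.exp (-lam * y ^ 2) ≤ Real.exp lam * Real.exp (-(lam / 2) * x ^ 2) :=
    exp_neg_sq_le_of_abs_sub_le hl (by rwa [abs_sub_comm])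
  have e1' : Real.exp (-lam * x ^ 2) ≤ Real.exp lam * Real.exp (-(lam / 2) * x ^ 2) :=
    exp_neg_sq_le_of_abs_sub_le hl (by simp)
  have e2 : |Real.exp (-lam * y ^ 2) - Real.exp (-lam * x ^ 2)|
      ≤ lam * |y - x| * Real.exp (2 * |x|) * (Real.exp lam * Real.exp (-(lam / 2) * x ^ 2)) := by
    rw [← Real.exp_add] at e1 e1' ⊢
    refine (abs_exp_sub_exp_le (Real.exp_le_exp.1 e1) (Real.exp_le_exp.1 e1')).trans ?_
    refine mul_le_mul_of_nonneg_right ?_ (Real.exp_pos _).le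
    have : -lam * y ^ 2 - -lam * x ^ 2 = -(lam * (y - x) * (y + x)) := by ring
    rw [this, abs_neg, abs_mul, abs_mul, abs_of_pos hl]
    have h3 : |y + x| ≤ Real.exp (2 * |x|) := by
      have := abs_add_le y x
      have := Real.add_one_le_exp (2 * |x|)
      linarith
    gcongr
  have e3 : |φ y - φ x| ≤ B * |y - x| * (Real.exp s * Real.exp ((2 * s + 3) * |x|)) := by
    refine (h.1 y x).trans ?_
    rw [← Real.exp_add]
    have : s * |y| ≤ s * (|x| + 1) := by gcongr
    gcongr
    nlinarith [abs_nonneg x]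
  have e4 : |φ x| * Real.exp (2 * |x|) ≤ B * Real.exp ((2 * s + 3) * |x|) := by
    calc |φ x| * Real.exp (2 * |x|) ≤ B * Real.exp ((s + 1) * |x|) * Real.exp (2 * |x|) := by
          gcongr; exact h.abs_le hs x
      _ = B * Real.exp ((s + 3) * |x|) := by rw [mul_assoc, ← Real.exp_add]; ring_nf
      _ ≤ _ := by gcongr; nlinarith [abs_nonneg x]
  have e5 := exp_abs_mul_exp_neg_le (half_pos hl) (2 * s + 3) x
  rw [show (2 : ℝ) * (lam / 2) = lam by ring, show lam / 2 / 2 = lam / 4 by ring] at e5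
  have e6 : φ y * Real.exp (-lam * y ^ 2) - φ x * Real.exp (-lam * x ^ 2)
      = (φ y - φ x) * Real.exp (-lam * y ^ 2)
        + φ x * (Real.exp (-lam * y ^ 2) - Real.exp (-lam * x ^ 2)) := by ring
  rw [e6]
  refine (abs_add_le _ _).trans ?_
  rw [abs_mul, abs_mul, abs_of_pos (Real.exp_pos _)]
  calc _ ≤ B * |y - x| * (Real.exp s * Real.exp ((2 * s + 3) * |x|)) *
          (Real.exp lam * Real.exp (-(lam / 2) * x ^ 2)) +
          |φ x| * (lam * |y - x| * Real.exp (2 * |x|) *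
            (Real.exp lam * Real.exp (-(lam / 2) * x ^ 2))) := by gcongr
    _ = (B * |y - x| * (Real.exp s * Real.exp ((2 * s + 3) * |x|)) +
          (|φ x| * Real.exp (2 * |x|)) * lam * |y - x|) *
          (Real.exp lam * Real.exp (-(lam / 2) * x ^ 2)) := by ring
    _ ≤ (B * |y - x| * (Real.exp s * Real.exp ((2 * s + 3) * |x|)) +
          (B * Real.exp ((2 * s + 3) * |x|)) * lam * |y - x|) *
          (Real.exp lam * Real.exp (-(lam / 2) * x ^ 2)) := by gcongr
    _ = Real.exp lam * (B * Real.exp s + B * lam) * |y - x| *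
          (Real.exp ((2 * s + 3) * |x|) * Real.exp (-(lam / 2) * x ^ 2)) := by ring
    _ ≤ Real.exp lam * (B * Real.exp s + B * lam) * |y - x| *
          (Real.exp ((2 * s + 3) ^ 2 / lam) * Real.exp (-(lam / 4) * x ^ 2)) := by gcongr
    _ = _ := by ring

end ExpLipschitz

lemma integral_gaussianReal_half_inv {lam : ℝ} (hl : 0 < lam) (φ : ℝ → ℝ) :
    ∫ y, φ y ∂(gaussianReal 0 (1 / (2 * lam)).toNNReal)
      = √(lam / Real.pi) * ∫ y, φ y * Real.exp (-lam * y ^ 2) := by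
  have hpi := Real.pi_pos
  have hv : (1 / (2 * lam)).toNNReal ≠ 0 := by
    rw [Ne, Real.toNNReal_eq_zero, not_le]; positivity
  rw [integral_gaussianReal_eq_integral_smul hv, ← integral_const_mul]
  refine integral_congr_ae (Eventually.of_forall fun y => ?_)
  simp only [gaussianPDFReal, smul_eq_mul, sub_zero]
  rw [Real.coe_toNNReal _ (by positivity)]
  have e1 : (√(2 * Real.pi * (1 / (2 * lam))))⁻¹ = √(lam / Real.pi) := by
    rw [← Real.sqrt_inv]; congr 1; field_simp
  have e2 : -y ^ 2 / (2 * (1 / (2 * lam))) = -lam * y ^ 2 := by field_simp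
  rw [e1, e2]; ring

/-! ### Arrays with a Gaussian profile -/

/-- A triangular array of weights satisfying a local limit theorem with total mass `W` around the
point `a`. -/
def GaussianLike (a W lam : ℝ) (q : ℕ → ℕ → ℝ) : Prop :=
  ∃ C c : ℝ, 0 < C ∧ 0 < c ∧ ∀ n : ℕ, 0 < n → ∀ k ≤ n,
    |q n k - W * √(lam / (Real.pi * n)) * Real.exp (-lam * latticePoint a n k ^ 2)|
      ≤ C / n * Real.exp (-c * latticePoint a n k ^ 2)

namespace GaussianLike

variable {a W lam : ℝ} {q : ℕ → ℕ → ℝ}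

/-- Two errors of order `1/√n` add up: replacing `q` by its Gaussian profile costs `C/n` on
effectively `√n` points, and replacing the Riemann sum by the integral costs one mesh. The constant
is chosen before `φ`, which is what a supremum over test functions requires. -/
theorem abs_sum_sub_integral_le (hq : GaussianLike a W lam q) (ha : a ∈ Set.Ioo (0 : ℝ) 1)
    (hl : 0 < lam) (B : ℝ) {s : ℝ} (hs : 0 ≤ s) :
    ∃ C : ℝ, 0 < C ∧ ∀ φ : ℝ → ℝ, ExpLipschitz B s φ → ∀ n : ℕ, 0 < n →
      |∑ k ∈ Finset.range (n + 1), q n k * φ (latticePoint a n k)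
        - W * ∫ y, φ y ∂(gaussianReal 0 (1 / (2 * lam)).toNNReal)| ≤ C / √(n : ℝ) := by
  obtain ⟨C₀, c, hC₀, hc, hq⟩ := hq
  have hpi := Real.pi_pos
  obtain ⟨C₁, hC₁, hsum⟩ := sum_exp_neg_latticePoint_le (half_pos hc) a
  set K := B * Real.exp ((s + 1) ^ 2 / (2 * lam)) +
    Real.exp lam * (B * Real.exp s + B * lam) * Real.exp ((2 * s + 3) ^ 2 / lam) with hK
  obtain ⟨C₂, hR⟩ := abs_riemannSum_sub_integral_le ha (c := lam / 4) (by positivity) K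
  set E := B * Real.exp ((s + 1) ^ 2 / (2 * c)) with hE
  -- The signs of `B` and `C₂` are not known at this point, so the constant is made positive by
  -- hand.
  refine ⟨|C₀ * E * C₁ + |W| * √(lam / Real.pi) * C₂| + 1, by positivity, fun φ hφ n hn => ?_⟩
  have hB := hφ.nonneg
  have hn0 : (0 : ℝ) < n := by exact_mod_cast hn
  have hs0 : 0 < √(n : ℝ) := Real.sqrt_pos.2 hn0
  have hsq : √(n : ℝ) * √(n : ℝ) = n := Real.mul_self_sqrt hn0.le
  have hR' := hR (fun y => φ y * Real.exp (-lam * y ^ 2))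
    (hφ.continuous.mul (by fun_prop)) (fun y => by
      refine (hφ.mul_gaussian_abs_le hs hl y).trans ?_
      have h1 : Real.exp (-(lam / 2) * y ^ 2) ≤ Real.exp (-(lam / 4) * y ^ 2) := by
        gcongr; linarith
      refine mul_le_mul ?_ h1 (Real.exp_pos _).le (by positivity)
      rw [hK]; have : 0 ≤ Real.exp lam * (B * Real.exp s + B * lam) *
        Real.exp ((2 * s + 3) ^ 2 / lam) := by positivity
      linarith) (fun x y hxy => by
      refine (hφ.mul_gaussian_sub_le hs hl hxy).trans ?_
      have : 0 ≤ B * Real.exp ((s + 1) ^ 2 / (2 * lam)) := by positivity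
      gcongr
      rw [hK]; linarith) n hn
  rw [integral_gaussianReal_half_inv hl]
  set I := ∫ y, φ y * Real.exp (-lam * y ^ 2) with hI
  have hsplit : √(lam / (Real.pi * n)) = √(lam / Real.pi) * (1 / √(n : ℝ)) := by
    rw [← div_div, Real.sqrt_div (by positivity)]; ring
  have h1 : |∑ k ∈ Finset.range (n + 1), (q n k * φ (latticePoint a n k) -
      W * √(lam / (Real.pi * n)) * Real.exp (-lam * latticePoint a n k ^ 2) *
        φ (latticePoint a n k))| ≤ C₀ * E * C₁ / √(n : ℝ) := by
    refine (Finset.abs_sum_le_sum_abs _ _).trans ?_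
    have : ∀ k ∈ Finset.range (n + 1), |q n k * φ (latticePoint a n k) -
      W * √(lam / (Real.pi * n)) * Real.exp (-lam * latticePoint a n k ^ 2) *
        φ (latticePoint a n k)| ≤ C₀ / n * E * Real.exp (-(c / 2) * latticePoint a n k ^ 2) := by
      intro k hk
      rw [← sub_mul, abs_mul]
      have hk' : k ≤ n := by have := Finset.mem_range.1 hk; omega
      have h3 := hq n hn k hk'
      have h4 := hφ.abs_le hs (latticePoint a n k)
      have h5 := exp_abs_mul_exp_neg_le hc (s + 1) (latticePoint a n k)
      calc _ ≤ C₀ / n * Real.exp (-c * latticePoint a n k ^ 2) *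
            (B * Real.exp ((s + 1) * |latticePoint a n k|)) := by gcongr
        _ = C₀ / n * B * (Real.exp ((s + 1) * |latticePoint a n k|) *
            Real.exp (-c * latticePoint a n k ^ 2)) := by ring
        _ ≤ C₀ / n * B * (Real.exp ((s + 1) ^ 2 / (2 * c)) *
            Real.exp (-(c / 2) * latticePoint a n k ^ 2)) := by gcongr
        _ = _ := by rw [hE]; ring
    refine (Finset.sum_le_sum this).trans ?_
    rw [← Finset.mul_sum]
    have hE0 : 0 ≤ E := by positivity
    calc _ ≤ C₀ / n * E * (C₁ * √(n : ℝ)) := by gcongr; exact hsum n hn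
      _ = _ := by field_simp; rw [sq, hsq]; ring
  have h2 : |∑ k ∈ Finset.range (n + 1), W * √(lam / (Real.pi * n)) *
      Real.exp (-lam * latticePoint a n k ^ 2) * φ (latticePoint a n k)
      - W * (√(lam / Real.pi) * I)| ≤ |W| * √(lam / Real.pi) * C₂ / √(n : ℝ) := by
    have : ∑ k ∈ Finset.range (n + 1), W * √(lam / (Real.pi * n)) *
      Real.exp (-lam * latticePoint a n k ^ 2) * φ (latticePoint a n k)
      - W * (√(lam / Real.pi) * I) = W * √(lam / Real.pi) * (1 / √(n : ℝ) *
        ∑ k ∈ Finset.range (n + 1), φ (latticePoint a n k) *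
          Real.exp (-lam * latticePoint a n k ^ 2) - I) := by
      rw [hsplit, mul_sub, Finset.mul_sum, Finset.mul_sum]
      congr 1
      · exact Finset.sum_congr rfl fun k _ => by ring
      · ring
    rw [this, abs_mul, abs_mul, abs_of_nonneg (Real.sqrt_nonneg _), mul_div_assoc]
    gcongr
  rw [Finset.sum_sub_distrib] at h1
  calc _ ≤ _ := abs_sub_le _ (∑ k ∈ Finset.range (n + 1), W * √(lam / (Real.pi * n)) *
        Real.exp (-lam * latticePoint a n k ^ 2) * φ (latticePoint a n k)) _
    _ ≤ _ := add_le_add h1 h2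
    _ = (C₀ * E * C₁ + |W| * √(lam / Real.pi) * C₂) / √(n : ℝ) := by ring
    _ ≤ _ := by
      refine div_le_div_of_nonneg_right ?_ hs0.le
      linarith [le_abs_self (C₀ * E * C₁ + |W| * √(lam / Real.pi) * C₂)]

/-- Profile and error are both `O(1/√n)` times a Gaussian, which absorbs the exponential; the
remaining lattice sum is `O(√n)`. These exponential moments control all polynomial moments and all
linearisation errors. -/
theorem sum_abs_mul_exp_le (hq : GaussianLike a W lam q) (hl : 0 < lam) (s : ℝ) :
    ∃ C : ℝ, 0 < C ∧ ∀ n : ℕ, 0 < n →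
      ∑ k ∈ Finset.range (n + 1), |q n k| * Real.exp (s * |latticePoint a n k|) ≤ C := by
  obtain ⟨C₀, c, hC₀, hc, hq⟩ := hq
  have hpi := Real.pi_pos
  set d := min c lam with hd
  have hd0 : 0 < d := lt_min hc hl
  obtain ⟨C₁, hC₁, hsum⟩ := sum_exp_neg_latticePoint_le (half_pos hd0) a
  set K := C₀ + |W| * √(lam / Real.pi) with hK
  have hK0 : 0 < K := by positivity
  refine ⟨K * Real.exp (s ^ 2 / (2 * d)) * C₁, by positivity, fun n hn => ?_⟩
  have hn0 : (0 : ℝ) < n := by exact_mod_cast hn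
  have hs0 : 0 < √(n : ℝ) := Real.sqrt_pos.2 hn0
  have hsplit : √(lam / (Real.pi * n)) = √(lam / Real.pi) * (1 / √(n : ℝ)) := by
    rw [← div_div, Real.sqrt_div (by positivity)]; ring
  have : ∀ k ∈ Finset.range (n + 1), |q n k| * Real.exp (s * |latticePoint a n k|)
      ≤ K / √(n : ℝ) * Real.exp (s ^ 2 / (2 * d)) *
        Real.exp (-(d / 2) * latticePoint a n k ^ 2) := by
    intro k hk
    have hk' : k ≤ n := by have := Finset.mem_range.1 hk; omega
    set y := latticePoint a n k
    have h3 : |q n k - W * √(lam / (Real.pi * n)) * Real.exp (-lam * y ^ 2)|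
      ≤ C₀ / n * Real.exp (-c * y ^ 2) := hq n hn k hk'
    have h4 := abs_add_le (q n k - W * √(lam / (Real.pi * n)) * Real.exp (-lam * y ^ 2))
      (W * √(lam / (Real.pi * n)) * Real.exp (-lam * y ^ 2))
    rw [sub_add_cancel] at h4
    have h5 : |W * √(lam / (Real.pi * n)) * Real.exp (-lam * y ^ 2)|
        = |W| * √(lam / Real.pi) * (1 / √(n : ℝ)) * Real.exp (-lam * y ^ 2) := by
      rw [abs_mul, abs_mul, abs_of_pos (Real.exp_pos _), abs_of_nonneg (Real.sqrt_nonneg _), hsplit]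
      ring
    have h6 : Real.exp (-c * y ^ 2) ≤ Real.exp (-d * y ^ 2) := by
      gcongr; exact min_le_left _ _
    have h7 : Real.exp (-lam * y ^ 2) ≤ Real.exp (-d * y ^ 2) := by
      gcongr; exact min_le_right _ _
    have h8 : |q n k| ≤ K / √(n : ℝ) * Real.exp (-d * y ^ 2) := by
      rw [h5] at h4
      calc |q n k| ≤ C₀ / n * Real.exp (-c * y ^ 2)
            + |W| * √(lam / Real.pi) * (1 / √(n : ℝ)) * Real.exp (-lam * y ^ 2) := by linarith
        _ ≤ C₀ * (1 / √(n : ℝ)) * Real.exp (-d * y ^ 2)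
            + |W| * √(lam / Real.pi) * (1 / √(n : ℝ)) * Real.exp (-d * y ^ 2) := by
          have := one_div_le_one_div_sqrt hn
          rw [div_eq_mul_one_div]
          gcongr
        _ = _ := by rw [hK]; ring
    calc _ ≤ K / √(n : ℝ) * Real.exp (-d * y ^ 2) * Real.exp (s * |y|) := by gcongr
      _ = K / √(n : ℝ) * (Real.exp (s * |y|) * Real.exp (-d * y ^ 2)) := by ring
      _ ≤ K / √(n : ℝ) * (Real.exp (s ^ 2 / (2 * d)) * Real.exp (-(d / 2) * y ^ 2)) := by
        exact mul_le_mul_of_nonneg_left (exp_abs_mul_exp_neg_le hd0 s y) (by positivity)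
      _ = _ := by ring
  refine (Finset.sum_le_sum this).trans ?_
  rw [← Finset.mul_sum]
  calc _ ≤ K / √(n : ℝ) * Real.exp (s ^ 2 / (2 * d)) * (C₁ * √(n : ℝ)) := by
        gcongr; exact hsum n hn
    _ = _ := by field_simp

end GaussianLike
end CubicIsing

/-! ### The local limit theorem at a nondegenerate maximum -/

namespace CubicIsing

/-- The second order Taylor expansion at a critical point, with cubic error. -/
lemma abs_sub_quadratic_le {A A' A'' : ℝ → ℝ} {a η K : ℝ} (hK : 0 ≤ K)
    (h1 : ∀ x, |x - a| ≤ η → HasDerivAt A (A' x) x)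
    (h2 : ∀ x, |x - a| ≤ η → HasDerivAt A' (A'' x) x)
    (h3 : ∀ x, |x - a| ≤ η → |A'' x - A'' a| ≤ K * |x - a|) (ha : A' a = 0)
    {x : ℝ} (hx : |x - a| ≤ η) : |A x - A a - A'' a / 2 * (x - a) ^ 2| ≤ K * |x - a| ^ 3 := by
  have hseg : ∀ {x : ℝ}, ∀ t ∈ Set.uIcc a x, |t - a| ≤ |x - a| := fun t ht =>
    Set.abs_sub_left_of_mem_uIcc ht
  -- The mean value inequality is applied on the segment from `a` to `x`, here to `A'` and below to
  -- `A`; the factor `1/6` of Taylor's formula is not needed.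
  have step1 : ∀ x, |x - a| ≤ η → |A' x - A'' a * (x - a)| ≤ K * |x - a| * |x - a| := by
    intro x hx
    have := (convex_uIcc a x).norm_image_sub_le_of_norm_hasDerivWithin_le
      (f := fun t => A' t - A'' a * (t - a)) (f' := fun t => A'' t - A'' a) (C := K * |x - a|)
      (fun t ht => by
        have hd := (h2 t ((hseg t ht).trans hx)).sub
          (((hasDerivAt_id t).sub_const a).const_mul (A'' a))
        simp only [id, mul_one] at hd
        exact hd.hasDerivWithinAt)
      (fun t ht => by
        rw [Real.norm_eq_abs]
        exact (h3 t ((hseg t ht).trans hx)).trans (mul_le_mul_of_nonneg_left (hseg t ht) hK))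
      Set.left_mem_uIcc Set.right_mem_uIcc
    simpa [ha] using this
  have := (convex_uIcc a x).norm_image_sub_le_of_norm_hasDerivWithin_le
      (f := fun t => A t - A'' a / 2 * (t - a) ^ 2) (f' := fun t => A' t - A'' a * (t - a))
      (C := K * |x - a| * |x - a|)
      (fun t ht => by
        have hd := (h1 t ((hseg t ht).trans hx)).sub
          ((((hasDerivAt_id t).sub_const a).pow 2).const_mul (A'' a / 2))
        refine (hd.congr_deriv ?_).hasDerivWithinAt
        simp; ring)
      (fun t ht => by
        rw [Real.norm_eq_abs]
        refine (step1 t ((hseg t ht).trans hx)).trans ?_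
        have := hseg t ht
        gcongr)
      Set.left_mem_uIcc Set.right_mem_uIcc
  simp only [sub_self, Real.norm_eq_abs] at this
  calc _ = |A x - A'' a / 2 * (x - a) ^ 2 - (A a - A'' a / 2 * 0 ^ 2)| := by congr 1; ring
    _ ≤ _ := this
    _ = _ := by ring

/-- A strict maximum on a compact set with a nondegenerate quadratic expansion is quadratically
separated. -/
lemma exists_le_sub_mul_sq {A : ℝ → ℝ} {a lam K η : ℝ} {D : Set ℝ} (hD : IsCompact D)
    (hA : ContinuousOn A D) (hl : 0 < lam) (hη : 0 < η)
    (hexp : ∀ x, |x - a| ≤ η → |A x - A a + lam * (x - a) ^ 2| ≤ K * |x - a| ^ 3)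
    (hmax : ∀ x ∈ D, x ≠ a → A x < A a) :
    ∃ c : ℝ, 0 < c ∧ ∀ x ∈ D, A x ≤ A a - c * (x - a) ^ 2 := by
  -- Within this radius the cubic error uses up at most half of the quadratic term. Beyond it,
  -- compactness leaves a positive gap, which is spread over the bounded values of `(x - a)²`.
  set η₀ := min η (lam / (2 * (|K| + 1))) with hη₀
  have hη₀0 : 0 < η₀ := lt_min hη (by positivity)
  have hnear : ∀ x, |x - a| ≤ η₀ → A x ≤ A a - lam / 2 * (x - a) ^ 2 := by
    intro x hx
    have h1 := (abs_le.1 (hexp x (hx.trans (min_le_left _ _)))).2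
    have h2 : |x - a| ≤ lam / (2 * (|K| + 1)) := hx.trans (min_le_right _ _)
    rw [le_div_iff₀ (by positivity)] at h2
    have h3 : K * |x - a| ^ 3 ≤ lam / 2 * |x - a| ^ 2 := by
      have : K * |x - a| ≤ lam / 2 := by
        nlinarith [le_abs_self K, abs_nonneg (x - a), abs_nonneg K]
      calc K * |x - a| ^ 3 = K * |x - a| * |x - a| ^ 2 := by ring
        _ ≤ _ := by gcongr
    rw [sq_abs] at h3
    linarith
  set E := D ∩ {x | η₀ ≤ |x - a|} with hE
  have hEc : IsCompact E := hD.inter_right (isClosed_le continuous_const (by fun_prop))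
  obtain ⟨R, hR⟩ := hD.isBounded.subset_closedBall a
  rcases E.eq_empty_or_nonempty with hemp | hne
  · refine ⟨lam / 2, by positivity, fun x hx => hnear x ?_⟩
    by_contra hcon
    have : x ∈ E := ⟨hx, (not_le.1 hcon).le⟩
    rw [hemp] at this
    exact this
  · obtain ⟨x₀, hx₀, hx₀m⟩ := hEc.exists_isMaxOn hne (hA.mono Set.inter_subset_left)
    have hx₀a : x₀ ≠ a := by
      rintro rfl
      have := hx₀.2
      simp only [Set.mem_ofPred_eq, sub_self, abs_zero] at this
      linarith
    have hgap : 0 < A a - A x₀ := sub_pos.2 (hmax x₀ hx₀.1 hx₀a)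
    have hR0 : 0 ≤ R ^ 2 := sq_nonneg R
    refine ⟨min (lam / 2) ((A a - A x₀) / (R ^ 2 + 1)), lt_min (by positivity) (by positivity),
      fun x hx => ?_⟩
    by_cases hc : |x - a| ≤ η₀
    · have := hnear x hc
      have h2 := mul_le_mul_of_nonneg_right
        (min_le_left (lam / 2) ((A a - A x₀) / (R ^ 2 + 1))) (sq_nonneg (x - a))
      linarith
    · have h1 : A x ≤ A x₀ := hx₀m (show x ∈ E from ⟨hx, (not_le.1 hc).le⟩)
      have h2 : (x - a) ^ 2 ≤ R ^ 2 + 1 := by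
        have := hR hx
        rw [Metric.mem_closedBall, Real.dist_eq] at this
        rw [← sq_abs]
        nlinarith [abs_nonneg (x - a)]
      have h3 : min (lam / 2) ((A a - A x₀) / (R ^ 2 + 1)) * (x - a) ^ 2 ≤ A a - A x₀ := by
        calc _ ≤ (A a - A x₀) / (R ^ 2 + 1) * (R ^ 2 + 1) := by
              gcongr; exact min_le_right _ _
          _ = _ := by field_simp
      linarith

lemma abs_log_sub_log_le {p q δ : ℝ} (hδ : 0 < δ) (hp : δ ≤ p) (hq : δ ≤ q) :
    |Real.log p - Real.log q| ≤ |p - q| / δ := by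
  have key : ∀ {p q : ℝ}, δ ≤ p → δ ≤ q → Real.log p - Real.log q ≤ |p - q| / δ := by
    intro p q hp hq
    have hq0 := hδ.trans_le hq
    have hp0 := hδ.trans_le hp
    rw [← Real.log_div hp0.ne' hq0.ne']
    calc _ ≤ p / q - 1 := Real.log_le_sub_one_of_pos (by positivity)
      _ = (p - q) / q := by field_simp
      _ ≤ |p - q| / q := by gcongr; exact le_abs_self _
      _ ≤ _ := by gcongr
  rw [abs_le]
  constructor
  · have := key hq hp; rw [abs_sub_comm] at this; linarith
  · exact key hp hq

/-- The weights of the levels in `D`, normalised by the value of `A = F + I` at `a`. -/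
noncomputable def peakWeight (F : ℝ → ℝ) (a : ℝ) (D : Set ℝ) (n k : ℕ) : ℝ :=
  D.indicator (fun _ => levelWeight n F k * Real.exp (-(n * (F a + Real.binEntropy a)))) (k / n : ℝ)

lemma peakWeight_nonneg (F : ℝ → ℝ) (a : ℝ) (D : Set ℝ) (n k : ℕ) : 0 ≤ peakWeight F a D n k :=
  Set.indicator_nonneg (fun _ _ => mul_nonneg (levelWeight_nonneg _ _ _) (Real.exp_pos _).le) _

lemma natCast_mul_sub_sq (a : ℝ) {n : ℕ} (k : ℕ) :
    (n : ℝ) * ((k : ℝ) / n - a) ^ 2 = latticePoint a n k ^ 2 := by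
  rw [latticePoint, mul_pow, Real.sq_sqrt (by positivity)]

lemma levelWeight_le {n k : ℕ} (F : ℝ → ℝ) (hn : 0 < n) (hk : k ≤ n) :
    levelWeight n F k ≤ Real.exp (n * (F (k / n) + Real.binEntropy (k / n))) := by
  rw [levelWeight, mul_add, add_comm, Real.exp_add]
  exact mul_le_mul_of_nonneg_right (choose_le_exp_binEntropy hn hk) (Real.exp_pos _).le

set_option maxHeartbeats 1000000 in
/-- Local limit theorem around a nondegenerate maximum. -/
theorem gaussianLike_peakWeight {F : ℝ → ℝ} {a lam : ℝ} (ha : a ∈ Set.Ioo (0 : ℝ) 1)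
    (hl : 0 < lam) {D : Set ℝ} {η K ρ c : ℝ} (hη : 0 < η) (hρ : 0 < ρ) (hc : 0 < c)
    (hexp : ∀ x, |x - a| ≤ η → |F x + Real.binEntropy x - (F a + Real.binEntropy a)
      + lam * (x - a) ^ 2| ≤ K * |x - a| ^ 3)
    (hD : ∀ x, |x - a| ≤ ρ → x ∈ D)
    (hquad : ∀ x ∈ D, x ∈ Set.Icc (0 : ℝ) 1 →
      F x + Real.binEntropy x ≤ F a + Real.binEntropy a - c * (x - a) ^ 2) :
    GaussianLike a (1 / √(2 * lam * (a * (1 - a)))) lam (peakWeight F a D) := by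
  have hpi := Real.pi_pos
  obtain ⟨ha0, ha1⟩ := ha
  set W := 1 / √(2 * lam * (a * (1 - a))) with hW
  have ha1' : 0 < 1 - a := by linarith
  -- Within `δ` of `a` both `x` and `1 - x` are at least `δ`, so the Stirling error `1/k + 1/(n-k)`
  -- is `O(1/n)`.
  set δ := min (a / 2) ((1 - a) / 2) with hδ
  have hδ0 : 0 < δ := lt_min (by linarith) (by linarith)
  have hδ1 : δ ≤ a / 2 := min_le_left _ _
  have hδ2 : δ ≤ (1 - a) / 2 := min_le_right _ _
  set r := min (min η ρ) δ with hr
  have hr0 : 0 < r := lt_min (lt_min hη hρ) hδ0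
  set d := min c lam with hd
  have hd0 : 0 < d := lt_min hc hl
  have hdc' : d ≤ c := min_le_left _ _
  have hdl' : d ≤ lam := min_le_right _ _
  have hrδ : r ≤ δ := min_le_right _ _
  have hrη : r ≤ η := (min_le_left _ _).trans (min_le_left _ _)
  have hrρ : r ≤ ρ := (min_le_left _ _).trans (min_le_right _ _)
  set M := 2 / δ + 6 * |K| + 1 / (2 * δ ^ 2) with hM
  have hM0 : 0 < M := by positivity
  set M₂ := 2 / δ - Real.log δ with hM₂
  set C' := M * Real.exp M₂ + 2 / r ^ 2 * (1 + W * √(lam / Real.pi)) with hC'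
  have hW0 : 0 ≤ W := by positivity
  have hC'0 : 0 < C' := by positivity
  refine ⟨C' * Real.exp (1 ^ 2 / (2 * d)), d / 2, by positivity, by positivity, fun n hn k hk => ?_⟩
  have hn0 : (0 : ℝ) < n := by exact_mod_cast hn
  have hs0 : 0 < √(n : ℝ) := Real.sqrt_pos.2 hn0
  have hsq : √(n : ℝ) * √(n : ℝ) = n := Real.mul_self_sqrt hn0.le
  set y := latticePoint a n k with hy
  set x := (k : ℝ) / n with hx
  have hx01 : x ∈ Set.Icc (0 : ℝ) 1 :=
    ⟨by positivity, div_le_one_of_le₀ (by exact_mod_cast hk) hn0.le⟩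
  have hyx : n * (x - a) ^ 2 = y ^ 2 := natCast_mul_sub_sq a k
  have hlw := levelWeight_le F hn hk
  rw [← hx] at hlw
  have hxa : |x - a| = |y| / √(n : ℝ) := by
    rw [hy, latticePoint, abs_mul, abs_of_pos hs0, ← hx]; field_simp
  clear_value x y δ r d M M₂ C' W
  -- Powers of `|y|` in the error will be bounded by multiples of `exp |y|`, which then costs only
  -- half of the Gaussian exponent.
  suffices hsuff : |peakWeight F a D n k - W * √(lam / (Real.pi * n)) * Real.exp (-lam * y ^ 2)|
      ≤ C' / n * (Real.exp (1 * |y|) * Real.exp (-d * y ^ 2)) by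
    refine hsuff.trans ?_
    calc _ ≤ C' / n * (Real.exp (1 ^ 2 / (2 * d)) * Real.exp (-(d / 2) * y ^ 2)) :=
          mul_le_mul_of_nonneg_left (exp_abs_mul_exp_neg_le hd0 _ _) (by positivity)
      _ = _ := by ring
  rw [one_mul]
  have hdc : Real.exp (-c * y ^ 2) ≤ Real.exp (-d * y ^ 2) := by gcongr
  have hdl : Real.exp (-lam * y ^ 2) ≤ Real.exp (-d * y ^ 2) := by gcongr
  have hupper : peakWeight F a D n k ≤ Real.exp (-c * y ^ 2) := by
    by_cases hxD : x ∈ D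
    · rw [peakWeight, ← hx, Set.indicator_of_mem hxD]
      calc _ ≤ Real.exp (n * (F x + Real.binEntropy x)) *
            Real.exp (-(n * (F a + Real.binEntropy a))) := by
            gcongr
        _ ≤ _ := by
          rw [← Real.exp_add, Real.exp_le_exp, ← hyx]
          have := mul_le_mul_of_nonneg_left (hquad x hxD hx01) hn0.le
          linarith
    · rw [peakWeight, ← hx, Set.indicator_of_notMem hxD]; positivity
  have hsplit : √(lam / (Real.pi * n)) ≤ √(lam / Real.pi) := by
    apply Real.sqrt_le_sqrt
    have : (1 : ℝ) ≤ n := by exact_mod_cast hn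
    gcongr
    exact le_mul_of_one_le_right hpi.le this
  by_cases hnear : |x - a| ≤ r
  · have hxδ : δ ≤ x := by
      have := (abs_le.1 (hnear.trans hrδ)).1; linarith
    have hxδ' : δ ≤ 1 - x := by
      have := (abs_le.1 (hnear.trans hrδ)).2; linarith
    have hxD : x ∈ D := hD x (hnear.trans hrρ)
    have hkx : (k : ℝ) = n * x := by rw [hx]; field_simp
    have hk0 : 0 < k := by
      have : (0 : ℝ) < k := by rw [hkx]; exact mul_pos hn0 (hδ0.trans_le hxδ)
      exact_mod_cast this
    have hkn : k < n := by
      have : (k : ℝ) < n := by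
        rw [hkx]; exact mul_lt_of_lt_one_right hn0 (by linarith)
      exact_mod_cast this
    have hch := abs_log_choose_sub_le hk0 hkn
    rw [← hx] at hch
    have herr : 1 / (k : ℝ) + 1 / ((n : ℝ) - k) ≤ 2 / δ / n := by
      have e1 : 1 / (k : ℝ) ≤ 1 / (δ * n) := by
        apply one_div_le_one_div_of_le (by positivity)
        rw [hkx, mul_comm]; exact mul_le_mul_of_nonneg_left hxδ hn0.le
      have e2 : 1 / ((n : ℝ) - k) ≤ 1 / (δ * n) := by
        apply one_div_le_one_div_of_le (by positivity)
        have := mul_le_mul_of_nonneg_left hxδ' hn0.le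
        rw [hkx]; linarith
      calc _ ≤ 1 / (δ * n) + 1 / (δ * n) := add_le_add e1 e2
        _ = _ := by field_simp; norm_num
    set u := Real.log (n.choose k) + n * F x - n * (F a + Real.binEntropy a) with hu
    set v := -(Real.log (2 * Real.pi * n) / 2) - Real.log (a * (1 - a)) / 2 - lam * y ^ 2 with hv
    have hqu : peakWeight F a D n k = Real.exp u := by
      rw [peakWeight, ← hx, Set.indicator_of_mem hxD, levelWeight, ← hx, hu, sub_eq_add_neg, Real.exp_add,
        Real.exp_add, Real.exp_log]
      exact_mod_cast Nat.choose_pos hk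
    have hgv : W * √(lam / (Real.pi * n)) * Real.exp (-lam * y ^ 2) = Real.exp v := by
      rw [hv, sub_eq_add_neg _ (lam * y ^ 2), Real.exp_add, neg_mul]
      congr 1
      have h1 : -(Real.log (2 * Real.pi * n) / 2) - Real.log (a * (1 - a)) / 2
          = -(Real.log (2 * Real.pi * n * (a * (1 - a))) / 2) := by
        rw [Real.log_mul (x := 2 * Real.pi * n) (by positivity) (by positivity)]; ring
      rw [h1, ← Real.log_sqrt (by positivity), ← Real.log_inv, Real.exp_log (by positivity), hW,
        one_div, ← Real.sqrt_inv, ← Real.sqrt_inv, ← Real.sqrt_mul (by positivity)]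
      congr 1
      field_simp
    have hx1x : δ ^ 2 ≤ x * (1 - x) := by
      rw [sq]; exact mul_le_mul hxδ hxδ' hδ0.le hx01.1
    have ha1a : δ ^ 2 ≤ a * (1 - a) := by
      rw [sq]; exact mul_le_mul (by linarith) (by linarith) hδ0.le ha0.le
    have hlogd : |Real.log (x * (1 - x)) - Real.log (a * (1 - a))| ≤ |x - a| / δ ^ 2 := by
      refine (abs_log_sub_log_le (by positivity) hx1x ha1a).trans ?_
      have : x * (1 - x) - a * (1 - a) = (x - a) * (1 - x - a) := by ring
      rw [this, abs_mul]
      gcongr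
      have : |1 - x - a| ≤ 1 := by rw [abs_le]; constructor <;> linarith [hx01.1, hx01.2]
      exact mul_le_of_le_one_right (abs_nonneg _) this
    have hlog1 : 2 * Real.log δ ≤ Real.log (x * (1 - x)) := by
      have := Real.log_le_log (by positivity) hx1x
      rwa [Real.log_pow] at this
    have hlog2 : 2 * Real.log δ ≤ Real.log (a * (1 - a)) := by
      have := Real.log_le_log (by positivity) ha1a
      rwa [Real.log_pow] at this
    have hlog2pi : Real.log n ≤ Real.log (2 * Real.pi * n) := by
      apply Real.log_le_log hn0
      exact le_mul_of_one_le_left hn0.le (by linarith [Real.pi_gt_three])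
    have hd2 : 2 / δ / (n : ℝ) ≤ 2 / δ := by
      apply div_le_self (by positivity); exact_mod_cast hn
    -- A common upper bound for the logarithms `u` and `v` of the weight and of its Gaussian
    -- profile. Since `exp w` is `O(1/√n)` times a Gaussian and `|u - v|` is `O(exp |y| / √n)`, the
    -- difference of the exponentials is of order `1/n`.
    set w := -(Real.log n / 2) + M₂ - d * y ^ 2 with hw
    have hdlam : d * y ^ 2 ≤ lam * y ^ 2 := by gcongr
    have hdcc : d * y ^ 2 ≤ c * y ^ 2 := by gcongr
    have h2δ : 0 < 2 / δ := by positivity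
    have hvw : v ≤ w := by rw [hv, hw, hM₂]; linarith
    have huw : u ≤ w := by
      have h1 := (abs_le.1 hch).2
      have h2 := mul_le_mul_of_nonneg_left (hquad x hxD hx01) hn0.le
      have h3 : (n : ℝ) * (F a + Real.binEntropy a - c * (x - a) ^ 2)
        = n * (F a + Real.binEntropy a) - c * y ^ 2 := by rw [← hyx]; ring
      rw [hu, hw, hM₂]
      linarith
    -- Three sources of error: Stirling, `O(1/n)`; the cubic Taylor remainder, `n|x - a|³ =
    -- |y|³/√n`; and freezing the prefactor `x(1-x)` at `a`, `O(|y|/√n)`.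
    have huv : |u - v| ≤ M / √(n : ℝ) * Real.exp |y| := by
      have e : u - v = (Real.log (n.choose k) - (n * Real.binEntropy x
          - Real.log (2 * Real.pi * n) / 2 - Real.log (x * (1 - x)) / 2))
          + n * (F x + Real.binEntropy x - (F a + Real.binEntropy a) + lam * (x - a) ^ 2)
          - (Real.log (x * (1 - x)) - Real.log (a * (1 - a))) / 2 := by
        rw [hu, hv, ← hyx]; ring
      have t1 : |n * (F x + Real.binEntropy x - (F a + Real.binEntropy a) + lam * (x - a) ^ 2)|
          ≤ |K| * |y| ^ 3 / √(n : ℝ) := by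
        rw [abs_mul, abs_of_pos hn0]
        calc _ ≤ n * (K * |x - a| ^ 3) := by
              gcongr; exact hexp x (hnear.trans hrη)
          _ ≤ n * (|K| * |x - a| ^ 3) := by gcongr; exact le_abs_self K
          _ = _ := by
            rw [hxa]; nth_rewrite 1 [← hsq]; field_simp
      have t2 : |(Real.log (x * (1 - x)) - Real.log (a * (1 - a))) / 2|
          ≤ 1 / (2 * δ ^ 2) * |y| / √(n : ℝ) := by
        rw [abs_div, abs_two, div_le_iff₀ two_pos]
        refine hlogd.trans (le_of_eq ?_)
        rw [hxa]; field_simp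
      have t3 : 2 / δ / n ≤ 2 / δ / √(n : ℝ) := by
        have := one_div_le_one_div_sqrt hn
        rw [div_eq_mul_one_div, div_eq_mul_one_div _ (√(n : ℝ))]
        gcongr
      have y1 : 1 ≤ Real.exp |y| := Real.one_le_exp (abs_nonneg y)
      have y2 : |y| ≤ Real.exp |y| := by linarith [Real.add_one_le_exp |y|]
      have y3 : |y| ^ 3 ≤ 6 * Real.exp |y| := by
        have := abs_pow_le_factorial_mul_exp y 3
        norm_num [Nat.factorial] at this; exact this
      rw [e]
      calc _ ≤ 1 / (k : ℝ) + 1 / ((n : ℝ) - k) + |K| * |y| ^ 3 / √(n : ℝ)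
            + 1 / (2 * δ ^ 2) * |y| / √(n : ℝ) :=
            (abs_sub _ _).trans (add_le_add ((abs_add_le _ _).trans (add_le_add hch t1)) t2)
        _ ≤ 2 / δ / √(n : ℝ) + |K| * |y| ^ 3 / √(n : ℝ)
            + 1 / (2 * δ ^ 2) * |y| / √(n : ℝ) := by linarith
        _ = (2 / δ * 1 + |K| * |y| ^ 3 + 1 / (2 * δ ^ 2) * |y|) / √(n : ℝ) := by ring
        _ ≤ (2 / δ * Real.exp |y| + |K| * (6 * Real.exp |y|) + 1 / (2 * δ ^ 2) * Real.exp |y|)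
            / √(n : ℝ) := by gcongr
        _ = _ := by rw [hM]; ring
    have hexpw : Real.exp w = 1 / √(n : ℝ) * Real.exp M₂ * Real.exp (-d * y ^ 2) := by
      have : w = -(Real.log n / 2) + M₂ + -d * y ^ 2 := by rw [hw]; ring
      rw [this, Real.exp_add, Real.exp_add, ← Real.log_sqrt hn0.le, Real.exp_neg,
        Real.exp_log hs0, one_div]
    rw [hqu, hgv]
    calc _ ≤ |u - v| * Real.exp w := abs_exp_sub_exp_le huw hvw
      _ ≤ M / √(n : ℝ) * Real.exp |y| * (1 / √(n : ℝ) * Real.exp M₂ * Real.exp (-d * y ^ 2)) := by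
        rw [hexpw]; gcongr
      _ = M * Real.exp M₂ / (√(n : ℝ) * √(n : ℝ)) * (Real.exp |y| * Real.exp (-d * y ^ 2)) := by
        field_simp
      _ ≤ _ := by
        rw [hsq]
        refine mul_le_mul_of_nonneg_right ?_ (by positivity)
        refine div_le_div_of_nonneg_right ?_ hn0.le
        rw [hC']
        have : 0 ≤ 2 / r ^ 2 * (1 + W * √(lam / Real.pi)) := by positivity
        linarith
  -- Far from the peak `y² > r²n`, so the missing factor `1/n` is bought with `y² ≤ 2 exp |y|`; no
  -- cancellation between weight and profile is used.
  · have hfar : 1 ≤ 2 / r ^ 2 / n * Real.exp |y| := by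
      have h1 : r ^ 2 * n ≤ y ^ 2 := by
        rw [← hyx, ← sq_abs (x - a), mul_comm]
        have := (not_le.1 hnear).le
        gcongr
      have h2 : y ^ 2 ≤ 2 * Real.exp |y| := by
        have := abs_pow_le_factorial_mul_exp y 2
        norm_num [Nat.factorial] at this; exact this
      rw [div_div, div_mul_eq_mul_div, le_div_iff₀ (by positivity)]
      linarith
    have h1 : |peakWeight F a D n k - W * √(lam / (Real.pi * n)) * Real.exp (-lam * y ^ 2)|
        ≤ (1 + W * √(lam / Real.pi)) * Real.exp (-d * y ^ 2) := by
      refine (abs_sub _ _).trans ?_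
      rw [abs_of_nonneg (peakWeight_nonneg _ _ _ _ _), abs_of_nonneg (by positivity), add_mul,
        one_mul]
      refine add_le_add (hupper.trans hdc) ?_
      gcongr
    calc _ ≤ 1 * ((1 + W * √(lam / Real.pi)) * Real.exp (-d * y ^ 2)) := by rw [one_mul]; exact h1
      _ ≤ 2 / r ^ 2 / n * Real.exp |y| * ((1 + W * √(lam / Real.pi)) * Real.exp (-d * y ^ 2)) :=
        mul_le_mul_of_nonneg_right hfar (by positivity)
      _ = 2 / r ^ 2 * (1 + W * √(lam / Real.pi)) / n * (Real.exp |y| * Real.exp (-d * y ^ 2)) := by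
        ring
      _ ≤ _ := by
        refine mul_le_mul_of_nonneg_right ?_ (by positivity)
        refine div_le_div_of_nonneg_right ?_ hn0.le
        rw [hC']
        have : 0 ≤ M * Real.exp M₂ := by positivity
        linarith

end CubicIsing

/-! ### Normalised sums and concentration -/

namespace CubicIsing

lemma expLipschitz_of_lipschitz {φ : ℝ → ℝ} {B : ℝ} (h : ∀ x y, |φ x - φ y| ≤ B * |x - y|)
    (h0 : |φ 0| ≤ B) : ExpLipschitz B 0 φ :=
  ⟨fun x y => by simpa using h x y, h0⟩

lemma integrable_exp_abs_gaussianReal (s : ℝ) (v : NNReal) :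
    Integrable (fun y => Real.exp (s * |y|)) (gaussianReal 0 v) := by
  refine ((integrable_exp_mul_gaussianReal (μ := 0) (v := v) s).add
    (integrable_exp_mul_gaussianReal (μ := 0) (v := v) (-s))).mono'
    (by fun_prop) (Eventually.of_forall fun y => ?_)
  rw [Real.norm_eq_abs, abs_of_pos (Real.exp_pos _), Pi.add_apply]
  rcases abs_cases y with ⟨h, _⟩ | ⟨h, _⟩
  · rw [h]; linarith [Real.exp_pos (-s * y)]
  · rw [h, mul_neg, ← neg_mul]; linarith [Real.exp_pos (s * y)]

lemma ExpLipschitz.abs_integral_le {B s : ℝ} (hs : 0 ≤ s) (v : NNReal) {φ : ℝ → ℝ}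
    (h : ExpLipschitz B s φ) : |∫ y, φ y ∂(gaussianReal 0 v)|
      ≤ B * ∫ y, Real.exp ((s + 1) * |y|) ∂(gaussianReal 0 v) := by
  rw [← integral_const_mul, ← Real.norm_eq_abs]
  exact norm_integral_le_of_norm_le ((integrable_exp_abs_gaussianReal _ _).const_mul _)
    (Eventually.of_forall fun y => h.abs_le hs y)

lemma ExpLipschitz.integrable {B s : ℝ} (hs : 0 ≤ s) (v : NNReal) {φ : ℝ → ℝ}
    (h : ExpLipschitz B s φ) : Integrable φ (gaussianReal 0 v) :=
  ((integrable_exp_abs_gaussianReal (s + 1) v).const_mul B).mono' h.continuous.aestronglyMeasurable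
    (Eventually.of_forall fun y => h.abs_le hs y)

lemma tendsto_div_sqrt (C : ℝ) : Tendsto (fun n : ℕ => C / √(n : ℝ)) atTop (𝓝 0) :=
  Tendsto.const_div_atTop (Real.tendsto_sqrt_atTop.comp tendsto_natCast_atTop_atTop) C

lemma tendsto_of_abs_sub_le_div_sqrt {u : ℕ → ℝ} {L C : ℝ}
    (h : ∀ n : ℕ, 0 < n → |u n - L| ≤ C / √(n : ℝ)) : Tendsto u atTop (𝓝 L) := by
  rw [tendsto_iff_norm_sub_tendsto_zero]
  refine squeeze_zero' (Eventually.of_forall fun _ => norm_nonneg _) ?_ (tendsto_div_sqrt C)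
  filter_upwards [eventually_gt_atTop 0] with n hn using h n hn

/-- A positive sequence with a positive limit is bounded below, from index one on. -/
lemma exists_pos_le_of_tendsto {u : ℕ → ℝ} {L : ℝ} (h : Tendsto u atTop (𝓝 L)) (hL : 0 < L)
    (hu : ∀ n, 0 < n → 0 < u n) : ∃ c : ℝ, 0 < c ∧ ∀ n : ℕ, 0 < n → c ≤ u n := by
  obtain ⟨N, hN⟩ := eventually_atTop.1 (h.eventually (lt_mem_nhds (half_lt_self hL)))
  have key : ∀ N : ℕ, ∃ c : ℝ, 0 < c ∧ ∀ n : ℕ, 0 < n → n < N → c ≤ u n := by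
    intro N
    induction N with
    | zero => exact ⟨1, one_pos, fun n _ h => absurd h (Nat.not_lt_zero n)⟩
    | succ N ih =>
      obtain ⟨c, hc, h⟩ := ih
      rcases Nat.eq_zero_or_pos N with rfl | hN
      · exact ⟨c, hc, fun n h1 h2 => by omega⟩
      · refine ⟨min c (u N), lt_min hc (hu N hN), fun n h1 h2 => ?_⟩
        rcases Nat.lt_succ_iff_lt_or_eq.1 h2 with h3 | rfl
        · exact (min_le_left _ _).trans (h n h1 h3)
        · exact min_le_right _ _
  obtain ⟨c, hc, hcN⟩ := key N
  refine ⟨min c (L / 2), lt_min hc (half_pos hL), fun n hn => ?_⟩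
  by_cases h' : n < N
  · exact (min_le_left _ _).trans (hcN n hn h')
  · exact (min_le_right _ _).trans (hN n (not_lt.1 h')).le

namespace GaussianLike

variable {a W lam : ℝ} {q : ℕ → ℕ → ℝ}

theorem abs_sum_sub_le (hq : GaussianLike a W lam q) (ha : a ∈ Set.Ioo (0 : ℝ) 1)
    (hl : 0 < lam) : ∃ C : ℝ, 0 < C ∧ ∀ n : ℕ, 0 < n →
      |∑ k ∈ Finset.range (n + 1), q n k - W| ≤ C / √(n : ℝ) := by
  obtain ⟨C, hC, h⟩ := hq.abs_sum_sub_integral_le ha hl 1 le_rfl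
  refine ⟨C, hC, fun n hn => ?_⟩
  simpa using h (fun _ => 1) (expLipschitz_of_lipschitz (by simp) (by simp)) n hn

theorem tendsto_sum (hq : GaussianLike a W lam q) (ha : a ∈ Set.Ioo (0 : ℝ) 1)
    (hl : 0 < lam) : Tendsto (fun n => ∑ k ∈ Finset.range (n + 1), q n k) atTop (𝓝 W) := by
  obtain ⟨C, _, h⟩ := hq.abs_sum_sub_le ha hl
  exact tendsto_of_abs_sub_le_div_sqrt h

theorem sum_mul_abs_pow_le (hq : GaussianLike a W lam q) (hl : 0 < lam) (l : ℕ) :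
    ∃ C : ℝ, 0 < C ∧ ∀ n : ℕ, 0 < n →
      ∑ k ∈ Finset.range (n + 1), |q n k| * |latticePoint a n k| ^ l ≤ C := by
  obtain ⟨C, hC, h⟩ := hq.sum_abs_mul_exp_le hl 1
  refine ⟨l.factorial * C, by positivity, fun n hn => ?_⟩
  calc _ ≤ ∑ k ∈ Finset.range (n + 1),
        l.factorial * (|q n k| * Real.exp (1 * |latticePoint a n k|)) := by
        refine Finset.sum_le_sum fun k _ => ?_
        rw [one_mul, mul_left_comm]
        gcongr
        exact abs_pow_le_factorial_mul_exp _ _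
    _ ≤ _ := by rw [← Finset.mul_sum]; gcongr; exact h n hn

/-- Normalised sums converge to Gaussian integrals with rate `1/√n`, uniformly. -/
theorem abs_ratio_sub_integral_le (hq : GaussianLike a W lam q) (ha : a ∈ Set.Ioo (0 : ℝ) 1)
    (hl : 0 < lam) (B : ℝ) {s c₀ : ℝ} (hs : 0 ≤ s) (hc₀ : 0 < c₀) :
    ∃ C : ℝ, 0 < C ∧ ∀ φ : ℝ → ℝ, ExpLipschitz B s φ → ∀ n : ℕ, 0 < n →
      c₀ ≤ ∑ k ∈ Finset.range (n + 1), q n k →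
      |(∑ k ∈ Finset.range (n + 1), q n k * φ (latticePoint a n k))
          / (∑ k ∈ Finset.range (n + 1), q n k)
        - ∫ y, φ y ∂(gaussianReal 0 (1 / (2 * lam)).toNNReal)| ≤ C / √(n : ℝ) := by
  obtain ⟨C₁, hC₁, h1⟩ := hq.abs_sum_sub_integral_le ha hl B hs
  obtain ⟨C₂, hC₂, h2⟩ := hq.abs_sum_sub_le ha hl
  set J := ∫ y, Real.exp ((s + 1) * |y|) ∂(gaussianReal 0 (1 / (2 * lam)).toNNReal) with hJ
  have hJ0 : 0 ≤ J := integral_nonneg fun _ => (Real.exp_pos _).le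
  refine ⟨(C₁ + |B| * J * C₂) / c₀, by positivity, fun φ hφ n hn hc => ?_⟩
  set I := ∫ y, φ y ∂(gaussianReal 0 (1 / (2 * lam)).toNNReal) with hI
  set S := ∑ k ∈ Finset.range (n + 1), q n k
  set T := ∑ k ∈ Finset.range (n + 1), q n k * φ (latticePoint a n k)
  have hS : 0 < S := hc₀.trans_le hc
  have hIb : |I| ≤ |B| * J := (hφ.abs_integral_le hs _).trans (by gcongr; exact le_abs_self B)
  have e : T / S - I = ((T - W * I) - I * (S - W)) / S := by field_simp; ring
  have hn0 : 0 < √(n : ℝ) := Real.sqrt_pos.2 (by exact_mod_cast hn)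
  rw [e, abs_div, abs_of_pos hS]
  calc _ ≤ (C₁ / √(n : ℝ) + |B| * J * (C₂ / √(n : ℝ))) / c₀ := by
        refine div_le_div₀ (by positivity) ?_ hc₀ hc
        refine (abs_sub _ _).trans (add_le_add (h1 φ hφ n hn) ?_)
        rw [abs_mul]
        exact mul_le_mul hIb (h2 n hn) (abs_nonneg _) (by positivity)
    _ = _ := by field_simp

/-- Sums against bounded functions continuous at the peak concentrate. -/
theorem tendsto_sum_mul (hq : GaussianLike a W lam q) (ha : a ∈ Set.Ioo (0 : ℝ) 1)
    (hl : 0 < lam) {ψ : ℝ → ℝ} {B : ℝ} (hB : ∀ x, |ψ x| ≤ B) (hψ : ContinuousAt ψ a) :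
    Tendsto (fun n : ℕ => ∑ k ∈ Finset.range (n + 1), q n k * ψ (k / n)) atTop (𝓝 (W * ψ a)) := by
  obtain ⟨C₀, hC₀, h0⟩ := hq.sum_mul_abs_pow_le hl 0
  obtain ⟨C₂, hC₂, h2⟩ := hq.sum_mul_abs_pow_le hl 2
  have hB0 : 0 ≤ B := (abs_nonneg _).trans (hB 0)
  have key : Tendsto (fun n : ℕ => ∑ k ∈ Finset.range (n + 1), q n k * (ψ (k / n) - ψ a)) atTop
      (𝓝 0) := by
    rw [Metric.tendsto_atTop]
    intro ε hε
    obtain ⟨ρ, hρ, hρψ⟩ := Metric.continuousAt_iff.1 hψ (ε / (2 * C₀)) (by positivity)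
    have hlim : Tendsto (fun n : ℕ => 2 * B / ρ ^ 2 * C₂ / n) atTop (𝓝 0) :=
      tendsto_const_div_atTop_nhds_zero_nat _
    obtain ⟨N, hN⟩ := eventually_atTop.1 ((hlim.eventually (gt_mem_nhds (half_pos hε))).and
      (eventually_gt_atTop 0))
    refine ⟨N, fun n hn => ?_⟩
    obtain ⟨hN1, hn0⟩ := hN n hn
    have hn0' : (0 : ℝ) < n := by exact_mod_cast hn0
    rw [Real.dist_eq, sub_zero]
    have hterm : ∀ k ∈ Finset.range (n + 1), |q n k * (ψ (k / n) - ψ a)|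
        ≤ ε / (2 * C₀) * (|q n k| * |latticePoint a n k| ^ 0)
          + 2 * B / ρ ^ 2 / n * (|q n k| * |latticePoint a n k| ^ 2) := by
      intro k _
      rw [abs_mul, sq_abs, ← natCast_mul_sub_sq, pow_zero, mul_one]
      -- Continuity within distance `ρ` of the peak, Chebyshev's inequality beyond. The quadratic
      -- term is `y²/n`, hence negligible by the bound on second moments.
      have h3 : |ψ (k / n) - ψ a| ≤ ε / (2 * C₀) + 2 * B / ρ ^ 2 * ((k : ℝ) / n - a) ^ 2 := by
        by_cases hd : |(k : ℝ) / n - a| < ρ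
        · have h4 := hρψ (by rwa [Real.dist_eq])
          rw [Real.dist_eq] at h4
          have : 0 ≤ 2 * B / ρ ^ 2 * ((k : ℝ) / n - a) ^ 2 := by positivity
          linarith
        · have h4 : |ψ (k / n) - ψ a| ≤ 2 * B := by
            have := abs_sub (ψ (k / n)) (ψ a)
            linarith [hB (k / n), hB a]
          have h5 : ρ ^ 2 ≤ ((k : ℝ) / n - a) ^ 2 := by
            rw [← sq_abs ((k : ℝ) / n - a)]
            have := not_lt.1 hd
            gcongr
          have h6 : 2 * B ≤ 2 * B / ρ ^ 2 * ((k : ℝ) / n - a) ^ 2 := by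
            rw [div_mul_eq_mul_div, le_div_iff₀ (by positivity)]
            gcongr
          have : 0 < ε / (2 * C₀) := by positivity
          linarith
      calc _ ≤ |q n k| * (ε / (2 * C₀) + 2 * B / ρ ^ 2 * ((k : ℝ) / n - a) ^ 2) := by gcongr
        _ = _ := by field_simp
    calc _ ≤ _ := Finset.abs_sum_le_sum_abs _ _
      _ ≤ _ := Finset.sum_le_sum hterm
      _ ≤ ε / (2 * C₀) * C₀ + 2 * B / ρ ^ 2 / n * C₂ := by
        rw [Finset.sum_add_distrib, ← Finset.mul_sum, ← Finset.mul_sum]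
        gcongr
        · exact h0 n hn0
        · exact h2 n hn0
      _ = ε / 2 + 2 * B / ρ ^ 2 * C₂ / n := by field_simp
      _ < ε := by linarith
  have h := key.add ((hq.tendsto_sum ha hl).mul_const (ψ a))
  rw [zero_add] at h
  refine h.congr fun n => ?_
  rw [Finset.sum_mul, ← Finset.sum_add_distrib]
  exact Finset.sum_congr rfl fun k _ => by ring

end GaussianLike

/-! ### The Gibbs measure in terms of normalised weights -/

section Gibbs

variable (n : ℕ) (F : ℝ → ℝ) (a : ℝ)

lemma peakWeight_mul (D : Set ℝ) (Φ : ℝ → ℝ) (k : ℕ) :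
    peakWeight F a D n k * Φ (k / n)
      = Real.exp (-(n * (F a + Real.binEntropy a))) *
        (levelWeight n F k * D.indicator Φ (k / n)) := by
  unfold peakWeight
  by_cases h : (k / n : ℝ) ∈ D
  · rw [Set.indicator_of_mem h, Set.indicator_of_mem h]; ring
  · rw [Set.indicator_of_notMem h, Set.indicator_of_notMem h]; ring

lemma sum_peakWeight_univ_pos : 0 < ∑ k ∈ Finset.range (n + 1), peakWeight F a Set.univ n k := by
  refine Finset.sum_pos (fun k hk => ?_) (by simp)
  have : 0 < (n.choose k : ℝ) := by
    exact_mod_cast Nat.choose_pos (Nat.lt_succ_iff.1 (Finset.mem_range.1 hk))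
  simp only [peakWeight, Set.indicator_univ, levelWeight]
  positivity

/-- The factor `exp (-n A(a))` is common to numerator and denominator, so any reference point `a` is
allowed. -/
lemma integral_gibbs_indicator (D : Set ℝ) (Φ : ℝ → ℝ) :
    ∫ ω, D.indicator Φ (plusFraction ω) ∂(gibbs n F)
      = (∑ k ∈ Finset.range (n + 1), peakWeight F a D n k * Φ (k / n))
        / ∑ k ∈ Finset.range (n + 1), peakWeight F a Set.univ n k := by
  have h1 : ∀ k, peakWeight F a Set.univ n k
      = Real.exp (-(n * (F a + Real.binEntropy a))) * levelWeight n F k := fun k => by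
    simp [peakWeight, mul_comm]
  simp only [integral_gibbs, peakWeight_mul, h1, ← Finset.mul_sum]
  rw [mul_div_mul_left _ _ (Real.exp_pos _).ne']

lemma integral_gibbs_eq (Φ : ℝ → ℝ) :
    ∫ ω, Φ (plusFraction ω) ∂(gibbs n F)
      = (∑ k ∈ Finset.range (n + 1), peakWeight F a Set.univ n k * Φ (k / n))
        / ∑ k ∈ Finset.range (n + 1), peakWeight F a Set.univ n k := by
  rw [← integral_gibbs_indicator]; simp

lemma gibbs_real_eq (D : Set ℝ) :
    (gibbs n F).real {ω | plusFraction ω ∈ D}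
      = (∑ k ∈ Finset.range (n + 1), peakWeight F a D n k)
        / ∑ k ∈ Finset.range (n + 1), peakWeight F a Set.univ n k := by
  have h := integral_gibbs_indicator n F a D (fun _ => 1)
  simp only [mul_one] at h
  rw [← h, ← integral_indicator_one (Set.toFinite _).measurableSet]
  rfl

/-- Conditioning cancels the partition function, so conditional laws depend on the peak inside `D`
alone. -/
lemma integral_cond_gibbs (D : Set ℝ) (Φ : ℝ → ℝ) :
    ∫ ω, Φ (plusFraction ω) ∂(ProbabilityTheory.cond (gibbs n F) {ω | plusFraction ω ∈ D})
      = (∑ k ∈ Finset.range (n + 1), peakWeight F a D n k * Φ (k / n))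
        / ∑ k ∈ Finset.range (n + 1), peakWeight F a D n k := by
  rw [ProbabilityTheory.cond, integral_smul_measure, ENNReal.toReal_inv, ← measureReal_def, gibbs_real_eq n F a,
    ← integral_indicator (Set.toFinite _).measurableSet]
  have : ({ω : Config n | plusFraction ω ∈ D}.indicator fun ω => Φ (plusFraction ω))
      = fun ω => D.indicator Φ (plusFraction ω) := rfl
  rw [this, integral_gibbs_indicator n F a, smul_eq_mul]
  have := (sum_peakWeight_univ_pos n F a).ne'
  rw [inv_div]
  field_simp

end Gibbs

end CubicIsing

/-! ### Mass, moments and fluctuations of a peak -/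

namespace CubicIsing

lemma abs_div_sub_div_le {S Z W V e c : ℝ} (hc : 0 < c) (hcZ : c ≤ Z) (hV : 0 < V)
    (hS : |S - W| ≤ e) (hZ : |Z - V| ≤ e) :
    |S / Z - W / V| ≤ e * ((V + |W|) / (c * V)) := by
  have hZ0 : 0 < Z := hc.trans_le hcZ
  have he : 0 ≤ e := (abs_nonneg _).trans hS
  have h : S / Z - W / V = ((S - W) * V - W * (Z - V)) / (Z * V) := by field_simp; ring
  rw [h, abs_div, abs_of_pos (mul_pos hZ0 hV)]
  calc _ ≤ (e * V + |W| * e) / (c * V) := by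
        refine div_le_div₀ (by positivity) ?_ (by positivity) (by gcongr)
        refine (abs_sub _ _).trans ?_
        rw [abs_mul, abs_mul, abs_of_pos hV]
        gcongr
    _ = _ := by ring

/-- The partition function, normalised by the value of `F + I` at `a`, converges to `V` with
rate `1/√n`. -/
def PartitionLimit (F : ℝ → ℝ) (a V : ℝ) : Prop :=
  0 < V ∧ ∃ C : ℝ, 0 < C ∧ ∀ n : ℕ, 0 < n →
    |∑ k ∈ Finset.range (n + 1), peakWeight F a Set.univ n k - V| ≤ C / √(n : ℝ)

lemma PartitionLimit.tendsto {F : ℝ → ℝ} {a V : ℝ} (h : PartitionLimit F a V) :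
    Tendsto (fun n => ∑ k ∈ Finset.range (n + 1), peakWeight F a Set.univ n k) atTop (𝓝 V) := by
  obtain ⟨_, C, _, h⟩ := h
  exact tendsto_of_abs_sub_le_div_sqrt h

lemma PartitionLimit.exists_pos_le {F : ℝ → ℝ} {a V : ℝ} (h : PartitionLimit F a V) :
    ∃ c : ℝ, 0 < c ∧ ∀ n : ℕ, 0 < n →
      c ≤ ∑ k ∈ Finset.range (n + 1), peakWeight F a Set.univ n k :=
  exists_pos_le_of_tendsto h.tendsto h.1 fun n _ => sum_peakWeight_univ_pos n F a

variable {F : ℝ → ℝ} {a W V lam : ℝ} {D : Set ℝ}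

/-- Asymptotic mass of a peak. -/
theorem exists_abs_gibbs_real_sub_le (hq : GaussianLike a W lam (peakWeight F a D))
    (ha : a ∈ Set.Ioo (0 : ℝ) 1) (hl : 0 < lam) (hZ : PartitionLimit F a V) :
    ∃ C : ℝ, 0 < C ∧ ∀ n : ℕ, 0 < n →
      |(gibbs n F).real {ω | plusFraction ω ∈ D} - W / V| ≤ C / √(n : ℝ) := by
  obtain ⟨c, hc, hcZ⟩ := hZ.exists_pos_le
  obtain ⟨hV, C₁, hC₁, h1⟩ := hZ
  obtain ⟨C₂, hC₂, h2⟩ := hq.abs_sum_sub_le ha hl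
  refine ⟨max C₁ C₂ * ((V + |W|) / (c * V)), by positivity, fun n hn => ?_⟩
  rw [gibbs_real_eq n F a]
  refine (abs_div_sub_div_le hc (hcZ n hn) hV (e := max C₁ C₂ / √(n : ℝ)) ?_ ?_).trans
    (le_of_eq (by ring))
  · refine (h2 n hn).trans ?_
    gcongr; exact le_max_right _ _
  · refine (h1 n hn).trans ?_
    gcongr; exact le_max_left _ _

lemma abs_magnetization_div_sub {n : ℕ} (hn : 0 < n) (a : ℝ) (ω : Config n) :
    magnetization ω / n - (2 * a - 1) = 2 * (plusFraction ω - a) := by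
  rw [magnetization_div hn.ne']; ring

lemma fluctuation_eq {n : ℕ} (hn : 0 < n) (a : ℝ) (ω : Config n) :
    fluctuation (2 * a - 1) ω = 2 * (√(n : ℝ) * (plusFraction ω - a)) := by
  have hn0 : (0 : ℝ) < n := by exact_mod_cast hn
  have hs : 0 < √(n : ℝ) := Real.sqrt_pos.2 hn0
  have h := abs_magnetization_div_sub hn a ω
  have h2 : magnetization ω - n * (2 * a - 1) = n * (2 * (plusFraction ω - a)) := by
    rw [← h]; field_simp
  rw [fluctuation, h2]
  nth_rewrite 1 [← Real.mul_self_sqrt hn0.le]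
  field_simp

/-- Conditional moments. -/
theorem exists_integral_cond_abs_pow_le (hq : GaussianLike a W lam (peakWeight F a D))
    (hl : 0 < lam) {c : ℝ} (hc : 0 < c) (l : ℕ) :
    ∃ C : ℝ, ∀ n : ℕ, 0 < n → c ≤ ∑ k ∈ Finset.range (n + 1), peakWeight F a D n k →
      ∫ ω, |magnetization ω / n - (2 * a - 1)| ^ l
        ∂(ProbabilityTheory.cond (gibbs n F) {ω | plusFraction ω ∈ D}) ≤ C / √(n : ℝ) ^ l := by
  obtain ⟨C, hC, h⟩ := hq.sum_mul_abs_pow_le hl l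
  refine ⟨2 ^ l * C / c, fun n hn hcn => ?_⟩
  have hs : 0 < √(n : ℝ) := Real.sqrt_pos.2 (by exact_mod_cast hn)
  have e : ∀ ω : Config n, |magnetization ω / n - (2 * a - 1)| ^ l
      = (fun x => |2 * (x - a)| ^ l) (plusFraction ω) := fun ω => by
    rw [abs_magnetization_div_sub hn]
  simp only [e]
  rw [integral_cond_gibbs n F a D fun x => |2 * (x - a)| ^ l]
  have e2 : ∑ k ∈ Finset.range (n + 1), peakWeight F a D n k * |2 * ((k : ℝ) / n - a)| ^ l
      = 2 ^ l / √(n : ℝ) ^ l * ∑ k ∈ Finset.range (n + 1),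
        |peakWeight F a D n k| * |latticePoint a n k| ^ l := by
    rw [Finset.mul_sum]
    refine Finset.sum_congr rfl fun k _ => ?_
    rw [abs_of_nonneg (peakWeight_nonneg _ _ _ _ _), latticePoint, abs_mul, abs_mul, abs_two,
      abs_of_pos hs, mul_pow, mul_pow]
    field_simp
  rw [e2]
  calc _ ≤ 2 ^ l / √(n : ℝ) ^ l * C / c := by
        refine div_le_div₀ (by positivity) ?_ hc hcn
        gcongr; exact h n hn
    _ = _ := by ring

/-- Conditional central limit theorem in Wasserstein distance. -/
theorem exists_wasserstein_cond_le (hq : GaussianLike a W lam (peakWeight F a D))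
    (ha : a ∈ Set.Ioo (0 : ℝ) 1) (hl : 0 < lam) {c : ℝ} (hc : 0 < c) :
    ∃ C : ℝ, ∀ n : ℕ, 0 < n → c ≤ ∑ k ∈ Finset.range (n + 1), peakWeight F a D n k →
      wasserstein ((ProbabilityTheory.cond (gibbs n F) {ω | plusFraction ω ∈ D}).map
          (fluctuation (2 * a - 1))) (gaussianReal 0 (4 / (2 * lam)).toNNReal)
        ≤ ENNReal.ofReal (C / √(n : ℝ)) := by
  obtain ⟨C, hC, h⟩ := hq.abs_ratio_sub_integral_le ha hl 2 le_rfl hc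
  refine ⟨C, fun n hn hcn => ?_⟩
  have hS : 0 < ∑ k ∈ Finset.range (n + 1), peakWeight F a D n k := hc.trans_le hcn
  refine iSup₂_le fun f hf => ENNReal.ofReal_le_ofReal ?_
  have hlip : ∀ x y, |f x - f y| ≤ |x - y| := fun x y => by
    have := hf.dist_le_mul x y
    simpa [Real.dist_eq] using this
  -- The factor 2 comes from `z = 2a - 1`. Subtracting `f 0` puts all 1-Lipschitz `f` into one class
  -- `ExpLipschitz 2 0`, and the constant drops out of the difference of the two integrals.
  set φ : ℝ → ℝ := fun y => f (2 * y) - f 0 with hφ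
  have hφE : ExpLipschitz 2 0 φ := by
    refine expLipschitz_of_lipschitz (fun x y => ?_) (by simp [hφ])
    have := hlip (2 * x) (2 * y)
    rw [← mul_sub, abs_mul, abs_two] at this
    simpa [hφ] using this
  have e1 : ∫ x, f x ∂((ProbabilityTheory.cond (gibbs n F) {ω | plusFraction ω ∈ D}).map
      (fluctuation (2 * a - 1))) = (∑ k ∈ Finset.range (n + 1),
        peakWeight F a D n k * φ (latticePoint a n k)) /
        (∑ k ∈ Finset.range (n + 1), peakWeight F a D n k) + f 0 := by
    rw [integral_map (measurable_of_finite _).aemeasurable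
      hf.continuous.aestronglyMeasurable]
    simp only [fluctuation_eq hn]
    rw [integral_cond_gibbs n F a D fun x => f (2 * (√(n : ℝ) * (x - a)))]
    simp only [hφ, mul_sub (peakWeight _ _ _ _ _), Finset.sum_sub_distrib, ← Finset.sum_mul,
      latticePoint]
    field_simp
    ring
  have e2 : ∫ x, f x ∂(gaussianReal 0 (4 / (2 * lam)).toNNReal)
      = ∫ y, φ y ∂(gaussianReal 0 (1 / (2 * lam)).toNNReal) + f 0 := by
    have hmap : gaussianReal 0 (4 / (2 * lam)).toNNReal
        = (gaussianReal 0 (1 / (2 * lam)).toNNReal).map (fun x => 2 * x) := by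
      have := gaussianReal_map_const_mul (μ := 0) (v := (1 / (2 * lam)).toNNReal) 2
      rw [this, mul_zero]
      congr 1
      ext
      have : 0 < 4 / (2 * lam) := by positivity
      have : 0 < 1 / (2 * lam) := by positivity
      push_cast
      rw [Real.coe_toNNReal _ (by positivity), Real.coe_toNNReal _ (by positivity)]
      ring
    rw [hmap, integral_map (by fun_prop) hf.continuous.aestronglyMeasurable]
    have hint : Integrable φ (gaussianReal 0 (1 / (2 * lam)).toNNReal) := hφE.integrable le_rfl _
    have : (fun y => f (2 * y)) = fun y => φ y + f 0 := by funext y; simp [hφ]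
    rw [this, integral_add hint (integrable_const _)]
    simp
  rw [e1, e2, add_sub_add_right_eq_sub]
  exact h φ hφE n hn hcn

/-- Levels where `F + I` stays below its value at `a` carry exponentially small mass. -/
theorem exists_gibbs_real_le_exp (hZ : PartitionLimit F a V) {E : Set ℝ} {c : ℝ} (hc : 0 < c)
    (hE : ∀ x ∈ E, x ∈ Set.Icc (0 : ℝ) 1 →
      F x + Real.binEntropy x ≤ F a + Real.binEntropy a - c) :
    ∃ d : ℝ, 0 < d ∧ ∀ᶠ n : ℕ in atTop,
      (gibbs n F).real {ω | plusFraction ω ∈ E} ≤ Real.exp (-d * n) := by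
  obtain ⟨c₀, hc₀, hcZ⟩ := hZ.exists_pos_le
  -- At most `n + 1` levels carry at most `exp (-cn)` each; half of the rate pays for the factor `(n
  -- + 1)/c₀`.
  refine ⟨c / 2, half_pos hc, ?_⟩
  have hlim : Tendsto (fun n : ℕ => (((n : ℝ)) ^ 1 * Real.exp (-(c / 2) * n)
      + Real.exp (-(c / 2) * n)) / c₀) atTop (𝓝 0) := by
    have hlin : Tendsto (fun n : ℕ => c / 2 * (n : ℝ)) atTop atTop :=
      tendsto_natCast_atTop_atTop.const_mul_atTop (half_pos hc)
    have h1 := ((Real.tendsto_pow_mul_exp_neg_atTop_nhds_zero 1).comp hlin).const_mul (2 / c)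
    have h2 := (Real.tendsto_pow_mul_exp_neg_atTop_nhds_zero 0).comp hlin
    have := (h1.add h2).div_const c₀
    simp only [mul_zero, add_zero, zero_div] at this
    refine this.congr fun n => ?_
    simp only [Function.comp, neg_mul]
    field_simp
  filter_upwards [hlim.eventually (gt_mem_nhds one_pos), eventually_gt_atTop 0] with n h1 hn
  have hn0 : (0 : ℝ) < n := by exact_mod_cast hn
  have hterm : ∀ k ∈ Finset.range (n + 1), peakWeight F a E n k ≤ Real.exp (-c * n) := by
    intro k hk
    have hk' : k ≤ n := Nat.lt_succ_iff.1 (Finset.mem_range.1 hk)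
    by_cases hkE : (k / n : ℝ) ∈ E
    · rw [peakWeight, Set.indicator_of_mem hkE]
      calc _ ≤ Real.exp (n * (F (k / n) + Real.binEntropy (k / n))) *
            Real.exp (-(n * (F a + Real.binEntropy a))) := by
            gcongr; exact levelWeight_le F hn hk'
        _ ≤ _ := by
          rw [← Real.exp_add, Real.exp_le_exp]
          have := mul_le_mul_of_nonneg_left (hE _ hkE ⟨by positivity,
            div_le_one_of_le₀ (by exact_mod_cast hk') hn0.le⟩) hn0.le
          linarith
    · rw [peakWeight, Set.indicator_of_notMem hkE]; positivity
  rw [gibbs_real_eq n F a]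
  have hsum := Finset.sum_le_sum hterm
  rw [Finset.sum_const, Finset.card_range, nsmul_eq_mul] at hsum
  push_cast at hsum
  calc _ ≤ ((n : ℝ) + 1) * Real.exp (-c * n) / c₀ :=
        div_le_div₀ (by positivity) hsum hc₀ (hcZ n hn)
    _ = ((n : ℝ) ^ 1 * Real.exp (-(c / 2) * n) + Real.exp (-(c / 2) * n)) / c₀ *
          Real.exp (-(c / 2) * n) := by
        have : Real.exp (-c * n) = Real.exp (-(c / 2) * n) * Real.exp (-(c / 2) * n) := by
          rw [← Real.exp_add]; ring_nf
        rw [this]; ring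
    _ ≤ 1 * Real.exp (-(c / 2) * n) := by gcongr
    _ = _ := one_mul _

end CubicIsing

/-! ### The likelihood equation and exponential tilts -/

namespace CubicIsing

/-- Chebyshev's sum inequality: expand the nonnegative double sum of `p i * p j * (f i - f j) * (e i
- e j)`. -/
lemma weighted_chebyshev {ι : Type*} (s : Finset ι) (p f e : ι → ℝ) (hp : ∀ i ∈ s, 0 ≤ p i)
    (h : ∀ i ∈ s, ∀ j ∈ s, 0 ≤ (f i - f j) * (e i - e j)) :
    (∑ i ∈ s, p i * f i) * (∑ i ∈ s, p i * e i)
      ≤ (∑ i ∈ s, p i * e i * f i) * ∑ i ∈ s, p i := by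
  have h0 : 0 ≤ ∑ i ∈ s, ∑ j ∈ s, p i * p j * ((f i - f j) * (e i - e j)) :=
    Finset.sum_nonneg fun i hi => Finset.sum_nonneg fun j hj =>
      mul_nonneg (mul_nonneg (hp i hi) (hp j hj)) (h i hi j hj)
  have h1 : ∑ i ∈ s, ∑ j ∈ s, p i * p j * ((f i - f j) * (e i - e j))
      = 2 * ((∑ i ∈ s, p i * e i * f i) * (∑ i ∈ s, p i)
        - (∑ i ∈ s, p i * f i) * (∑ i ∈ s, p i * e i)) := by
    have e1 : ∀ u v : ι → ℝ, ∑ i ∈ s, ∑ j ∈ s, u i * v j = (∑ i ∈ s, u i) * ∑ j ∈ s, v j :=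
      fun u v => (Finset.sum_mul_sum s s u v).symm
    have e2 : ∀ i j, p i * p j * ((f i - f j) * (e i - e j))
        = p i * e i * f i * p j + p i * (p j * e j * f j)
          - (p i * f i * (p j * e j) + p i * e i * (p j * f j)) := fun i j => by ring
    simp only [e2, Finset.sum_sub_distrib, Finset.sum_add_distrib, e1]
    ring
  linarith

section Statistic

variable (n : ℕ) (f g : ℝ → ℝ)

lemma levelWeight_add_mul (b t : ℝ) (k : ℕ) :
    levelWeight n (fun x => (b + t) * f x + g x) k
      = levelWeight n (fun x => b * f x + g x) k * Real.exp (n * t * f (k / n)) := by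
  rw [levelWeight, levelWeight, mul_assoc, ← Real.exp_add]
  ring_nf

lemma sum_levelWeight_pos (F : ℝ → ℝ) : 0 < ∑ k ∈ Finset.range (n + 1), levelWeight n F k := by
  rw [← partition_eq]; exact partition_pos n F

lemma meanStat_eq (b : ℝ) :
    meanStat n f g b = (∑ k ∈ Finset.range (n + 1),
        levelWeight n (fun x => b * f x + g x) k * f (k / n))
      / ∑ k ∈ Finset.range (n + 1), levelWeight n (fun x => b * f x + g x) k :=
  integral_gibbs n _ f

/-- Raising the parameter by `t ≥ 0` multiplies the weights by `exp (n t f)`, which is ordered like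
`f` itself. Strict monotonicity fails for a constant statistic and is not needed. -/
lemma monotone_meanStat : Monotone (meanStat n f g) := by
  intro b b' hb
  obtain ⟨t, ht, rfl⟩ : ∃ t : ℝ, 0 ≤ t ∧ b' = b + t := ⟨b' - b, by linarith, by ring⟩
  rw [meanStat_eq, meanStat_eq, div_le_div_iff₀ (sum_levelWeight_pos _ _)
    (sum_levelWeight_pos _ _)]
  simp only [levelWeight_add_mul]
  refine weighted_chebyshev _ _ _ _ (fun k _ => levelWeight_nonneg _ _ _) fun i _ j _ => ?_
  have hnt : 0 ≤ (n : ℝ) * t := by positivity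
  rcases le_total (f (i / n)) (f (j / n)) with h | h
  · refine mul_nonneg_of_nonpos_of_nonpos (by linarith) (sub_nonpos.2 (Real.exp_le_exp.2 ?_))
    gcongr
  · refine mul_nonneg (by linarith) (sub_nonneg.2 (Real.exp_le_exp.2 ?_))
    gcongr

lemma continuous_meanStat : Continuous (meanStat n f g) := by
  have : meanStat n f g = fun b => _ := funext (meanStat_eq n f g)
  rw [this]
  refine Continuous.div ?_ ?_ fun b => (sum_levelWeight_pos n _).ne'
  all_goals
    refine continuous_finsetSum _ fun k _ => ?_
    unfold levelWeight
    fun_prop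

/-- A parameter shift of `t/√n` is an exponential tilt by `t` times the rescaled statistic; the
constant `κ` that centres the tilt at `f a` cancels in the ratio. -/
lemma meanStat_sub_eq {n : ℕ} (hn : 0 < n) (a b t : ℝ) :
    √(n : ℝ) * (meanStat n f g (b + t / √(n : ℝ)) - f a)
      = (∑ k ∈ Finset.range (n + 1), peakWeight (fun x => b * f x + g x) a Set.univ n k *
          (√(n : ℝ) * (f (k / n) - f a) * Real.exp (t * (√(n : ℝ) * (f (k / n) - f a)))))
        / ∑ k ∈ Finset.range (n + 1), peakWeight (fun x => b * f x + g x) a Set.univ n k *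
          Real.exp (t * (√(n : ℝ) * (f (k / n) - f a))) := by
  have hn0 : (0 : ℝ) < n := by exact_mod_cast hn
  have hs : 0 < √(n : ℝ) := Real.sqrt_pos.2 hn0
  set F : ℝ → ℝ := fun x => b * f x + g x with hF
  set κ := Real.exp (-(n * (F a + Real.binEntropy a))) * Real.exp (-(t * (√(n : ℝ) * f a))) with hκ
  have hκ0 : κ ≠ 0 := by positivity
  have hw : ∀ k, peakWeight F a Set.univ n k * Real.exp (t * (√(n : ℝ) * (f (k / n) - f a)))
      = κ * levelWeight n (fun x => (b + t / √(n : ℝ)) * f x + g x) k := by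
    intro k
    have h1 : (n : ℝ) * (t / √(n : ℝ)) = t * √(n : ℝ) := by
      nth_rewrite 1 [← Real.mul_self_sqrt hn0.le]; field_simp
    have h2 : Real.exp (t * (√(n : ℝ) * (f (k / n) - f a)))
        = Real.exp (t * √(n : ℝ) * f (k / n)) * Real.exp (-(t * (√(n : ℝ) * f a))) := by
      rw [← Real.exp_add]; ring_nf
    rw [levelWeight_add_mul, h1, h2, peakWeight, Set.indicator_univ, hκ]
    ring
  have hw' : ∀ k, peakWeight F a Set.univ n k *
      (√(n : ℝ) * (f (k / n) - f a) * Real.exp (t * (√(n : ℝ) * (f (k / n) - f a))))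
      = κ * (√(n : ℝ) * (levelWeight n (fun x => (b + t / √(n : ℝ)) * f x + g x) k * f (k / n)
          - levelWeight n (fun x => (b + t / √(n : ℝ)) * f x + g x) k * f a)) := by
    intro k
    have := hw k
    linear_combination (√(n : ℝ) * (f (k / n) - f a)) * this
  simp only [hw, hw', ← Finset.mul_sum, Finset.sum_sub_distrib, ← Finset.sum_mul]
  have hS := (sum_levelWeight_pos n fun x => (b + t / √(n : ℝ)) * f x + g x).ne'
  rw [mul_div_mul_left _ _ hκ0, meanStat_eq, mul_div_assoc, sub_div, mul_div_cancel_left₀ _ hS]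

end Statistic

lemma integral_exp_mul_gaussianReal (v : NNReal) (s : ℝ) :
    ∫ y, Real.exp (s * y) ∂(gaussianReal 0 v) = Real.exp (v * s ^ 2 / 2) := by
  have := congrFun (mgf_fun_id_gaussianReal (μ := 0) (v := v)) s
  simpa [mgf] using this

/-- Both sides are the derivative at `s` of the Gaussian moment generating function. -/
lemma integral_mul_exp_mul_gaussianReal (v : NNReal) (s : ℝ) :
    ∫ y, y * Real.exp (s * y) ∂(gaussianReal 0 v) = v * s * Real.exp (v * s ^ 2 / 2) := by
  have h1 : HasDerivAt (mgf (fun x => x) (gaussianReal 0 v))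
      (∫ y, y * Real.exp (s * y) ∂(gaussianReal 0 v)) s :=
    hasDerivAt_mgf (by simp)
  rw [mgf_fun_id_gaussianReal] at h1
  have h2 : HasDerivAt (fun t : ℝ => Real.exp (0 * t + v * t ^ 2 / 2))
      (v * s * Real.exp (v * s ^ 2 / 2)) s := by
    have h3 : HasDerivAt (fun t : ℝ => 0 * t + v * t ^ 2 / 2) (v * s) s := by
      have := (((hasDerivAt_id s).pow 2).const_mul (v : ℝ)).div_const 2
      have h4 := ((hasDerivAt_id s).const_mul 0).add this
      refine h4.congr_deriv ?_
      simp; ring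
    refine h3.exp.congr_deriv ?_
    simp; ring
  exact h1.unique h2

/-- The constants depend on the bound `T` only, so the Gaussian approximation of the tilted sums is
uniform in `|t| ≤ T`. -/
lemma expLipschitz_exp_mul {T t : ℝ} (ht : |t| ≤ T) :
    ExpLipschitz (T + 1) T fun y => Real.exp (t * y) := by
  have hT : 0 ≤ T := (abs_nonneg t).trans ht
  refine ⟨fun x y => ?_, by simp [hT]⟩
  have hb : ∀ z : ℝ, t * z ≤ T * |z| := fun z =>
    (le_abs_self _).trans (by rw [abs_mul]; gcongr)
  refine (abs_exp_sub_exp_le (w := T * (|x| + |y|)) ?_ ?_).trans ?_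
  · nlinarith [hb x, abs_nonneg y]
  · nlinarith [hb y, abs_nonneg x]
  · rw [← mul_sub, abs_mul]; gcongr; linarith

lemma expLipschitz_mul_exp_mul {T t : ℝ} (ht : |t| ≤ T) :
    ExpLipschitz 2 (2 * T) fun y => y * Real.exp (t * y) := by
  have hT : 0 ≤ T := (abs_nonneg t).trans ht
  refine ⟨fun x y => ?_, by simp⟩
  have hb : ∀ z : ℝ, t * z ≤ T * |z| := fun z =>
    (le_abs_self _).trans (by rw [abs_mul]; gcongr)
  have h1 : |Real.exp (t * x) - Real.exp (t * y)| ≤ T * |x - y| * Real.exp (T * (|x| + |y|)) := by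
    refine (abs_exp_sub_exp_le (w := T * (|x| + |y|)) ?_ ?_).trans ?_
    · nlinarith [hb x, abs_nonneg y]
    · nlinarith [hb y, abs_nonneg x]
    · rw [← mul_sub, abs_mul]; gcongr
  have h2 : Real.exp (t * x) ≤ Real.exp (2 * T * (|x| + |y|)) := by
    rw [Real.exp_le_exp]; nlinarith [hb x, abs_nonneg y, abs_nonneg x]
  have h3 : T * |y| * Real.exp (T * (|x| + |y|)) ≤ Real.exp (2 * T * (|x| + |y|)) := by
    have : T * |y| ≤ Real.exp (T * (|x| + |y|)) := by
      have := Real.add_one_le_exp (T * (|x| + |y|))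
      nlinarith [abs_nonneg x]
    calc _ ≤ Real.exp (T * (|x| + |y|)) * Real.exp (T * (|x| + |y|)) := by gcongr
      _ = _ := by rw [← Real.exp_add]; ring_nf
  have e : x * Real.exp (t * x) - y * Real.exp (t * y)
      = (x - y) * Real.exp (t * x) + y * (Real.exp (t * x) - Real.exp (t * y)) := by ring
  rw [e]
  calc _ ≤ |x - y| * Real.exp (t * x) + |y| * (T * |x - y| * Real.exp (T * (|x| + |y|))) := by
        refine (abs_add_le _ _).trans ?_
        rw [abs_mul, abs_mul, abs_of_pos (Real.exp_pos _)]
        gcongr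
    _ = |x - y| * (Real.exp (t * x) + T * |y| * Real.exp (T * (|x| + |y|))) := by ring
    _ ≤ |x - y| * (Real.exp (2 * T * (|x| + |y|)) + Real.exp (2 * T * (|x| + |y|))) := by gcongr
    _ = _ := by ring

/-- `f` has a first order expansion at `a` on `[0,1]` with derivative `d`. -/
structure FirstOrder (f : ℝ → ℝ) (a d K L : ℝ) : Prop where
  d_le : |d| ≤ L
  lip : ∀ x ∈ Set.Icc (0 : ℝ) 1, |f x - f a| ≤ L * |x - a|
  quad : ∀ x ∈ Set.Icc (0 : ℝ) 1, |f x - f a - d * (x - a)| ≤ K * (x - a) ^ 2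

namespace FirstOrder

variable {f : ℝ → ℝ} {a d K L : ℝ}

lemma L_nonneg (h : FirstOrder f a d K L) : 0 ≤ L := (abs_nonneg _).trans h.d_le

lemma abs_scaled_le (h : FirstOrder f a d K L) {n : ℕ} {x : ℝ}
    (hx : x ∈ Set.Icc (0 : ℝ) 1) :
    |√(n : ℝ) * (f x - f a)| ≤ L * |√(n : ℝ) * (x - a)| := by
  rw [abs_mul, abs_mul, mul_left_comm]
  gcongr
  exact h.lip x hx

lemma abs_scaled_sub_le (h : FirstOrder f a d K L) {n : ℕ} (hn : 0 < n) {x : ℝ}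
    (hx : x ∈ Set.Icc (0 : ℝ) 1) :
    |√(n : ℝ) * (f x - f a) - d * (√(n : ℝ) * (x - a))|
      ≤ K / √(n : ℝ) * (√(n : ℝ) * (x - a)) ^ 2 := by
  have hs : 0 < √(n : ℝ) := Real.sqrt_pos.2 (by exact_mod_cast hn)
  have e : √(n : ℝ) * (f x - f a) - d * (√(n : ℝ) * (x - a))
      = √(n : ℝ) * (f x - f a - d * (x - a)) := by ring
  rw [e, abs_mul, abs_of_pos hs]
  calc _ ≤ √(n : ℝ) * (K * (x - a) ^ 2) := by gcongr; exact h.quad x hx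
    _ = _ := by field_simp

/-- The exponential tilts of the statistic and of its linearisation are `O(1/√n)` apart. -/
lemma abs_exp_sub_exp_le (h : FirstOrder f a d K L) (hK : 0 ≤ K) {T t : ℝ} (ht : |t| ≤ T)
    {n : ℕ} (hn : 0 < n) {x : ℝ} (hx : x ∈ Set.Icc (0 : ℝ) 1) :
    |Real.exp (t * (√(n : ℝ) * (f x - f a))) - Real.exp (t * (d * (√(n : ℝ) * (x - a))))|
        ≤ 2 * T * K / √(n : ℝ) * Real.exp ((2 * T * L + 1) * |√(n : ℝ) * (x - a)|) ∧
    |√(n : ℝ) * (f x - f a) * Real.exp (t * (√(n : ℝ) * (f x - f a)))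
        - d * (√(n : ℝ) * (x - a)) * Real.exp (t * (d * (√(n : ℝ) * (x - a))))|
        ≤ 4 * K / √(n : ℝ) * Real.exp ((2 * T * L + 1) * |√(n : ℝ) * (x - a)|) := by
  have hs : 0 < √(n : ℝ) := Real.sqrt_pos.2 (by exact_mod_cast hn)
  have h1 := h.abs_scaled_le (n := n) hx
  have h2 := h.abs_scaled_sub_le hn hx
  have hL := h.L_nonneg
  have hdL := h.d_le
  set y := √(n : ℝ) * (x - a)
  set X := √(n : ℝ) * (f x - f a)
  have hT : 0 ≤ T := (abs_nonneg t).trans ht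
  have hdy : |d * y| ≤ L * |y| := by rw [abs_mul]; gcongr
  have hb : ∀ z : ℝ, |z| ≤ L * |y| → t * z ≤ T * L * |y| := fun z hz =>
    (le_abs_self _).trans (by rw [abs_mul, mul_assoc]; gcongr)
  have hy2 : y ^ 2 ≤ 2 * Real.exp |y| := by
    have := abs_pow_le_factorial_mul_exp y 2
    norm_num [Nat.factorial] at this; exact this
  have h3 : |X - d * y| ≤ 2 * K / √(n : ℝ) * Real.exp |y| := by
    refine h2.trans ?_
    calc _ ≤ K / √(n : ℝ) * (2 * Real.exp |y|) := by gcongr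
      _ = _ := by ring
  have h4 : |Real.exp (t * X) - Real.exp (t * (d * y))|
      ≤ T * |X - d * y| * Real.exp (T * L * |y|) := by
    refine (CubicIsing.abs_exp_sub_exp_le (hb _ h1) (hb _ hdy)).trans ?_
    rw [← mul_sub, abs_mul]; gcongr
  have hTL : 0 ≤ T * L * |y| := by positivity
  have h5 : Real.exp |y| * Real.exp (T * L * |y|) ≤ Real.exp ((2 * T * L + 1) * |y|) := by
    rw [← Real.exp_add, Real.exp_le_exp]; nlinarith
  constructor
  · refine h4.trans ?_
    calc _ ≤ T * (2 * K / √(n : ℝ) * Real.exp |y|) * Real.exp (T * L * |y|) := by gcongr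
      _ = 2 * T * K / √(n : ℝ) * (Real.exp |y| * Real.exp (T * L * |y|)) := by ring
      _ ≤ _ := by gcongr
  · have e : X * Real.exp (t * X) - d * y * Real.exp (t * (d * y))
        = (X - d * y) * Real.exp (t * X) + d * y * (Real.exp (t * X) - Real.exp (t * (d * y))) := by
      ring
    have h6 : T * L * |y| * (Real.exp |y| * Real.exp (T * L * |y|))
        ≤ Real.exp ((2 * T * L + 1) * |y|) := by
      have : T * L * |y| ≤ Real.exp (T * L * |y|) := by
        linarith [Real.add_one_le_exp (T * L * |y|)]
      calc _ ≤ Real.exp (T * L * |y|) * (Real.exp |y| * Real.exp (T * L * |y|)) := by gcongr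
        _ = _ := by rw [← Real.exp_add, ← Real.exp_add]; ring_nf
    rw [e]
    calc _ ≤ |X - d * y| * Real.exp (T * L * |y|)
          + L * |y| * (T * |X - d * y| * Real.exp (T * L * |y|)) := by
          refine (abs_add_le _ _).trans ?_
          rw [abs_mul, abs_mul (d * y), abs_of_pos (Real.exp_pos _)]
          have := Real.exp_le_exp.2 (hb _ h1)
          gcongr
      _ = |X - d * y| * (Real.exp (T * L * |y|) + T * L * |y| * Real.exp (T * L * |y|)) := by ring
      _ ≤ 2 * K / √(n : ℝ) * Real.exp |y| *
          (Real.exp (T * L * |y|) + T * L * |y| * Real.exp (T * L * |y|)) := by gcongr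
      _ = 2 * K / √(n : ℝ) * (Real.exp |y| * Real.exp (T * L * |y|)
          + T * L * |y| * (Real.exp |y| * Real.exp (T * L * |y|))) := by ring
      _ ≤ 2 * K / √(n : ℝ) * (Real.exp ((2 * T * L + 1) * |y|)
          + Real.exp ((2 * T * L + 1) * |y|)) := by gcongr
      _ = _ := by ring

end FirstOrder

end CubicIsing

/-! ### Asymptotic normality of maximum likelihood estimators -/

namespace CubicIsing

lemma natCast_div_mem_Icc {n k : ℕ} (hk : k ∈ Finset.range (n + 1)) :
    (k / n : ℝ) ∈ Set.Icc (0 : ℝ) 1 := by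
  have hk' : k ≤ n := Nat.lt_succ_iff.1 (Finset.mem_range.1 hk)
  exact ⟨by positivity, div_le_one_of_le₀ (by exact_mod_cast hk') (by positivity)⟩

variable {f g : ℝ → ℝ} {a b W lam d K L : ℝ}

/-- First order response of the mean of the statistic to a perturbation of order `1/√n`. -/
theorem exists_abs_meanStat_sub_le
    (hq : GaussianLike a W lam (peakWeight (fun x => b * f x + g x) a Set.univ))
    (ha : a ∈ Set.Ioo (0 : ℝ) 1) (hl : 0 < lam) (hW : 0 < W) (hf : FirstOrder f a d K L)
    (hK : 0 ≤ K) {T : ℝ} (hT : 0 ≤ T) :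
    ∃ C : ℝ, ∀ᶠ n : ℕ in atTop, ∀ t : ℝ, |t| ≤ T →
      |√(n : ℝ) * (meanStat n f g (b + t / √(n : ℝ)) - f a) - t * (d ^ 2 / (2 * lam))|
        ≤ C / √(n : ℝ) := by
  have hL := hf.L_nonneg
  have hTL : 0 ≤ T * L := by positivity
  obtain ⟨C₁, hC₁, h1⟩ := hq.abs_sum_sub_integral_le ha hl 2 (s := 2 * (T * L)) (by positivity)
  obtain ⟨C₂, hC₂, h2⟩ := hq.abs_sum_sub_integral_le ha hl (T * L + 1) (s := T * L) hTL
  obtain ⟨C₃, hC₃, h3⟩ := hq.sum_abs_mul_exp_le hl (2 * T * L + 1)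
  set v := 1 / (2 * lam) with hv
  have hv0 : 0 < v := by positivity
  have hvc : ((v.toNNReal : NNReal) : ℝ) = v := Real.coe_toNNReal _ hv0.le
  set E := max (4 * K * C₃ + L * C₁) (2 * T * K * C₃ + C₂) with hE
  have hE0 : 0 ≤ E := le_max_of_le_right (by positivity)
  refine ⟨E * ((1 + L * v * (T * L)) / (W / 2)), ?_⟩
  -- An error below `W/2` keeps the denominator of the ratio above `W/2`, since its limit `W M` is
  -- at least `W`.
  filter_upwards [(tendsto_div_sqrt E).eventually (gt_mem_nhds (half_pos hW)),
    eventually_gt_atTop 0] with n hnE hn t ht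
  have hs : 0 < √(n : ℝ) := Real.sqrt_pos.2 (by exact_mod_cast hn)
  have hs' : |t * d| ≤ T * L := by rw [abs_mul]; have := hf.d_le; gcongr
  have a1 := h1 _ (expLipschitz_mul_exp_mul hs') n hn
  have a2 := h2 _ (expLipschitz_exp_mul hs') n hn
  rw [integral_mul_exp_mul_gaussianReal, hvc] at a1
  rw [integral_exp_mul_gaussianReal, hvc] at a2
  -- The numerator tends to `W d (v t d) M` and the denominator to `W M`. The factor `M` drops out
  -- of the ratio and leaves a response that is exactly linear in `t`, with slope `d² v = d²/(2
  -- lam)`.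
  set M := Real.exp (v * (t * d) ^ 2 / 2) with hM
  have hM1 : 1 ≤ M := Real.one_le_exp (by positivity)
  rw [meanStat_sub_eq f g hn]
  set q := peakWeight (fun x => b * f x + g x) a Set.univ with hqd
  have b1 : |∑ k ∈ Finset.range (n + 1), q n k * (√(n : ℝ) * (f (k / n) - f a) *
      Real.exp (t * (√(n : ℝ) * (f (k / n) - f a)))) - W * (d * (v * (t * d) * M))|
      ≤ E / √(n : ℝ) := by
    have c1 : |∑ k ∈ Finset.range (n + 1), (q n k * (√(n : ℝ) * (f (k / n) - f a) *
        Real.exp (t * (√(n : ℝ) * (f (k / n) - f a)))) - d * (q n k * (latticePoint a n k *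
          Real.exp (t * d * latticePoint a n k))))| ≤ 4 * K / √(n : ℝ) * C₃ := by
      refine (Finset.abs_sum_le_sum_abs _ _).trans ?_
      refine le_trans (Finset.sum_le_sum (g := fun k => 4 * K / √(n : ℝ) * (|q n k| *
        Real.exp ((2 * T * L + 1) * |latticePoint a n k|))) fun k hk => ?_) ?_
      · have := (hf.abs_exp_sub_exp_le hK ht hn (natCast_div_mem_Icc hk)).2
        have e : ∀ P y : ℝ, q n k * P - d * (q n k * (y * Real.exp (t * d * y)))
            = q n k * (P - d * y * Real.exp (t * (d * y))) := fun P y => by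
          rw [← mul_assoc t d y]; ring
        rw [e, abs_mul]
        exact (mul_le_mul_of_nonneg_left this (abs_nonneg _)).trans
          (le_of_eq (by rw [latticePoint]; ring))
      · rw [← Finset.mul_sum]; gcongr; exact h3 n hn
    rw [Finset.sum_sub_distrib, ← Finset.mul_sum] at c1
    have c2 : |d * ∑ k ∈ Finset.range (n + 1), q n k * (latticePoint a n k *
          Real.exp (t * d * latticePoint a n k)) - W * (d * (v * (t * d) * M))|
        ≤ L * (C₁ / √(n : ℝ)) := by
      rw [mul_left_comm W, ← mul_sub, abs_mul]
      have := hf.d_le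
      gcongr
    calc _ ≤ _ := abs_sub_le _ _ _
      _ ≤ _ := add_le_add c1 c2
      _ = (4 * K * C₃ + L * C₁) / √(n : ℝ) := by ring
      _ ≤ _ := by gcongr; exact le_max_left _ _
  have b2 : |∑ k ∈ Finset.range (n + 1), q n k * Real.exp (t * (√(n : ℝ) * (f (k / n) - f a)))
      - W * M| ≤ E / √(n : ℝ) := by
    have c1 : |∑ k ∈ Finset.range (n + 1), (q n k *
        Real.exp (t * (√(n : ℝ) * (f (k / n) - f a))) - q n k *
          Real.exp (t * d * latticePoint a n k))| ≤ 2 * T * K / √(n : ℝ) * C₃ := by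
      refine (Finset.abs_sum_le_sum_abs _ _).trans ?_
      refine le_trans (Finset.sum_le_sum (g := fun k => 2 * T * K / √(n : ℝ) * (|q n k| *
        Real.exp ((2 * T * L + 1) * |latticePoint a n k|))) fun k hk => ?_) ?_
      · have := (hf.abs_exp_sub_exp_le hK ht hn (natCast_div_mem_Icc hk)).1
        rw [← mul_sub, abs_mul, mul_assoc t d]
        exact (mul_le_mul_of_nonneg_left this (abs_nonneg _)).trans
          (le_of_eq (by rw [latticePoint]; ring))
      · rw [← Finset.mul_sum]; gcongr; exact h3 n hn
    rw [Finset.sum_sub_distrib] at c1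
    calc _ ≤ _ := abs_sub_le _ _ _
      _ ≤ _ := add_le_add c1 a2
      _ = (2 * T * K * C₃ + C₂) / √(n : ℝ) := by ring
      _ ≤ _ := by gcongr; exact le_max_right _ _
  have hWM : W ≤ W * M := le_mul_of_one_le_right hW.le hM1
  have hden : W / 2 ≤ ∑ k ∈ Finset.range (n + 1),
      q n k * Real.exp (t * (√(n : ℝ) * (f (k / n) - f a))) := by
    have := (abs_le.1 b2).1; linarith
  have hfin := abs_div_sub_div_le (half_pos hW) hden (by positivity) b1 b2
  have e1 : W * (d * (v * (t * d) * M)) / (W * M) = t * (d ^ 2 / (2 * lam)) := by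
    rw [hv]; field_simp
  rw [e1] at hfin
  refine hfin.trans ?_
  have hM0 : 0 < M := by positivity
  rw [abs_mul, abs_of_pos hW, abs_mul, abs_mul, abs_mul, abs_of_pos hM0, abs_of_pos hv0]
  have e2 : (W * M + W * (|d| * (v * |t * d| * M))) / (W / 2 * (W * M))
      = (1 + |d| * v * |t * d|) / (W / 2) := by field_simp
  rw [e2, div_mul_eq_mul_div]
  have := hf.d_le
  gcongr

/-- On `|X| ≤ R`, the maximum likelihood estimator is asymptotically linear in the statistic. -/
theorem eventually_abs_mle_sub_le
    (hq : GaussianLike a W lam (peakWeight (fun x => b * f x + g x) a Set.univ))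
    (ha : a ∈ Set.Ioo (0 : ℝ) 1) (hl : 0 < lam) (hW : 0 < W) (hf : FirstOrder f a d K L)
    (hK : 0 ≤ K) (hd : d ≠ 0) {R ε : ℝ} (hR : 0 ≤ R) (hε : 0 < ε) :
    ∀ᶠ n : ℕ in atTop, ∀ est : Config n → ℝ, IsMLE n f g est → ∀ ω : Config n,
      |√(n : ℝ) * (f (plusFraction ω) - f a)| ≤ R →
      |√(n : ℝ) * (est ω - b) - √(n : ℝ) * (f (plusFraction ω) - f a) / (d ^ 2 / (2 * lam))| ≤ ε := by
  set τ := d ^ 2 / (2 * lam) with hτ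
  have hτ0 : 0 < τ := by positivity
  -- This range of `t` contains both test points `X/τ ± ε` as soon as `|X| ≤ R`.
  obtain ⟨C, hC⟩ := exists_abs_meanStat_sub_le hq ha hl hW hf hK (T := R / τ + ε) (by positivity)
  filter_upwards [hC, (tendsto_div_sqrt C).eventually (gt_mem_nhds (show 0 < ε * τ by positivity)),
    eventually_gt_atTop 0] with n hn hCn hn0 est hest ω hω
  have hs : 0 < √(n : ℝ) := Real.sqrt_pos.2 (by exact_mod_cast hn0)
  set X := √(n : ℝ) * (f (plusFraction ω) - f a) with hX
  have hXτ : |X / τ| ≤ R / τ := by rw [abs_div, abs_of_pos hτ0]; gcongr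
  obtain ⟨hx1, hx2⟩ := abs_le.1 hXτ
  have hlow := hn (X / τ - ε) (by rw [abs_le]; constructor <;> linarith)
  have hupp := hn (X / τ + ε) (by rw [abs_le]; constructor <;> linarith)
  have e1 : (X / τ - ε) * τ = X - ε * τ := by field_simp
  have e2 : (X / τ + ε) * τ = X + ε * τ := by field_simp
  rw [e1] at hlow
  rw [e2] at hupp
  set m := meanStat n f g
  have hlow' : m (b + (X / τ - ε) / √(n : ℝ)) < f (plusFraction ω) := by
    have h1 := (abs_le.1 hlow).2
    have h2 : √(n : ℝ) * (m (b + (X / τ - ε) / √(n : ℝ)) - f a) < X := by linarith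
    rw [hX] at h2
    have := lt_of_mul_lt_mul_left h2 hs.le
    linarith
  have hupp' : f (plusFraction ω) < m (b + (X / τ + ε) / √(n : ℝ)) := by
    have h1 := (abs_le.1 hupp).1
    have h2 : X < √(n : ℝ) * (m (b + (X / τ + ε) / √(n : ℝ)) - f a) := by linarith
    rw [hX] at h2
    have := lt_of_mul_lt_mul_left h2 hs.le
    linarith
  -- The means at the two test points straddle the observed value. Hence the equation is solvable
  -- and the estimator must solve it; by monotonicity every solution lies strictly between the test
  -- points, so uniqueness is not needed.
  have hsol : ∃ b', m b' = f (plusFraction ω) := by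
    have hle : b + (X / τ - ε) / √(n : ℝ) ≤ b + (X / τ + ε) / √(n : ℝ) := by gcongr; linarith
    obtain ⟨b', _, hb'⟩ := intermediate_value_Icc hle (continuous_meanStat n f g).continuousOn
      ⟨hlow'.le, hupp'.le⟩
    exact ⟨b', hb'⟩
  have hm := hest ω hsol
  have hmono := monotone_meanStat n f g
  have i1 : b + (X / τ - ε) / √(n : ℝ) < est ω := by
    refine hmono.reflect_lt ?_
    rw [hm]; exact hlow'
  have i2 : est ω < b + (X / τ + ε) / √(n : ℝ) := by
    refine hmono.reflect_lt ?_
    rw [hm]; exact hupp'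
  have i3 : (X / τ - ε) / √(n : ℝ) < est ω - b := by linarith
  have i4 : est ω - b < (X / τ + ε) / √(n : ℝ) := by linarith
  rw [div_lt_iff₀ hs] at i3
  rw [lt_div_iff₀ hs] at i4
  rw [abs_le]
  constructor <;> linarith

/-- Asymptotic normality of maximum likelihood estimators. -/
theorem tendstoInDistribution_mle
    (hq : GaussianLike a W lam (peakWeight (fun x => b * f x + g x) a Set.univ))
    (ha : a ∈ Set.Ioo (0 : ℝ) 1) (hl : 0 < lam) (hW : 0 < W) (hf : FirstOrder f a d K L)
    (hK : 0 ≤ K) (hd : d ≠ 0) (est : (n : ℕ) → Config n → ℝ) (hest : ∀ n, IsMLE n f g (est n)) :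
    TendstoInDistribution (fun (n : ℕ) ω => √(n : ℝ) * (est n ω - b)) atTop (id : ℝ → ℝ)
      (fun n => gibbs n fun x => b * f x + g x)
      (gaussianReal 0 (2 * lam / d ^ 2).toNNReal) := by
  refine ⟨fun n => (measurable_of_finite _).aemeasurable, aemeasurable_id, ?_⟩
  refine tendsto_iff_forall_lipschitz_integral_tendsto.2 ?_
  rintro φ ⟨B, hB⟩ ⟨Λ, hΛ⟩
  set F : ℝ → ℝ := fun x => b * f x + g x with hF
  set q := peakWeight F a Set.univ with hqd
  set τ := d ^ 2 / (2 * lam) with hτ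
  have hτ0 : 0 < τ := by positivity
  have hL := hf.L_nonneg
  have hB0 : 0 ≤ B := dist_nonneg.trans (hB 0 0)
  have hlip : ∀ x y, |φ x - φ y| ≤ Λ * |x - y| := fun x y => by
    simpa [Real.dist_eq] using hΛ.dist_le_mul x y
  have hbd : ∀ x y, |φ x - φ y| ≤ B := fun x y => by simpa [Real.dist_eq] using hB x y
  have hΛ0 : (0 : ℝ) ≤ Λ := Λ.2
  have hS := hq.tendsto_sum ha hl
  obtain ⟨c₀, hc₀, hcS⟩ := exists_pos_le_of_tendsto hS hW
    fun n _ => sum_peakWeight_univ_pos n F a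
  -- the linearised statistic
  set ψ : ℝ → ℝ := fun y => φ (d / τ * y) with hψ
  have hψE : ExpLipschitz (max (Λ * |d / τ|) |φ 0|) 0 ψ := by
    refine expLipschitz_of_lipschitz (fun x y => ?_) (by simp [hψ])
    refine (hlip _ _).trans ?_
    rw [← mul_sub, abs_mul, ← mul_assoc]
    gcongr
    exact le_max_left _ _
  obtain ⟨C₁, hC₁, h1⟩ := hq.abs_ratio_sub_integral_le ha hl _ le_rfl hc₀
  obtain ⟨C₂, hC₂, h2⟩ := hq.sum_mul_abs_pow_le hl 2
  have hlim1 : Tendsto (fun n : ℕ => ∫ ω, ψ (√(n : ℝ) * (plusFraction ω - a)) ∂(gibbs n F)) atTop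
      (𝓝 (∫ y, ψ y ∂(gaussianReal 0 (1 / (2 * lam)).toNNReal))) := by
    refine tendsto_of_abs_sub_le_div_sqrt (C := C₁) fun n hn => ?_
    rw [integral_gibbs_eq n F a fun x => ψ (√(n : ℝ) * (x - a))]
    exact h1 ψ hψE n hn (hcS n hn)
  have hgauss : ∫ y, ψ y ∂(gaussianReal 0 (1 / (2 * lam)).toNNReal)
      = ∫ x, φ x ∂(gaussianReal 0 (2 * lam / d ^ 2).toNNReal) := by
    -- Variance check: `d/τ = 2 lam/d`, and its square times `1/(2 lam)` is `2 lam/d²`.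
    have hmap : gaussianReal 0 (2 * lam / d ^ 2).toNNReal
        = (gaussianReal 0 (1 / (2 * lam)).toNNReal).map (fun x => d / τ * x) := by
      rw [gaussianReal_map_const_mul, mul_zero]
      congr 1
      ext
      push_cast
      rw [Real.coe_toNNReal _ (by positivity), Real.coe_toNNReal _ (by positivity), hτ]
      field_simp
    rw [hmap, integral_map (by fun_prop) hΛ.continuous.aestronglyMeasurable]
  have hsq : ∀ n : ℕ, 0 < n →
      ∫ ω, (√(n : ℝ) * (plusFraction ω - a)) ^ 2 ∂(gibbs n F) ≤ C₂ / c₀ := by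
    intro n hn
    rw [integral_gibbs_eq n F a fun x => (√(n : ℝ) * (x - a)) ^ 2]
    refine div_le_div₀ hC₂.le ?_ hc₀ (hcS n hn)
    refine le_trans (le_of_eq (Finset.sum_congr rfl fun k _ => ?_)) (h2 n hn)
    rw [sq_abs, abs_of_nonneg (peakWeight_nonneg _ _ _ _ _)]
    rfl
  have hlim2 : Tendsto (fun n : ℕ => (∫ ω, φ (√(n : ℝ) * (est n ω - b)) ∂(gibbs n F))
      - ∫ ω, ψ (√(n : ℝ) * (plusFraction ω - a)) ∂(gibbs n F)) atTop (𝓝 0) := by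
    rw [Metric.tendsto_atTop]
    intro η hη
    set M := C₂ / c₀ with hM
    have hM0 : 0 < M := by positivity
    -- With this `ε` the linearisation error on `|X| ≤ R` contributes at most `η/4`. With the next
    -- choice of `R`, the event `|X| > R`, where only boundedness of `φ` and Chebyshev's inequality
    -- are used, contributes at most `η/4` as well.
    set ε := η / (4 * (Λ + 1)) with hε
    have hε0 : 0 < ε := by positivity
    set R := √(4 * B * L ^ 2 * M / η + 1) with hR
    have hR2 : R ^ 2 = 4 * B * L ^ 2 * M / η + 1 := Real.sq_sqrt (by positivity)
    have hev := eventually_abs_mle_sub_le hq ha hl hW hf hK hd (Real.sqrt_nonneg _ : 0 ≤ R) hε0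
    obtain ⟨N, hN⟩ := eventually_atTop.1 (hev.and
      (((tendsto_div_sqrt (Λ / τ * K * M)).eventually (gt_mem_nhds (show 0 < η / 4 by positivity))).and
      (eventually_gt_atTop 0)))
    refine ⟨N, fun n hn => ?_⟩
    obtain ⟨hmle, hsmall, hn0⟩ := hN n hn
    have hs : 0 < √(n : ℝ) := Real.sqrt_pos.2 (by exact_mod_cast hn0)
    have hR0 : 0 < R ^ 2 := by rw [hR2]; positivity
    rw [Real.dist_eq, sub_zero, ← integral_sub (integrable_gibbs _ _ _) (integrable_gibbs _ _ _)]
    have hpt : ∀ ω : Config n, ‖φ (√(n : ℝ) * (est n ω - b)) - ψ (√(n : ℝ) * (plusFraction ω - a))‖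
        ≤ Λ * ε + (Λ / τ * K / √(n : ℝ) + B * L ^ 2 / R ^ 2) *
          (√(n : ℝ) * (plusFraction ω - a)) ^ 2 := by
      intro ω
      have hx := plusFraction_mem ω
      have k1 := hf.abs_scaled_le (n := n) hx
      have k2 := hf.abs_scaled_sub_le hn0 hx
      have k3 := hmle (est n) (hest n) ω
      set y := √(n : ℝ) * (plusFraction ω - a)
      set X := √(n : ℝ) * (f (plusFraction ω) - f a)
      have p1 : 0 ≤ Λ / τ * K / √(n : ℝ) * y ^ 2 := by positivity
      have p2 : 0 ≤ B * L ^ 2 / R ^ 2 * y ^ 2 := by positivity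
      rw [Real.norm_eq_abs, add_mul]
      by_cases hXR : |X| ≤ R
      · have k4 := k3 hXR
        have k5 : |X / τ - d / τ * y| ≤ K / √(n : ℝ) * y ^ 2 / τ := by
          have : X / τ - d / τ * y = (X - d * y) / τ := by ring
          rw [this, abs_div, abs_of_pos hτ0]; gcongr
        have k6 : |√(n : ℝ) * (est n ω - b) - d / τ * y| ≤ ε + K / √(n : ℝ) * y ^ 2 / τ :=
          (abs_sub_le _ (X / τ) _).trans (add_le_add k4 k5)
        calc _ ≤ Λ * |√(n : ℝ) * (est n ω - b) - d / τ * y| := hlip _ _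
          _ ≤ Λ * (ε + K / √(n : ℝ) * y ^ 2 / τ) := by gcongr
          _ = Λ * ε + Λ / τ * K / √(n : ℝ) * y ^ 2 := by ring
          _ ≤ _ := by linarith
      · have k4 : R ^ 2 ≤ L ^ 2 * y ^ 2 := by
          have : R ≤ L * |y| := (not_le.1 hXR).le.trans k1
          rw [← sq_abs y, ← mul_pow]
          exact pow_le_pow_left₀ (Real.sqrt_nonneg _) this 2
        have k5 : B ≤ B * L ^ 2 / R ^ 2 * y ^ 2 := by
          rw [div_mul_eq_mul_div, le_div_iff₀ hR0, mul_assoc]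
          gcongr
        have : 0 ≤ Λ * ε := by positivity
        linarith [hbd (√(n : ℝ) * (est n ω - b)) (d / τ * y)]
    have hint := norm_integral_le_of_norm_le (integrable_gibbs n F _) (Eventually.of_forall hpt)
    rw [Real.norm_eq_abs] at hint
    refine hint.trans_lt ?_
    rw [integral_add (integrable_gibbs _ _ _) (integrable_gibbs _ _ _),
      integral_const_mul (Λ / τ * K / √(n : ℝ) + B * L ^ 2 / R ^ 2)]
    simp only [integral_const, probReal_univ, one_smul]
    have i1 : Λ * ε ≤ η / 4 := by
      rw [hε, mul_div_assoc', div_le_div_iff₀ (by positivity) (by positivity)]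
      nlinarith
    have i2 : B * L ^ 2 / R ^ 2 * M ≤ η / 4 := by
      rw [div_mul_eq_mul_div, div_le_iff₀ hR0, hR2]
      have : η / 4 * (4 * B * L ^ 2 * M / η + 1) = B * L ^ 2 * M + η / 4 := by field_simp
      rw [this]; linarith
    calc _ ≤ Λ * ε + (Λ / τ * K / √(n : ℝ) + B * L ^ 2 / R ^ 2) * M := by
          gcongr; exact hsq n hn0
      _ = Λ * ε + Λ / τ * K * M / √(n : ℝ) + B * L ^ 2 / R ^ 2 * M := by ring
      _ < η := by linarith
  have hfin := hlim2.add hlim1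
  simp only [sub_add_cancel, zero_add] at hfin
  rw [hgauss] at hfin
  simp only [ProbabilityMeasure.coe_mk, Measure.map_id]
  refine hfin.congr fun n => ?_
  rw [integral_map (measurable_of_finite _).aemeasurable hΛ.continuous.aestronglyMeasurable]

end CubicIsing

/-! ### The function `A` and its peaks -/

namespace CubicIsing

/-- First derivative of `assoc`. -/
noncomputable def assocDeriv (β h x : ℝ) : ℝ :=
  6 * β * (2 * x - 1) ^ 2 + 4 * h * (2 * x - 1) + (Real.log (1 - x) - Real.log x)

/-- Second derivative of `assoc`. -/
noncomputable def assocDeriv2 (β h x : ℝ) : ℝ :=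
  24 * β * (2 * x - 1) + 8 * h - 1 / x - 1 / (1 - x)

variable {β h a : ℝ}

lemma hasDerivAt_two_mul_sub_one (x : ℝ) : HasDerivAt (fun x : ℝ => 2 * x - 1) 2 x := by
  simpa using ((hasDerivAt_id x).const_mul 2).sub_const 1

lemma hasDerivAt_cube (x : ℝ) : HasDerivAt cube (6 * (2 * x - 1) ^ 2) x := by
  have := (hasDerivAt_two_mul_sub_one x).pow 3
  refine this.congr_deriv ?_
  norm_num; ring

lemma hasDerivAt_square (x : ℝ) : HasDerivAt square (4 * (2 * x - 1)) x := by
  have := (hasDerivAt_two_mul_sub_one x).pow 2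
  refine this.congr_deriv ?_
  norm_num; ring

lemma hasDerivAt_assoc {x : ℝ} (hx : x ∈ Set.Ioo (0 : ℝ) 1) :
    HasDerivAt (assoc β h) (assocDeriv β h x) x := by
  have h1 := (((hasDerivAt_cube x).const_mul β).add ((hasDerivAt_square x).const_mul h)).add
    (Real.hasDerivAt_binEntropy hx.1.ne' hx.2.ne)
  refine h1.congr_deriv ?_
  rw [assocDeriv]; ring

lemma hasDerivAt_assocDeriv {x : ℝ} (hx : x ∈ Set.Ioo (0 : ℝ) 1) :
    HasDerivAt (assocDeriv β h) (assocDeriv2 β h x) x := by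
  have hx1 : 1 - x ≠ 0 := by linarith [hx.2]
  have h1 := (((hasDerivAt_two_mul_sub_one x).pow 2).const_mul (6 * β)).add
    ((hasDerivAt_two_mul_sub_one x).const_mul (4 * h))
  have h2 := (((hasDerivAt_id x).const_sub 1).log hx1).sub (Real.hasDerivAt_log hx.1.ne')
  refine (h1.add h2).congr_deriv ?_
  rw [assocDeriv2]
  have hx0 := hx.1.ne'
  simp only [id]
  field_simp
  ring

lemma deriv_assoc (ha : a ∈ Set.Ioo (0 : ℝ) 1) : deriv (assoc β h) a = assocDeriv β h a :=
  (hasDerivAt_assoc ha).deriv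

lemma iteratedDeriv_two_assoc (ha : a ∈ Set.Ioo (0 : ℝ) 1) :
    iteratedDeriv 2 (assoc β h) a = assocDeriv2 β h a := by
  rw [iteratedDeriv_succ, iteratedDeriv_one]
  refine ((hasDerivAt_assocDeriv ha).congr_of_eventuallyEq ?_).deriv
  filter_upwards [Ioo_mem_nhds ha.1 ha.2] with x hx using deriv_assoc hx

lemma isTwoRegular_iff (ha : a ∈ Set.Ioo (0 : ℝ) 1) :
    IsTwoRegular (assoc β h) a ↔ assocDeriv β h a = 0 ∧ assocDeriv2 β h a < 0 := by
  rw [IsTwoRegular, deriv_assoc ha, iteratedDeriv_two_assoc ha]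

lemma continuous_assoc : Continuous (assoc β h) := by
  unfold assoc energy cube square
  fun_prop

lemma abs_inv_sub_inv_le {x y : ℝ} (hy : 0 < y) (hx : y / 2 ≤ x) :
    |1 / x - 1 / y| ≤ 2 / y ^ 2 * |x - y| := by
  have hx0 : 0 < x := by linarith
  have e : 1 / x - 1 / y = (y - x) / (x * y) := by field_simp
  rw [e, abs_div, abs_of_pos (mul_pos hx0 hy), abs_sub_comm, div_le_iff₀ (mul_pos hx0 hy)]
  have : 1 ≤ 2 / y ^ 2 * (x * y) := by
    rw [div_mul_eq_mul_div, le_div_iff₀ (by positivity)]; nlinarith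
  calc |x - y| = |x - y| * 1 := (mul_one _).symm
    _ ≤ |x - y| * (2 / y ^ 2 * (x * y)) := by gcongr
    _ = _ := by ring

lemma exists_assoc_expansion (ha : a ∈ Set.Ioo (0 : ℝ) 1) (hreg : IsTwoRegular (assoc β h) a) :
    ∃ K η : ℝ, 0 < η ∧ ∀ x, |x - a| ≤ η →
      |assoc β h x - assoc β h a + |iteratedDeriv 2 (assoc β h) a| / 2 * (x - a) ^ 2|
        ≤ K * |x - a| ^ 3 := by
  obtain ⟨h1, h2⟩ := (isTwoRegular_iff ha).1 hreg
  rw [iteratedDeriv_two_assoc ha, abs_of_neg h2]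
  obtain ⟨ha0, ha1⟩ := ha
  have ha1' : 0 < 1 - a := by linarith
  -- Staying at most halfway to the endpoints makes `1/x` and `1/(1-x)` Lipschitz with constants
  -- `2/a²` and `2/(1-a)²`; with the linear term `48βx` this gives the Lipschitz constant of `A''`.
  set η := min (a / 2) ((1 - a) / 2) with hη
  have hη1 : η ≤ a / 2 := min_le_left _ _
  have hη2 : η ≤ (1 - a) / 2 := min_le_right _ _
  have hη0 : 0 < η := lt_min (by linarith) (by linarith)
  have hmem : ∀ x, |x - a| ≤ η → x ∈ Set.Ioo (0 : ℝ) 1 := fun x hx => by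
    obtain ⟨l, r⟩ := abs_le.1 hx
    constructor <;> linarith
  refine ⟨48 * |β| + 2 / a ^ 2 + 2 / (1 - a) ^ 2, η, hη0, fun x hx => ?_⟩
  have := abs_sub_quadratic_le (A := assoc β h) (A' := assocDeriv β h) (A'' := assocDeriv2 β h)
    (a := a) (η := η) (K := 48 * |β| + 2 / a ^ 2 + 2 / (1 - a) ^ 2) (by positivity)
    (fun x hx => hasDerivAt_assoc (hmem x hx)) (fun x hx => hasDerivAt_assocDeriv (hmem x hx))
    (fun x hx => by
      obtain ⟨l, r⟩ := abs_le.1 hx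
      have i1 := abs_inv_sub_inv_le ha0 (x := x) (by linarith)
      have i2 := abs_inv_sub_inv_le ha1' (x := 1 - x) (by linarith)
      have e2 : |1 - x - (1 - a)| = |x - a| := by rw [abs_sub_comm x a]; congr 1; ring
      rw [e2] at i2
      have e : assocDeriv2 β h x - assocDeriv2 β h a
          = 48 * β * (x - a) - (1 / x - 1 / a) - (1 / (1 - x) - 1 / (1 - a)) := by
        rw [assocDeriv2, assocDeriv2]; ring
      have i3 : |48 * β * (x - a)| = 48 * |β| * |x - a| := by
        rw [abs_mul, abs_mul, abs_of_pos (by norm_num : (0 : ℝ) < 48)]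
      rw [e]
      calc _ ≤ 48 * |β| * |x - a| + 2 / a ^ 2 * |x - a| + 2 / (1 - a) ^ 2 * |x - a| := by
            refine (abs_sub _ _).trans (add_le_add ((abs_sub _ _).trans (add_le_add i3.le i1)) i2)
        _ = _ := by ring) h1 hx
  refine le_trans (le_of_eq ?_) this
  congr 1; ring

/-- Each global maximizer contributes a Gaussian peak. -/
theorem gaussianLike_assoc {S : Set ℝ} (hS : maximizers (assoc β h) = S) (haS : a ∈ S)
    (ha : a ∈ Set.Ioo (0 : ℝ) 1) (hreg : IsTwoRegular (assoc β h) a) {D : Set ℝ} (hD : D ∈ 𝓝 a)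
    (hDS : closure D ∩ S ⊆ {a}) :
    GaussianLike a (weight (assoc β h) a) (|iteratedDeriv 2 (assoc β h) a| / 2)
      (peakWeight (energy β h) a D) := by
  obtain ⟨K, η, hη, hexp⟩ := exists_assoc_expansion ha hreg
  have hl : 0 < |iteratedDeriv 2 (assoc β h) a| / 2 := half_pos (abs_pos.2 hreg.2.ne)
  obtain ⟨ρ, hρ, hρD⟩ := Metric.mem_nhds_iff.1 hD
  have hcomp : IsCompact (closure D ∩ Set.Icc 0 1) :=
    (isCompact_Icc (a := (0 : ℝ)) (b := 1)).inter_left isClosed_closure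
  have hamax : ∀ x ∈ Set.Icc (0 : ℝ) 1, assoc β h x ≤ assoc β h a := by
    rw [← hS] at haS
    exact fun x hx => haS.2 hx
  -- Compactness is used on the closure of `D`, which is why the closure must contain no maximizer
  -- other than `a`.
  obtain ⟨c, hc, hquad⟩ := exists_le_sub_mul_sq (A := assoc β h) (a := a) (K := K) hcomp
    continuous_assoc.continuousOn hl hη hexp (fun x hx hxa => by
      refine lt_of_le_of_ne (hamax x hx.2) fun heq => hxa (hDS ⟨hx.1, ?_⟩)
      rw [← hS]
      exact ⟨hx.2, fun y hy => by rw [Set.mem_ofPred_eq, heq]; exact hamax y hy⟩)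
  have := gaussianLike_peakWeight (F := energy β h) ha hl hη (half_pos hρ) hc hexp
    (fun x hx => hρD (by rw [Metric.mem_ball, Real.dist_eq]; linarith))
    (fun x hx hx01 => hquad x ⟨subset_closure hx, hx01⟩)
  rwa [show 2 * (|iteratedDeriv 2 (assoc β h) a| / 2)
    = |iteratedDeriv 2 (assoc β h) a| by ring] at this

lemma weight_pos (ha : a ∈ Set.Ioo (0 : ℝ) 1) (hreg : IsTwoRegular (assoc β h) a) :
    0 < weight (assoc β h) a := by
  have h1 : 0 < |iteratedDeriv 2 (assoc β h) a| := abs_pos.2 hreg.2.ne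
  have h2 : 0 < a * (1 - a) := mul_pos ha.1 (by linarith [ha.2])
  unfold weight
  positivity

/-- Away from the maximizers, `assoc` is bounded away from its maximum. -/
lemma exists_assoc_le_sub {S : Set ℝ} (hS : maximizers (assoc β h) = S) (haS : a ∈ S)
    {E : Set ℝ} (hE : IsClosed E) (hES : Disjoint E S) :
    ∃ c : ℝ, 0 < c ∧ ∀ x ∈ E, x ∈ Set.Icc (0 : ℝ) 1 → assoc β h x ≤ assoc β h a - c := by
  have hamax : ∀ x ∈ Set.Icc (0 : ℝ) 1, assoc β h x ≤ assoc β h a := by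
    rw [← hS] at haS
    exact fun x hx => haS.2 hx
  have hcomp : IsCompact (E ∩ Set.Icc 0 1) :=
    (isCompact_Icc (a := (0 : ℝ)) (b := 1)).inter_left hE
  rcases (E ∩ Set.Icc (0 : ℝ) 1).eq_empty_or_nonempty with hemp | hne
  · refine ⟨1, one_pos, fun x hx hx01 => ?_⟩
    have : x ∈ E ∩ Set.Icc (0 : ℝ) 1 := ⟨hx, hx01⟩
    rw [hemp] at this
    exact this.elim
  · obtain ⟨x₀, hx₀, hmax⟩ := hcomp.exists_isMaxOn hne (continuous_assoc (β := β) (h := h)).continuousOn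
    refine ⟨assoc β h a - assoc β h x₀, sub_pos.2 (lt_of_le_of_ne (hamax x₀ hx₀.2) fun heq => ?_),
      fun x hx hx01 => ?_⟩
    · refine Set.disjoint_left.1 hES hx₀.1 ?_
      rw [← hS]
      exact ⟨hx₀.2, fun y hy => by rw [Set.mem_ofPred_eq, heq]; exact hamax y hy⟩
    · have := hmax (show x ∈ E ∩ Set.Icc (0 : ℝ) 1 from ⟨hx, hx01⟩)
      rw [Set.mem_ofPred_eq] at this
      linarith

/-- The reference point enters only through the height `A(a)`, so maximizers of equal height share
one normalisation. -/
lemma peakWeight_congr {F : ℝ → ℝ} {a b : ℝ}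
    (h : F a + Real.binEntropy a = F b + Real.binEntropy b) :
    peakWeight F a = peakWeight F b := by
  funext D n k
  rw [peakWeight, peakWeight, h]

/-- A single peak determines the partition function. -/
lemma partitionLimit_of_gaussianLike {F : ℝ → ℝ} {W lam : ℝ} (hW : 0 < W)
    (hq : GaussianLike a W lam (peakWeight F a Set.univ)) (ha : a ∈ Set.Ioo (0 : ℝ) 1)
    (hl : 0 < lam) : PartitionLimit F a W :=
  ⟨hW, hq.abs_sum_sub_le ha hl⟩

lemma peakWeight_univ_eq_add (F : ℝ → ℝ) (a : ℝ) (D : Set ℝ) (n k : ℕ) :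
    peakWeight F a Set.univ n k = peakWeight F a D n k + peakWeight F a Dᶜ n k := by
  unfold peakWeight
  by_cases h : (k / n : ℝ) ∈ D <;> simp [h]

/-- Two peaks of equal height determine the partition function. -/
lemma partitionLimit_of_gaussianLike_of_gaussianLike {F : ℝ → ℝ} {b W₁ W₂ lam₁ lam₂ : ℝ}
    {D : Set ℝ} (hW₁ : 0 < W₁) (hW₂ : 0 < W₂)
    (hab : F a + Real.binEntropy a = F b + Real.binEntropy b)
    (hq₁ : GaussianLike a W₁ lam₁ (peakWeight F a D))
    (hq₂ : GaussianLike b W₂ lam₂ (peakWeight F b Dᶜ))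
    (ha : a ∈ Set.Ioo (0 : ℝ) 1) (hb : b ∈ Set.Ioo (0 : ℝ) 1) (hl₁ : 0 < lam₁) (hl₂ : 0 < lam₂) :
    PartitionLimit F a (W₁ + W₂) := by
  obtain ⟨C₁, hC₁, h1⟩ := hq₁.abs_sum_sub_le ha hl₁
  obtain ⟨C₂, hC₂, h2⟩ := hq₂.abs_sum_sub_le hb hl₂
  refine ⟨by positivity, C₁ + C₂, by positivity, fun n hn => ?_⟩
  have e : ∑ k ∈ Finset.range (n + 1), peakWeight F a Set.univ n k - (W₁ + W₂)
      = (∑ k ∈ Finset.range (n + 1), peakWeight F a D n k - W₁)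
        + (∑ k ∈ Finset.range (n + 1), peakWeight F b Dᶜ n k - W₂) := by
    rw [← peakWeight_congr hab]
    simp only [peakWeight_univ_eq_add F a D, Finset.sum_add_distrib]
    ring
  rw [e, add_div]
  exact (abs_add_le _ _).trans (add_le_add (h1 n hn) (h2 n hn))

lemma firstOrder_cube (a : ℝ) (ha : a ∈ Set.Ioo (0 : ℝ) 1) :
    FirstOrder cube a (6 * (2 * a - 1) ^ 2) 20 6 := by
  obtain ⟨ha0, ha1⟩ := ha
  refine ⟨?_, fun x hx => ?_, fun x hx => ?_⟩
  · rw [abs_of_nonneg (by positivity)]; nlinarith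
  · have e : cube x - cube a = 2 * ((2 * x - 1) ^ 2 + (2 * x - 1) * (2 * a - 1) + (2 * a - 1) ^ 2)
        * (x - a) := by unfold cube; ring
    rw [e, abs_mul]
    gcongr
    obtain ⟨hx0, hx1⟩ := hx
    have p1 : (2 * x - 1) ^ 2 ≤ 1 := by nlinarith
    have p2 : (2 * a - 1) ^ 2 ≤ 1 := by nlinarith
    rw [abs_le]
    constructor <;> nlinarith [sq_nonneg ((2 * x - 1) + (2 * a - 1)),
      sq_nonneg ((2 * x - 1) - (2 * a - 1))]
  · have e : cube x - cube a - 6 * (2 * a - 1) ^ 2 * (x - a)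
        = 4 * ((2 * x - 1) + 2 * (2 * a - 1)) * (x - a) ^ 2 := by unfold cube; ring
    rw [e, abs_mul, abs_of_nonneg (sq_nonneg (x - a))]
    gcongr
    rw [abs_le]
    constructor <;> linarith [hx.1, hx.2]

lemma firstOrder_square (a : ℝ) (ha : a ∈ Set.Ioo (0 : ℝ) 1) :
    FirstOrder square a (4 * (2 * a - 1)) 4 4 := by
  obtain ⟨ha0, ha1⟩ := ha
  refine ⟨?_, fun x hx => ?_, fun x hx => ?_⟩
  · rw [abs_le]; constructor <;> linarith
  · have e : square x - square a = 4 * (x + a - 1) * (x - a) := by unfold square; ring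
    rw [e, abs_mul]
    gcongr
    rw [abs_le]; constructor <;> linarith [hx.1, hx.2]
  · have e : square x - square a - 4 * (2 * a - 1) * (x - a) = 4 * (x - a) ^ 2 := by
      unfold square; ring
    rw [e, abs_of_nonneg (by positivity)]

end CubicIsing

/-! ### Calculus of the gain function -/

namespace CubicIsing

/-- The entropy loss `log 2 - I((1+z)/2)` at magnetization `z`. -/
noncomputable def entropyLoss (z : ℝ) : ℝ := Real.log 2 - Real.binEntropy ((1 + z) / 2)

/-- The gain of `assoc` over its value at `1/2`, in terms of the magnetization. -/
noncomputable def gain (β h z : ℝ) : ℝ := β * z ^ 3 + h * z ^ 2 - entropyLoss z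

/-- First derivative of `gain`. -/
noncomputable def gainDeriv (β h z : ℝ) : ℝ :=
  3 * β * z ^ 2 + 2 * h * z - (Real.log (1 + z) - Real.log (1 - z)) / 2

/-- Second derivative of `gain`. -/
noncomputable def gainDeriv2 (β h z : ℝ) : ℝ := 6 * β * z + 2 * h - 1 / (1 - z ^ 2)

/-- Third derivative of `gain`. -/
noncomputable def gainDeriv3 (β z : ℝ) : ℝ := 6 * β - 2 * z / (1 - z ^ 2) ^ 2

variable {β h : ℝ}

@[simp] lemma entropyLoss_zero : entropyLoss 0 = 0 := by
  rw [entropyLoss, add_zero, one_div, Real.binEntropy_two_inv, sub_self]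

lemma entropyLoss_nonneg (z : ℝ) : 0 ≤ entropyLoss z :=
  sub_nonneg.2 Real.binEntropy_le_log_two

lemma entropyLoss_neg (z : ℝ) : entropyLoss (-z) = entropyLoss z := by
  rw [entropyLoss, entropyLoss, ← Real.binEntropy_one_sub]
  congr 2; ring

@[fun_prop] lemma continuous_entropyLoss : Continuous entropyLoss := by
  unfold entropyLoss; fun_prop

@[simp] lemma gain_zero (β h : ℝ) : gain β h 0 = 0 := by simp [gain]

lemma continuous_gain (β h : ℝ) : Continuous (gain β h) := by
  unfold gain; fun_prop

lemma assoc_eq_gain (β h a : ℝ) : assoc β h a = gain β h (2 * a - 1) + Real.log 2 := by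
  rw [assoc, gain, entropyLoss, energy, cube, square, show (1 + (2 * a - 1)) / 2 = a by ring]
  ring

/-- Only the cubic term is odd, and `β > 0` makes it favour positive magnetization. This excludes
negative maximizers. -/
lemma gain_lt_gain_neg (hβ : 0 < β) {z : ℝ} (hz : z < 0) : gain β h z < gain β h (-z) := by
  have h3 : z ^ 3 < 0 := Odd.pow_neg (by decide) hz
  have h4 : (-z) ^ 3 = -z ^ 3 := by ring
  have := mul_neg_of_pos_of_neg hβ h3
  rw [gain, gain, entropyLoss_neg, h4, neg_sq]
  linarith

lemma hasDerivAt_gain (β h : ℝ) {z : ℝ} (hz : z ∈ Set.Ioo (-1 : ℝ) 1) :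
    HasDerivAt (gain β h) (gainDeriv β h z) z := by
  obtain ⟨h1, h2⟩ := hz
  have p1 : 0 < (1 + z) / 2 := by linarith
  have p2 : (1 + z) / 2 < 1 := by linarith
  have d1 : HasDerivAt (fun z : ℝ => (1 + z) / 2) (1 / 2) z :=
    ((hasDerivAt_id z).const_add 1).div_const 2
  have d2 := ((Real.hasDerivAt_binEntropy p1.ne' p2.ne).comp z d1).const_sub (Real.log 2)
  have d3 := ((((hasDerivAt_id z).pow 3).const_mul β).add
    (((hasDerivAt_id z).pow 2).const_mul h)).sub d2
  refine d3.congr_deriv ?_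
  have e : 1 - (1 + z) / 2 = (1 - z) / 2 := by ring
  rw [gainDeriv, e, Real.log_div (by linarith) two_ne_zero, Real.log_div (by linarith) two_ne_zero]
  simp; ring

lemma one_sub_sq_pos {z : ℝ} (hz : z ∈ Set.Ioo (-1 : ℝ) 1) : 0 < 1 - z ^ 2 := by
  nlinarith [hz.1, hz.2]

lemma hasDerivAt_gainDeriv (β h : ℝ) {z : ℝ} (hz : z ∈ Set.Ioo (-1 : ℝ) 1) :
    HasDerivAt (gainDeriv β h) (gainDeriv2 β h z) z := by
  have hsq := (one_sub_sq_pos hz).ne'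
  obtain ⟨h1, h2⟩ := hz
  have p1 : 1 + z ≠ 0 := by linarith
  have p2 : 1 - z ≠ 0 := by linarith
  have d := ((((hasDerivAt_id z).pow 2).const_mul (3 * β)).add
    ((hasDerivAt_id z).const_mul (2 * h))).sub
    (((((hasDerivAt_id z).const_add 1).log p1).sub
      (((hasDerivAt_id z).const_sub 1).log p2)).div_const 2)
  refine d.congr_deriv ?_
  rw [gainDeriv2]
  simp only [id]
  have e : 1 - z ^ 2 = (1 + z) * (1 - z) := by ring
  rw [e]
  field_simp
  ring

lemma hasDerivAt_gainDeriv2 (β h : ℝ) {z : ℝ} (hz : z ∈ Set.Ioo (-1 : ℝ) 1) :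
    HasDerivAt (gainDeriv2 β h) (gainDeriv3 β z) z := by
  have hsq := (one_sub_sq_pos hz).ne'
  have d := (((hasDerivAt_id z).const_mul (6 * β)).add_const (2 * h)).sub
    ((((hasDerivAt_id z).pow 2).const_sub 1).inv hsq)
  have d' : HasDerivAt (gainDeriv2 β h) _ z := d.congr_of_eventuallyEq
    (Eventually.of_forall fun w => by simp [gainDeriv2])
  refine d'.congr_deriv ?_
  rw [gainDeriv3]
  simp

lemma gainDeriv3_strictAntiOn (β : ℝ) : StrictAntiOn (gainDeriv3 β) (Set.Ico 0 1) := by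
  intro x hx y hy hxy
  have hy' := one_sub_sq_pos (z := y) ⟨by linarith [hy.1], hy.2⟩
  have hx' := one_sub_sq_pos (z := x) ⟨by linarith [hx.1], hx.2⟩
  have h1 : (1 - y ^ 2) ^ 2 ≤ (1 - x ^ 2) ^ 2 := by
    refine pow_le_pow_left₀ hy'.le ?_ 2
    nlinarith [hx.1]
  have h2 : 2 * x / (1 - x ^ 2) ^ 2 < 2 * y / (1 - y ^ 2) ^ 2 := by
    have hx0 := hx.1
    calc 2 * x / (1 - x ^ 2) ^ 2 ≤ 2 * x / (1 - y ^ 2) ^ 2 := by gcongr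
      _ < _ := by gcongr
  unfold gainDeriv3
  linarith

/-- The derivative of `z ↦ gainDeriv z / z`, multiplied by `z²`. -/
noncomputable def slopeNumerator (β h z : ℝ) : ℝ := z * gainDeriv2 β h z - gainDeriv β h z

lemma hasDerivAt_slopeNumerator (β h : ℝ) {z : ℝ} (hz : z ∈ Set.Ioo (-1 : ℝ) 1) :
    HasDerivAt (slopeNumerator β h) (z * gainDeriv3 β z) z := by
  have d := ((hasDerivAt_id z).mul (hasDerivAt_gainDeriv2 β h hz)).sub (hasDerivAt_gainDeriv β h hz)
  refine d.congr_deriv ?_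
  simp

@[simp] lemma gainDeriv_zero (β h : ℝ) : gainDeriv β h 0 = 0 := by simp [gainDeriv]

@[simp] lemma slopeNumerator_zero (β h : ℝ) : slopeNumerator β h 0 = 0 := by simp [slopeNumerator]

lemma strictMonoOn_Icc_of_hasDerivAt {f f' : ℝ → ℝ} {a b : ℝ}
    (hf : ContinuousOn f (Set.Icc a b)) (hd : ∀ x ∈ Set.Ioo a b, HasDerivAt f (f' x) x)
    (hp : ∀ x ∈ Set.Ioo a b, 0 < f' x) : StrictMonoOn f (Set.Icc a b) :=
  strictMonoOn_of_deriv_pos (convex_Icc a b) hf fun x hx => by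
    rw [interior_Icc] at hx
    rw [(hd x hx).deriv]; exact hp x hx

lemma strictAntiOn_Icc_of_hasDerivAt {f f' : ℝ → ℝ} {a b : ℝ}
    (hf : ContinuousOn f (Set.Icc a b)) (hd : ∀ x ∈ Set.Ioo a b, HasDerivAt f (f' x) x)
    (hp : ∀ x ∈ Set.Ioo a b, f' x < 0) : StrictAntiOn f (Set.Icc a b) :=
  strictAntiOn_of_deriv_neg (convex_Icc a b) hf fun x hx => by
    rw [interior_Icc] at hx
    rw [(hd x hx).deriv]; exact hp x hx

lemma continuousOn_of_hasDerivAt {f f' : ℝ → ℝ} {a b : ℝ} (ha : -1 < a) (hb : b < 1)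
    (hd : ∀ x ∈ Set.Ioo (-1 : ℝ) 1, HasDerivAt f (f' x) x) : ContinuousOn f (Set.Icc a b) :=
  fun x hx => (hd x ⟨by linarith [hx.1], by linarith [hx.2]⟩).continuousAt.continuousWithinAt

/-- The third derivative decreases strictly, so it is positive on all of `(0, z)`, and the numerator
increases from its value 0 at the origin. -/
lemma slopeNumerator_pos {z : ℝ} (hz : z ∈ Set.Ioo (0 : ℝ) 1) (h3 : 0 ≤ gainDeriv3 β z) :
    0 < slopeNumerator β h z := by
  have hmono : StrictMonoOn (slopeNumerator β h) (Set.Icc 0 z) :=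
    strictMonoOn_Icc_of_hasDerivAt
      (continuousOn_of_hasDerivAt (by norm_num) hz.2 fun x hx => hasDerivAt_slopeNumerator β h hx)
      (fun x hx => hasDerivAt_slopeNumerator β h ⟨by linarith [hx.1], by linarith [hx.2, hz.2]⟩)
      (fun x hx => mul_pos hx.1 (h3.trans_lt (gainDeriv3_strictAntiOn β
        ⟨hx.1.le, hx.2.trans hz.2⟩ ⟨hz.1.le, hz.2⟩ hx.2)))
  have := hmono (Set.left_mem_Icc.2 hz.1.le) (Set.right_mem_Icc.2 hz.1.le) hz.1
  simpa using this

/-- Once the third derivative is negative it stays negative. With `slopeNumerator_pos` this means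
that the numerator rises from 0, then falls, and changes sign at most once. -/
lemma slopeNumerator_lt {z w : ℝ} (hz : 0 < z) (hzw : z < w) (hw : w < 1)
    (h3 : gainDeriv3 β z < 0) : slopeNumerator β h w < slopeNumerator β h z := by
  have hanti : StrictAntiOn (slopeNumerator β h) (Set.Icc z w) :=
    strictAntiOn_Icc_of_hasDerivAt
      (continuousOn_of_hasDerivAt (by linarith) hw fun x hx => hasDerivAt_slopeNumerator β h hx)
      (fun x hx => hasDerivAt_slopeNumerator β h ⟨by linarith [hx.1], by linarith [hx.2]⟩)
      (fun x hx => mul_neg_of_pos_of_neg (hz.trans hx.1) ((gainDeriv3_strictAntiOn β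
        ⟨hz.le, by linarith⟩ ⟨(hz.trans hx.1).le, hx.2.trans hw⟩ hx.1).trans h3))
  exact hanti (Set.left_mem_Icc.2 hzw.le) (Set.right_mem_Icc.2 hzw.le) hzw

lemma hasDerivAt_gainDeriv_div {z : ℝ} (hz : z ∈ Set.Ioo (0 : ℝ) 1) :
    HasDerivAt (fun z => gainDeriv β h z / z) (slopeNumerator β h z / z ^ 2) z := by
  have d := (hasDerivAt_gainDeriv β h (z := z) ⟨by linarith [hz.1], hz.2⟩).div (hasDerivAt_id z)
    hz.1.ne'
  refine d.congr_deriv ?_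
  simp [slopeNumerator, mul_comm]

/-- A positive critical point at which `gain` is nonnegative is nondegenerate, and `gain`
decreases beyond it. -/
lemma gainDeriv2_neg_of_critical {z₀ : ℝ} (hz : z₀ ∈ Set.Ioo (0 : ℝ) 1)
    (hcrit : gainDeriv β h z₀ = 0) (hpos : 0 ≤ gain β h z₀) :
    gainDeriv2 β h z₀ < 0 ∧ ∀ z ∈ Set.Ioo z₀ 1, gainDeriv β h z < 0 := by
  obtain ⟨hz0, hz1⟩ := hz
  -- Otherwise the numerator is positive on `(0, z₀)`, so `gainDeriv z / z` increases to 0 at `z₀`.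
  -- Then `gain` decreases on `[0, z₀]` and is negative at `z₀`.
  have hV : slopeNumerator β h z₀ < 0 := by
    by_contra hcon
    have hcon' := not_lt.1 hcon
    have hVpos : ∀ z ∈ Set.Ioo 0 z₀, 0 < slopeNumerator β h z := fun z hz => by
      by_cases h3 : 0 ≤ gainDeriv3 β z
      · exact slopeNumerator_pos ⟨hz.1, hz.2.trans hz1⟩ h3
      · exact hcon'.trans_lt (slopeNumerator_lt hz.1 hz.2 hz1 (not_le.1 h3))
    have hneg : ∀ z ∈ Set.Ioo 0 z₀, gainDeriv β h z < 0 := fun z hz => by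
      have hmono : StrictMonoOn (fun z => gainDeriv β h z / z) (Set.Icc z z₀) :=
        strictMonoOn_Icc_of_hasDerivAt
          (fun x hx => (hasDerivAt_gainDeriv_div ⟨by linarith [hx.1, hz.1],
            by linarith [hx.2]⟩).continuousAt.continuousWithinAt)
          (fun x hx => hasDerivAt_gainDeriv_div ⟨by linarith [hx.1, hz.1], by linarith [hx.2]⟩)
          (fun x hx => div_pos (hVpos x ⟨by linarith [hx.1, hz.1], hx.2⟩)
            (by have : 0 < x := by linarith [hx.1, hz.1]
                positivity))
      have := hmono (Set.left_mem_Icc.2 hz.2.le) (Set.right_mem_Icc.2 hz.2.le) hz.2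
      simp only [hcrit, zero_div] at this
      exact (div_neg_iff.1 this).elim (fun h => absurd h.2 (by linarith [hz.1])) fun h => h.1
    have hanti : StrictAntiOn (gain β h) (Set.Icc 0 z₀) :=
      strictAntiOn_Icc_of_hasDerivAt (continuous_gain β h).continuousOn
        (fun x hx => hasDerivAt_gain β h ⟨by linarith [hx.1], by linarith [hx.2]⟩) hneg
    have := hanti (Set.left_mem_Icc.2 hz0.le) (Set.right_mem_Icc.2 hz0.le) hz0
    rw [gain_zero] at this
    linarith
  have h3 : gainDeriv3 β z₀ < 0 := by
    by_contra hcon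
    exact absurd (slopeNumerator_pos (h := h) ⟨hz0, hz1⟩ (not_lt.1 hcon)) (by linarith)
  constructor
  · rw [slopeNumerator, hcrit, sub_zero] at hV
    exact (mul_neg_iff.1 hV).elim (fun h => h.2) fun h => absurd h.1 (by linarith)
  · intro z hz
    -- Beyond `z₀` the numerator keeps falling and stays negative, so `gainDeriv z / z` decreases
    -- from 0.
    have hanti : StrictAntiOn (fun z => gainDeriv β h z / z) (Set.Icc z₀ z) :=
      strictAntiOn_Icc_of_hasDerivAt
        (fun x hx => (hasDerivAt_gainDeriv_div ⟨by linarith [hx.1],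
          by linarith [hx.2, hz.2]⟩).continuousAt.continuousWithinAt)
        (fun x hx => hasDerivAt_gainDeriv_div ⟨by linarith [hx.1], by linarith [hx.2, hz.2]⟩)
        (fun x hx => div_neg_of_neg_of_pos
          ((slopeNumerator_lt hz0 hx.1 (by linarith [hx.2, hz.2]) h3).trans hV)
          (by have : 0 < x := by linarith [hx.1]
              positivity))
    have := hanti (Set.left_mem_Icc.2 hz.1.le) (Set.right_mem_Icc.2 hz.1.le) hz.1
    simp only [hcrit, zero_div] at this
    exact (div_neg_iff.1 this).elim (fun h => absurd h.2 (by linarith [hz.1])) fun h => h.1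

/-- The saturated state is never a maximizer. -/
lemma exists_gain_one_lt (hβ : 0 < β) : ∃ z ∈ Set.Ioo (0 : ℝ) 1, gain β h 1 < gain β h z := by
  -- `R` bounds the polynomial part of the derivative on `(0,1)`. Beyond `z₁ = 1 - exp (-2R)` the
  -- term `log (1 - x) / 2` lies below `-R`, so `gain` decreases up to 1.
  set R := 3 * β + 2 * |h| with hR
  have hR0 : 0 < R := by positivity
  have he : Real.exp (-(2 * R)) < 1 := by rw [Real.exp_lt_one_iff]; linarith
  have he0 := Real.exp_pos (-(2 * R))
  set z₁ := 1 - Real.exp (-(2 * R)) with hz₁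
  have hz0 : 0 < z₁ := by linarith
  have hz1 : z₁ < 1 := by linarith
  refine ⟨z₁, ⟨hz0, hz1⟩, ?_⟩
  have hanti : StrictAntiOn (gain β h) (Set.Icc z₁ 1) :=
    strictAntiOn_Icc_of_hasDerivAt (continuous_gain β h).continuousOn
      (fun x hx => hasDerivAt_gain β h ⟨by linarith [hx.1], hx.2⟩) (fun x hx => by
        have hx0 : 0 < x := by linarith [hx.1]
        have l1 : 0 < Real.log (1 + x) := Real.log_pos (by linarith)
        have l2 : Real.log (1 - x) < -(2 * R) := by
          rw [Real.log_lt_iff_lt_exp (by linarith [hx.2])]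
          linarith [hx.1]
        have l3 : 3 * β * x ^ 2 ≤ 3 * β := by
          have : x ^ 2 ≤ 1 := by nlinarith [hx.2]
          nlinarith
        have l4 : 2 * h * x ≤ 2 * |h| := by
          have : h * x ≤ |h| := by
            calc h * x ≤ |h| * x := by gcongr; exact le_abs_self h
              _ ≤ |h| * 1 := by gcongr; exact hx.2.le
              _ = |h| := mul_one _
          linarith
        unfold gainDeriv
        linarith)
  exact hanti (Set.left_mem_Icc.2 hz1.le) (Set.right_mem_Icc.2 hz1.le) hz1

/-- This is `gain 0 (1/2) z ≤ 0`: value and first derivative vanish at 0, and the second derivative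
`1 - 1/(1 - z²)` is negative on `(0,1)`. -/
lemma sq_div_two_le_entropyLoss {z : ℝ} (hz : z ∈ Set.Icc (0 : ℝ) 1) :
    z ^ 2 / 2 ≤ entropyLoss z := by
  have h1 : ∀ x ∈ Set.Ioo (0 : ℝ) 1, gainDeriv 0 (1 / 2) x < 0 := fun x hx => by
    have hanti : StrictAntiOn (gainDeriv 0 (1 / 2)) (Set.Icc 0 x) :=
      strictAntiOn_Icc_of_hasDerivAt
        (continuousOn_of_hasDerivAt (by norm_num) hx.2 fun y hy => hasDerivAt_gainDeriv _ _ hy)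
        (fun y hy => hasDerivAt_gainDeriv _ _ ⟨by linarith [hy.1], by linarith [hy.2, hx.2]⟩)
        (fun y hy => by
          have hy1 : y < 1 := hy.2.trans hx.2
          have hpos := one_sub_sq_pos (z := y) ⟨by linarith [hy.1], hy1⟩
          have : 1 < 1 / (1 - y ^ 2) := by
            rw [lt_div_iff₀ hpos]; nlinarith [hy.1]
          unfold gainDeriv2
          linarith)
    have := hanti (Set.left_mem_Icc.2 hx.1.le) (Set.right_mem_Icc.2 hx.1.le) hx.1
    simpa using this
  have hanti : StrictAntiOn (gain 0 (1 / 2)) (Set.Icc 0 1) :=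
    strictAntiOn_Icc_of_hasDerivAt (continuous_gain _ _).continuousOn
      (fun x hx => hasDerivAt_gain _ _ ⟨by linarith [hx.1], hx.2⟩) h1
  have := hanti.antitoneOn (Set.left_mem_Icc.2 zero_le_one) hz hz.1
  rw [gain_zero, gain] at this
  linarith

/-- For `h ≥ 1/2` the quadratic coefficient at 0 is nonnegative and the cubic term beats the quartic
one: `6βy > 1/(1-y²) - 1` for `0 < y < min (1/2) β`. Hence the curve stays strictly below `1/2`. -/
lemma exists_gain_pos (hβ : 0 < β) (hh : 1 / 2 ≤ h) : ∃ z ∈ Set.Ioo (0 : ℝ) 1, 0 < gain β h z := by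
  set z₀ := min (1 / 2) β with hz₀
  have hz0 : 0 < z₀ := lt_min (by norm_num) hβ
  have hz12 : z₀ ≤ 1 / 2 := min_le_left _ _
  have hzβ : z₀ ≤ β := min_le_right _ _
  have h1 : ∀ x ∈ Set.Ioo (0 : ℝ) z₀, 0 < gainDeriv β h x := fun x hx => by
    have hmono : StrictMonoOn (gainDeriv β h) (Set.Icc 0 x) :=
      strictMonoOn_Icc_of_hasDerivAt
        (continuousOn_of_hasDerivAt (by norm_num) (by linarith [hx.2])
          fun y hy => hasDerivAt_gainDeriv _ _ hy)
        (fun y hy => hasDerivAt_gainDeriv _ _ ⟨by linarith [hy.1], by linarith [hy.2, hx.2]⟩)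
        (fun y hy => by
          have hy1 : y < 1 / 2 := by linarith [hy.2, hx.2]
          have hyβ : y < β := by linarith [hy.2, hx.2]
          have hy0 := hy.1
          have hpos := one_sub_sq_pos (z := y) ⟨by linarith, by linarith⟩
          have : 1 / (1 - y ^ 2) < 6 * β * y + 1 := by
            rw [div_lt_iff₀ hpos]
            have h2 : y ^ 2 ≤ 1 / 4 := by nlinarith
            have h3 : y ^ 2 ≤ β * y := by nlinarith
            have h4 : 0 < β * y := by positivity
            nlinarith
          unfold gainDeriv2
          linarith)
    have := hmono (Set.left_mem_Icc.2 hx.1.le) (Set.right_mem_Icc.2 hx.1.le) hx.1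
    simpa using this
  have hmono : StrictMonoOn (gain β h) (Set.Icc 0 z₀) :=
    strictMonoOn_Icc_of_hasDerivAt (continuous_gain _ _).continuousOn
      (fun x hx => hasDerivAt_gain _ _ ⟨by linarith [hx.1], by linarith [hx.2]⟩) h1
  have := hmono (Set.left_mem_Icc.2 hz0.le) (Set.right_mem_Icc.2 hz0.le) hz0
  rw [gain_zero] at this
  exact ⟨z₀, ⟨hz0, by linarith⟩, this⟩

/-! ### The critical curve and the maximizers -/

/-- The critical curve: above it the magnetized state wins. -/
noncomputable def criticalCurve (β : ℝ) : ℝ :=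
  sInf ((fun z : ℝ => entropyLoss z / z ^ 2 - β * z) '' Set.Ioc 0 1)

lemma criticalCurve_set_bddBelow (β : ℝ) :
    BddBelow ((fun z : ℝ => entropyLoss z / z ^ 2 - β * z) '' Set.Ioc 0 1) := by
  refine ⟨-|β|, ?_⟩
  rintro _ ⟨z, hz, rfl⟩
  have h1 : 0 ≤ entropyLoss z / z ^ 2 := div_nonneg (entropyLoss_nonneg z) (sq_nonneg z)
  have h2 : β * z ≤ |β| := by
    have hz0 := hz.1
    calc β * z ≤ |β| * z := by gcongr; exact le_abs_self β
      _ ≤ |β| * 1 := by gcongr; exact hz.2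
      _ = |β| := mul_one _
  simp only
  linarith

lemma criticalCurve_set_nonempty (β : ℝ) :
    ((fun z : ℝ => entropyLoss z / z ^ 2 - β * z) '' Set.Ioc 0 1).Nonempty :=
  ⟨_, 1, ⟨one_pos, le_rfl⟩, rfl⟩

lemma criticalCurve_le {z : ℝ} (hz : z ∈ Set.Ioc (0 : ℝ) 1) :
    criticalCurve β ≤ entropyLoss z / z ^ 2 - β * z :=
  csInf_le (criticalCurve_set_bddBelow β) ⟨z, hz, rfl⟩

/-- This identity motivates the definition of `criticalCurve`: the sign of the gain is decided by
comparing `h` with the function whose infimum is taken there. -/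
lemma gain_eq_sq_mul {z : ℝ} (hz : z ≠ 0) :
    gain β h z = z ^ 2 * (h - (entropyLoss z / z ^ 2 - β * z)) := by
  rw [gain]; field_simp; ring

/-- For fixed `z` in `(0,1]` the competitor is 1-Lipschitz in `β`, and so is the infimum. -/
lemma continuous_criticalCurve : Continuous criticalCurve := by
  have key : ∀ x y : ℝ, criticalCurve x ≤ criticalCurve y + 1 * dist x y := by
    intro x y
    rw [← sub_le_iff_le_add]
    refine le_csInf (criticalCurve_set_nonempty y) ?_
    rintro _ ⟨z, hz, rfl⟩
    have h1 := criticalCurve_le (β := x) hz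
    have h2 : (y - x) * z ≤ dist x y := by
      rw [Real.dist_eq, abs_sub_comm]
      have hz0 := hz.1
      calc (y - x) * z ≤ |y - x| * z := by gcongr; exact le_abs_self _
        _ ≤ |y - x| * 1 := by gcongr; exact hz.2
        _ = _ := mul_one _
    simp only
    linarith
  exact (LipschitzWith.of_le_add_mul 1 key).continuous

lemma gain_nonpos_of_le (hh : h ≤ criticalCurve β) {z : ℝ} (hz : z ∈ Set.Ioc (0 : ℝ) 1) :
    gain β h z ≤ 0 := by
  rw [gain_eq_sq_mul hz.1.ne']
  exact mul_nonpos_of_nonneg_of_nonpos (sq_nonneg z) (by linarith [criticalCurve_le (β := β) hz])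

lemma gain_neg_of_lt (hh : h < criticalCurve β) {z : ℝ} (hz : z ∈ Set.Ioc (0 : ℝ) 1) :
    gain β h z < 0 := by
  rw [gain_eq_sq_mul hz.1.ne']
  have hz0 := hz.1
  exact mul_neg_of_pos_of_neg (by positivity) (by linarith [criticalCurve_le (β := β) hz])

lemma lt_half_of_le_criticalCurve (hβ : 0 < β) (hh : h ≤ criticalCurve β) : h < 1 / 2 := by
  by_contra hcon
  obtain ⟨z, hz, hpos⟩ := exists_gain_pos hβ (not_lt.1 hcon)
  linarith [gain_nonpos_of_le hh ⟨hz.1, hz.2.le⟩]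

lemma exists_gain_pos_of_lt (hh : criticalCurve β < h) :
    ∃ z ∈ Set.Ioc (0 : ℝ) 1, 0 < gain β h z := by
  obtain ⟨_, ⟨z, hz, rfl⟩, hlt⟩ := exists_lt_of_csInf_lt (criticalCurve_set_nonempty β) hh
  refine ⟨z, hz, ?_⟩
  rw [gain_eq_sq_mul hz.1.ne']
  have hz0 := hz.1
  exact mul_pos (by positivity) (by simp only at hlt; linarith)

/-- The infimum cannot be approached only as `z → 0`: there the competitor is at least `1/2 - βz`,
which exceeds `h` by a fixed amount because `h < 1/2`. If the gain were negative everywhere,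
compactness of `[ρ, 1]` would give such an amount there too, and the infimum would exceed `h`. -/
lemma exists_gain_eq_zero (hβ : 0 < β) (hh : h = criticalCurve β) :
    ∃ z ∈ Set.Ioc (0 : ℝ) 1, gain β h z = 0 := by
  by_contra hcon
  have hneg : ∀ z ∈ Set.Ioc (0 : ℝ) 1, gain β h z < 0 := fun z hz =>
    lt_of_le_of_ne (gain_nonpos_of_le hh.le hz) fun h0 => hcon ⟨z, hz, h0⟩
  have hhalf := lt_half_of_le_criticalCurve hβ hh.le
  set ρ := min 1 ((1 / 2 - h) / (2 * β)) with hρ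
  have hρ0 : 0 < ρ := lt_min one_pos (div_pos (by linarith) (by positivity))
  have hρ1 : ρ ≤ 1 := min_le_left _ _
  have hρ2 : ρ * (2 * β) ≤ 1 / 2 - h := by
    rw [← le_div_iff₀ (by positivity)]; exact min_le_right _ _
  obtain ⟨z₁, hz₁, hmax⟩ := (isCompact_Icc (a := ρ) (b := 1)).exists_isMaxOn
    (Set.nonempty_Icc.2 hρ1) (continuous_gain β h).continuousOn
  have hM : gain β h z₁ < 0 := hneg z₁ ⟨hρ0.trans_le hz₁.1, hz₁.2⟩
  set e := min ((1 / 2 - h) / 2) (-gain β h z₁) with he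
  have he0 : 0 < e := lt_min (by linarith) (by linarith)
  have hge : h + e ≤ criticalCurve β := by
    refine le_csInf (criticalCurve_set_nonempty β) ?_
    rintro _ ⟨z, hz, rfl⟩
    obtain ⟨hz0, hz1⟩ := hz
    simp only
    by_cases hzρ : z ≤ ρ
    · have h1 : 1 / 2 ≤ entropyLoss z / z ^ 2 := by
        rw [le_div_iff₀ (by positivity)]
        linarith [sq_div_two_le_entropyLoss ⟨hz0.le, hz1⟩]
      have h2 : e ≤ (1 / 2 - h) / 2 := min_le_left _ _
      have h3 : β * z ≤ β * ρ := by gcongr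
      linarith
    · have h1 : gain β h z ≤ gain β h z₁ := hmax ⟨(not_le.1 hzρ).le, hz1⟩
      have h2 : e ≤ -gain β h z₁ := min_le_right _ _
      rw [gain_eq_sq_mul hz0.ne'] at h1
      have h4 : z ^ 2 ≤ 1 := by nlinarith
      set r := entropyLoss z / z ^ 2 - β * z
      have h5 : e ≤ z ^ 2 * (r - h) := by linarith
      have h6 : 0 < r - h := pos_of_mul_pos_right (he0.trans_le h5) (sq_nonneg z)
      have h7 : z ^ 2 * (r - h) ≤ 1 * (r - h) := mul_le_mul_of_nonneg_right h4 h6.le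
      linarith
  linarith

/-- On and above the critical curve there is exactly one positive maximizer. -/
lemma exists_positive_maximizer (hβ : 0 < β) (hh : criticalCurve β ≤ h) :
    ∃ z₀ ∈ Set.Ioo (0 : ℝ) 1, (∀ z ∈ Set.Icc (-1 : ℝ) 1, gain β h z ≤ gain β h z₀) ∧
      0 ≤ gain β h z₀ ∧ (criticalCurve β < h → 0 < gain β h z₀) ∧ gainDeriv β h z₀ = 0 ∧
      gainDeriv2 β h z₀ < 0 ∧
      ∀ z ∈ Set.Icc (0 : ℝ) 1, 0 < z → gain β h z = gain β h z₀ → z = z₀ := by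
  obtain ⟨z₀, hz₀, hmax, hnn, hpos⟩ : ∃ z₀ ∈ Set.Ioc (0 : ℝ) 1,
      (∀ z ∈ Set.Icc (0 : ℝ) 1, gain β h z ≤ gain β h z₀) ∧ 0 ≤ gain β h z₀ ∧
      (criticalCurve β < h → 0 < gain β h z₀) := by
    rcases hh.eq_or_lt with heq | hlt
    · obtain ⟨z, hz, h0⟩ := exists_gain_eq_zero hβ heq.symm
      refine ⟨z, hz, fun w hw => ?_, h0.ge, fun hlt => absurd hlt (by rw [heq]; exact lt_irrefl _)⟩
      rw [h0]
      rcases hw.1.eq_or_lt with rfl | hw0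
      · simp
      · exact gain_nonpos_of_le heq.ge ⟨hw0, hw.2⟩
    · obtain ⟨z, hz, h0⟩ := exists_gain_pos_of_lt hlt
      obtain ⟨z₀, hz₀, hmax⟩ := (isCompact_Icc (a := (0 : ℝ)) (b := 1)).exists_isMaxOn
        (Set.nonempty_Icc.2 zero_le_one) (continuous_gain β h).continuousOn
      have hp : 0 < gain β h z₀ := h0.trans_le (hmax ⟨hz.1.le, hz.2⟩)
      refine ⟨z₀, ⟨lt_of_le_of_ne hz₀.1 ?_, hz₀.2⟩, fun w hw => hmax hw, hp.le, fun _ => hp⟩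
      rintro rfl
      simp at hp
  have hz1 : z₀ < 1 := by
    refine lt_of_le_of_ne hz₀.2 ?_
    rintro rfl
    obtain ⟨z, hz, hlt⟩ := exists_gain_one_lt (h := h) hβ
    linarith [hmax z ⟨hz.1.le, hz.2.le⟩]
  have hcrit : ∀ z ∈ Set.Ioo (0 : ℝ) 1, (∀ w ∈ Set.Icc (0 : ℝ) 1, gain β h w ≤ gain β h z) →
      gainDeriv β h z = 0 := fun z hz hm => by
    have hloc : IsLocalMax (gain β h) z := by
      filter_upwards [Icc_mem_nhds hz.1 hz.2] with w hw using hm w hw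
    exact hloc.hasDerivAt_eq_zero (hasDerivAt_gain β h ⟨by linarith [hz.1], hz.2⟩)
  -- Applied to the smaller of two positive maximizers, this puts the larger one strictly below it;
  -- hence uniqueness.
  have hbeyond : ∀ z ∈ Set.Ioo (0 : ℝ) 1, (∀ w ∈ Set.Icc (0 : ℝ) 1, gain β h w ≤ gain β h z) →
      0 ≤ gain β h z → ∀ w, z < w → w ≤ 1 → gain β h w < gain β h z := by
    intro z hz hm hnn w hzw hw
    have hneg := (gainDeriv2_neg_of_critical hz (hcrit z hz hm) hnn).2
    have hanti : StrictAntiOn (gain β h) (Set.Icc z w) :=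
      strictAntiOn_Icc_of_hasDerivAt (continuous_gain β h).continuousOn
        (fun x hx => hasDerivAt_gain β h ⟨by linarith [hx.1, hz.1], by linarith [hx.2]⟩)
        (fun x hx => hneg x ⟨hx.1, by linarith [hx.2]⟩)
    exact hanti (Set.left_mem_Icc.2 hzw.le) (Set.right_mem_Icc.2 hzw.le) hzw
  have hz₀' : z₀ ∈ Set.Ioo (0 : ℝ) 1 := ⟨hz₀.1, hz1⟩
  refine ⟨z₀, hz₀', fun z hz => ?_, hnn, hpos, hcrit z₀ hz₀' hmax,
    (gainDeriv2_neg_of_critical hz₀' (hcrit z₀ hz₀' hmax) hnn).1, fun z hz hz0 heq => ?_⟩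
  · rcases le_or_gt 0 z with h0 | h0
    · exact hmax z ⟨h0, hz.2⟩
    · exact (gain_lt_gain_neg hβ h0).le.trans (hmax (-z) ⟨by linarith, by linarith [hz.1]⟩)
  · rcases lt_trichotomy z z₀ with hlt | h0 | hlt
    · have := hbeyond z ⟨hz0, hlt.trans hz1⟩ (fun w hw => by rw [heq]; exact hmax w hw)
        (by rw [heq]; exact hnn) z₀ hlt hz1.le
      linarith
    · exact h0
    · linarith [hbeyond z₀ hz₀' hmax hnn z hlt hz.2]

lemma mem_maximizers_iff {a : ℝ} : a ∈ maximizers (assoc β h) ↔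
    a ∈ Set.Icc (0 : ℝ) 1 ∧ ∀ z ∈ Set.Icc (-1 : ℝ) 1, gain β h z ≤ gain β h (2 * a - 1) := by
  refine and_congr_right fun _ => ⟨fun hm z hz => ?_, fun hm x hx => ?_⟩
  · have := hm (show (1 + z) / 2 ∈ Set.Icc (0 : ℝ) 1 from
      ⟨by linarith [hz.1], by linarith [hz.2]⟩)
    rw [Set.mem_ofPred_eq, assoc_eq_gain, assoc_eq_gain,
      show 2 * ((1 + z) / 2) - 1 = z by ring] at this
    linarith
  · rw [Set.mem_ofPred_eq, assoc_eq_gain, assoc_eq_gain]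
    linarith [hm (2 * x - 1) ⟨by linarith [hx.1], by linarith [hx.2]⟩]

/-- Chain rule for `z = 2a - 1`: the derivatives of `A` are 2 and 4 times those of the gain. -/
lemma isTwoRegular_of_gainDeriv {a : ℝ} (ha : a ∈ Set.Ioo (0 : ℝ) 1)
    (h1 : gainDeriv β h (2 * a - 1) = 0) (h2 : gainDeriv2 β h (2 * a - 1) < 0) :
    IsTwoRegular (assoc β h) a := by
  rw [isTwoRegular_iff ha]
  obtain ⟨ha0, ha1⟩ := ha
  have ha1' : 1 - a ≠ 0 := by linarith
  constructor
  · have e : assocDeriv β h a = 2 * gainDeriv β h (2 * a - 1) := by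
      rw [assocDeriv, gainDeriv, show 1 + (2 * a - 1) = 2 * a by ring,
        show 1 - (2 * a - 1) = 2 * (1 - a) by ring, Real.log_mul two_ne_zero ha0.ne',
        Real.log_mul two_ne_zero ha1']
      ring
    rw [e, h1, mul_zero]
  · have e : assocDeriv2 β h a = 4 * gainDeriv2 β h (2 * a - 1) := by
      rw [assocDeriv2, gainDeriv2, show 1 - (2 * a - 1) ^ 2 = 4 * (a * (1 - a)) by ring]
      have := ha0.ne'
      field_simp
      ring
    rw [e]; linarith

lemma isTwoRegular_half (hh : h < 1 / 2) : IsTwoRegular (assoc β h) (1 / 2) := by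
  refine isTwoRegular_of_gainDeriv (by norm_num) (by norm_num) ?_
  norm_num [gainDeriv2]
  linarith

/-- Below the critical curve. -/
lemma maximizers_of_lt (hβ : 0 < β) (hh : h < criticalCurve β) :
    maximizers (assoc β h) = {1 / 2} ∧ IsTwoRegular (assoc β h) (1 / 2) := by
  have hlt : ∀ z ∈ Set.Icc (-1 : ℝ) 1, z ≠ 0 → gain β h z < 0 := fun z hz hz0 => by
    rcases lt_or_gt_of_ne hz0 with h0 | h0
    · exact (gain_lt_gain_neg hβ h0).trans (gain_neg_of_lt hh ⟨by linarith, by linarith [hz.1]⟩)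
    · exact gain_neg_of_lt hh ⟨h0, hz.2⟩
  refine ⟨?_, isTwoRegular_half (lt_half_of_le_criticalCurve hβ hh.le)⟩
  ext a
  rw [mem_maximizers_iff, Set.mem_singleton_iff]
  constructor
  · rintro ⟨ha, hm⟩
    by_contra hne
    have h1 := hm 0 (by norm_num)
    rw [gain_zero] at h1
    have := hlt (2 * a - 1) ⟨by linarith [ha.1], by linarith [ha.2]⟩
      (fun h0 => hne (by linarith))
    linarith
  · rintro rfl
    refine ⟨by norm_num, fun z hz => ?_⟩
    norm_num
    by_cases h0 : z = 0
    · simp [h0]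
    · exact (hlt z hz h0).le

/-- Above the critical curve. -/
lemma maximizers_of_gt (hβ : 0 < β) (hh : criticalCurve β < h) :
    ∃ a : ℝ, 1 / 2 < a ∧ a < 1 ∧ maximizers (assoc β h) = {a} ∧ IsTwoRegular (assoc β h) a := by
  obtain ⟨z₀, hz₀, hmax, -, hpos, h1, h2, huniq⟩ := exists_positive_maximizer hβ hh.le
  have e : 2 * ((1 + z₀) / 2) - 1 = z₀ := by ring
  refine ⟨(1 + z₀) / 2, by linarith [hz₀.1], by linarith [hz₀.2], ?_,
    isTwoRegular_of_gainDeriv ⟨by linarith [hz₀.1], by linarith [hz₀.2]⟩ (by rw [e]; exact h1)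
      (by rw [e]; exact h2)⟩
  ext a
  rw [mem_maximizers_iff, Set.mem_singleton_iff]
  constructor
  · rintro ⟨ha, hm⟩
    have hmem : 2 * a - 1 ∈ Set.Icc (-1 : ℝ) 1 := ⟨by linarith [ha.1], by linarith [ha.2]⟩
    have heq := le_antisymm (hmax _ hmem) (hm z₀ ⟨by linarith [hz₀.1], hz₀.2.le⟩)
    have h0 : 0 < 2 * a - 1 := by
      rcases lt_trichotomy (2 * a - 1) 0 with h0 | h0 | h0
      · have := hm (-(2 * a - 1)) ⟨by linarith, by linarith [hmem.1]⟩
        exact absurd (gain_lt_gain_neg hβ h0) (not_lt.2 this)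
      · rw [h0, gain_zero] at heq; linarith [hpos hh]
      · exact h0
    linarith [huniq _ ⟨h0.le, hmem.2⟩ h0 heq]
  · rintro rfl
    refine ⟨⟨by linarith [hz₀.1], by linarith [hz₀.2]⟩, ?_⟩
    rw [e]; exact hmax

/-- On the critical curve. -/
lemma maximizers_of_eq (hβ : 0 < β) (hh : h = criticalCurve β) :
    ∃ a : ℝ, 1 / 2 < a ∧ a < 1 ∧ maximizers (assoc β h) = {1 / 2, a} ∧
      IsTwoRegular (assoc β h) (1 / 2) ∧ IsTwoRegular (assoc β h) a := by
  obtain ⟨z₀, hz₀, hmax, hnn, -, h1, h2, huniq⟩ := exists_positive_maximizer hβ hh.ge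
  have e : 2 * ((1 + z₀) / 2) - 1 = z₀ := by ring
  have hz : gain β h z₀ = 0 := le_antisymm (gain_nonpos_of_le hh.le ⟨hz₀.1, hz₀.2.le⟩) hnn
  refine ⟨(1 + z₀) / 2, by linarith [hz₀.1], by linarith [hz₀.2], ?_,
    isTwoRegular_half (lt_half_of_le_criticalCurve hβ hh.le),
    isTwoRegular_of_gainDeriv ⟨by linarith [hz₀.1], by linarith [hz₀.2]⟩ (by rw [e]; exact h1)
      (by rw [e]; exact h2)⟩
  ext a
  rw [mem_maximizers_iff, Set.mem_insert_iff, Set.mem_singleton_iff]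
  constructor
  · rintro ⟨ha, hm⟩
    have hmem : 2 * a - 1 ∈ Set.Icc (-1 : ℝ) 1 := ⟨by linarith [ha.1], by linarith [ha.2]⟩
    have heq := le_antisymm (hmax _ hmem) (hm z₀ ⟨by linarith [hz₀.1], hz₀.2.le⟩)
    rcases lt_trichotomy (2 * a - 1) 0 with h | h | h
    · have := hm (-(2 * a - 1)) ⟨by linarith, by linarith [hmem.1]⟩
      exact absurd (gain_lt_gain_neg hβ h) (not_lt.2 this)
    · left; linarith
    · right; linarith [huniq _ ⟨h.le, hmem.2⟩ h heq]
  · rintro (rfl | rfl)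
    · refine ⟨by norm_num, fun z hz' => ?_⟩
      have := hmax z hz'
      norm_num
      linarith
    · refine ⟨⟨by linarith [hz₀.1], by linarith [hz₀.2]⟩, ?_⟩
      rw [e]; exact hmax

end CubicIsing

/-! ### Limit theorems off and on the curve -/

namespace CubicIsing

variable {β h a V N δ : ℝ} {S : Set ℝ}

lemma tendsto_integral_gibbs {F : ℝ → ℝ} (hZ : PartitionLimit F a V) (φ : ℝ → ℝ)
    (hN : Tendsto (fun n : ℕ => ∑ k ∈ Finset.range (n + 1),
      peakWeight F a Set.univ n k * φ (2 * (k / n) - 1)) atTop (𝓝 N)) :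
    Tendsto (fun n : ℕ => ∫ ω, φ (magnetization ω / n) ∂(gibbs n F)) atTop (𝓝 (N / V)) := by
  refine (hN.div hZ.tendsto hZ.1.ne').congr' ?_
  filter_upwards [eventually_ne_atTop 0] with n hn
  simp only [magnetization_div hn]
  exact (integral_gibbs_eq n F a fun x => φ (2 * x - 1)).symm

/-- The magnetization is exponentially unlikely to be away from the maximizers. -/
lemma exists_gibbs_real_forall_lt_le_exp (hS : maximizers (assoc β h) = S) (haS : a ∈ S)
    (hZ : PartitionLimit (energy β h) a V) (hδ : 0 < δ) :
    ∃ c : ℝ, 0 < c ∧ ∀ᶠ n : ℕ in atTop,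
      (gibbs n (energy β h)).real {ω | ∀ x ∈ S, δ < |magnetization ω / n - (2 * x - 1)|}
        ≤ Real.exp (-c * n) := by
  -- The non-strict inequality makes the set closed, as compactness requires; it contains the event,
  -- which is defined by a strict one.
  set E : Set ℝ := {y | ∀ x ∈ S, δ ≤ |2 * y - 1 - (2 * x - 1)|} with hE
  have hEc : IsClosed E := by
    simp only [hE, Set.ofPred_forall]
    exact isClosed_iInter fun x => isClosed_iInter fun _ =>
      isClosed_le continuous_const (by fun_prop)
  have hES : Disjoint E S := Set.disjoint_left.2 fun x hx hxS => by
    have := hx x hxS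
    rw [sub_self, abs_zero] at this
    linarith
  obtain ⟨c, hc, hle⟩ := exists_assoc_le_sub hS haS hEc hES
  obtain ⟨d, hd, hev⟩ := exists_gibbs_real_le_exp hZ hc hle
  refine ⟨d, hd, ?_⟩
  filter_upwards [hev, eventually_ne_atTop 0] with n hn hn0
  have hsub : {ω : Config n | ∀ x ∈ S, δ < |magnetization ω / n - (2 * x - 1)|}
      ⊆ {ω | plusFraction ω ∈ E} := fun ω hω x hx => by
    have := (hω x hx).le
    rwa [magnetization_div hn0] at this
  exact (MeasureTheory.measureReal_mono hsub).trans hn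

/-- A closed neighbourhood of `a` in the proportion variable, corresponding to a window of
half-width `ε` for the magnetization. -/
def nearFraction (a ε : ℝ) : Set ℝ := {y | |2 * y - 1 - (2 * a - 1)| ≤ ε}

lemma window_eq {n : ℕ} (hn : n ≠ 0) (a ε : ℝ) :
    window n (2 * a - 1) ε = {ω | plusFraction ω ∈ nearFraction a ε} := by
  ext ω
  simp [window, nearFraction, magnetization_div hn]

lemma isClosed_nearFraction (a ε : ℝ) : IsClosed (nearFraction a ε) :=
  isClosed_le (by fun_prop) continuous_const

lemma nearFraction_mem_nhds (a : ℝ) {ε : ℝ} (hε : 0 < ε) : nearFraction a ε ∈ 𝓝 a := by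
  have hc : ContinuousAt (fun y : ℝ => |2 * y - 1 - (2 * a - 1)|) a := by fun_prop
  exact hc.preimage_mem_nhds (Iic_mem_nhds (show _ < ε by simpa using hε))

lemma half_abs_iteratedDeriv_pos (hreg : IsTwoRegular (assoc β h) a) :
    0 < |iteratedDeriv 2 (assoc β h) a| / 2 := half_pos (abs_pos.2 hreg.2.ne)

lemma two_mul_half_abs (x : ℝ) : 2 * (|x| / 2) = |x| := mul_div_cancel₀ _ two_ne_zero

section UniqueMaximizer

variable (hS : maximizers (assoc β h) = {a}) (ha : a ∈ Set.Ioo (0 : ℝ) 1)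
  (hreg : IsTwoRegular (assoc β h) a)
include hS ha hreg

lemma gaussianLike_univ_of_maximizers_eq_singleton :
    GaussianLike a (weight (assoc β h) a) (|iteratedDeriv 2 (assoc β h) a| / 2)
      (peakWeight (energy β h) a Set.univ) :=
  gaussianLike_assoc hS rfl ha hreg univ_mem (by simp)

lemma partitionLimit_of_maximizers_eq_singleton :
    PartitionLimit (energy β h) a (weight (assoc β h) a) :=
  partitionLimit_of_gaussianLike (weight_pos ha hreg)
    (gaussianLike_univ_of_maximizers_eq_singleton hS ha hreg) ha (half_abs_iteratedDeriv_pos hreg)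

theorem tendsto_integral_gibbs_of_maximizers_eq_singleton (φ : BoundedContinuousFunction ℝ ℝ) :
    Tendsto (fun n : ℕ => ∫ ω, φ (magnetization ω / n) ∂(gibbs n (energy β h))) atTop
      (𝓝 (φ (2 * a - 1))) := by
  have h1 := (gaussianLike_univ_of_maximizers_eq_singleton hS ha hreg).tendsto_sum_mul ha
    (half_abs_iteratedDeriv_pos hreg) (ψ := fun x => φ (2 * x - 1))
    (fun x => φ.norm_coe_le_norm _) (by fun_prop)
  have h2 := tendsto_integral_gibbs (partitionLimit_of_maximizers_eq_singleton hS ha hreg) φ h1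
  rwa [mul_div_cancel_left₀ _ (weight_pos ha hreg).ne'] at h2

theorem exists_integral_abs_pow_le (l : ℕ) : ∃ C : ℝ, ∀ n : ℕ, 1 ≤ n →
    ∫ ω, |magnetization ω / n - (2 * a - 1)| ^ l ∂(gibbs n (energy β h)) ≤ C / √(n : ℝ) ^ l := by
  obtain ⟨c, hc, hcn⟩ := (partitionLimit_of_maximizers_eq_singleton hS ha hreg).exists_pos_le
  obtain ⟨C, hC⟩ := exists_integral_cond_abs_pow_le
    (gaussianLike_univ_of_maximizers_eq_singleton hS ha hreg) (half_abs_iteratedDeriv_pos hreg) hc l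
  refine ⟨C, fun n hn => ?_⟩
  have := hC n hn (hcn n hn)
  rwa [show {ω : Config n | plusFraction ω ∈ Set.univ} = Set.univ from rfl, cond_univ] at this

theorem exists_wasserstein_le : ∃ C : ℝ, ∀ n : ℕ, 1 ≤ n →
    wasserstein ((gibbs n (energy β h)).map (fluctuation (2 * a - 1)))
      (limitGaussian (assoc β h) a) ≤ ENNReal.ofReal (C / √(n : ℝ)) := by
  obtain ⟨c, hc, hcn⟩ := (partitionLimit_of_maximizers_eq_singleton hS ha hreg).exists_pos_le
  obtain ⟨C, hC⟩ := exists_wasserstein_cond_le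
    (gaussianLike_univ_of_maximizers_eq_singleton hS ha hreg) ha
    (half_abs_iteratedDeriv_pos hreg) hc
  refine ⟨C, fun n hn => ?_⟩
  have := hC n hn (hcn n hn)
  rwa [show {ω : Config n | plusFraction ω ∈ Set.univ} = Set.univ from rfl, cond_univ,
    two_mul_half_abs] at this

theorem tendstoInDistribution_mle_cube (ha2 : a ≠ 1 / 2) (est : (n : ℕ) → Config n → ℝ)
    (hest : ∀ n, IsMLE n cube (fun x => h * square x) (est n)) :
    TendstoInDistribution (fun (n : ℕ) ω => √(n : ℝ) * (est n ω - β)) atTop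
      (id : ℝ → ℝ) (fun n => gibbs n (energy β h))
      (gaussianReal 0 (|iteratedDeriv 2 (assoc β h) a| / (deriv cube a) ^ 2).toNNReal) := by
  -- The derivative of the statistic vanishes exactly at `a = 1/2`, where the linear response
  -- degenerates.
  have hz : 2 * a - 1 ≠ 0 := fun h0 => ha2 (by linarith)
  have := tendstoInDistribution_mle (f := cube) (g := fun x => h * square x) (b := β)
    (gaussianLike_univ_of_maximizers_eq_singleton hS ha hreg) ha (half_abs_iteratedDeriv_pos hreg)
    (weight_pos ha hreg) (firstOrder_cube a ha) (by norm_num) (by positivity) est hest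
  rwa [two_mul_half_abs, ← (hasDerivAt_cube a).deriv] at this

theorem tendstoInDistribution_mle_square (ha2 : a ≠ 1 / 2) (est : (n : ℕ) → Config n → ℝ)
    (hest : ∀ n, IsMLE n square (fun x => β * cube x) (est n)) :
    TendstoInDistribution (fun (n : ℕ) ω => √(n : ℝ) * (est n ω - h)) atTop
      (id : ℝ → ℝ) (fun n => gibbs n (energy β h))
      (gaussianReal 0 (|iteratedDeriv 2 (assoc β h) a| / (deriv square a) ^ 2).toNNReal) := by
  have hz : 2 * a - 1 ≠ 0 := fun h0 => ha2 (by linarith)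
  have hF : energy β h = fun x => h * square x + β * cube x := funext fun x => add_comm _ _
  have hq := gaussianLike_univ_of_maximizers_eq_singleton hS ha hreg
  rw [hF] at hq ⊢
  have := tendstoInDistribution_mle hq ha (half_abs_iteratedDeriv_pos hreg)
    (weight_pos ha hreg) (firstOrder_square a ha) (by norm_num)
    (mul_ne_zero four_ne_zero hz) est hest
  rwa [two_mul_half_abs, ← (hasDerivAt_square a).deriv] at this

end UniqueMaximizer

section TwoMaximizers

variable (ha0 : 1 / 2 < a) (ha1 : a < 1) (hS : maximizers (assoc β h) = {1 / 2, a})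
  (hreg₁ : IsTwoRegular (assoc β h) (1 / 2)) (hreg₂ : IsTwoRegular (assoc β h) a)

include hS in
lemma assoc_half_eq : assoc β h (1 / 2) = assoc β h a := by
  have h1 : (1 / 2 : ℝ) ∈ maximizers (assoc β h) := by rw [hS]; simp
  have h2 : a ∈ maximizers (assoc β h) := by rw [hS]; simp
  exact le_antisymm (h2.2 h1.1) (h1.2 h2.1)

include ha0 ha1 hS hreg₁

/-- Cutting at the midpoint of the two maximizers leaves exactly one of them in the closure of each
half, so the full sum splits into two peaks. -/
lemma gaussianLike_left :
    GaussianLike (1 / 2) (weight (assoc β h) (1 / 2)) (|iteratedDeriv 2 (assoc β h) (1 / 2)| / 2)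
      (peakWeight (energy β h) (1 / 2) (Set.Iic ((1 / 2 + a) / 2))) := by
  refine gaussianLike_assoc hS (by simp) (by norm_num) hreg₁ (Iic_mem_nhds (by linarith)) ?_
  rw [isClosed_Iic.closure_eq]
  rintro x ⟨hx, rfl | rfl⟩
  · rfl
  · rw [Set.mem_Iic] at hx; linarith

omit hreg₁
include hreg₂

lemma gaussianLike_right :
    GaussianLike a (weight (assoc β h) a) (|iteratedDeriv 2 (assoc β h) a| / 2)
      (peakWeight (energy β h) a (Set.Iic ((1 / 2 + a) / 2))ᶜ) := by
  rw [Set.compl_Iic]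
  refine gaussianLike_assoc hS (by simp) ⟨by linarith, ha1⟩ hreg₂ (Ioi_mem_nhds (by linarith)) ?_
  rw [closure_Ioi]
  rintro x ⟨hx, rfl | rfl⟩
  · rw [Set.mem_Ici] at hx; linarith
  · rfl

include hreg₁

lemma partitionLimit_of_two_maximizers :
    PartitionLimit (energy β h) (1 / 2) (weight (assoc β h) (1 / 2) + weight (assoc β h) a) :=
  partitionLimit_of_gaussianLike_of_gaussianLike (weight_pos (by norm_num) hreg₁)
    (weight_pos ⟨by linarith, ha1⟩ hreg₂) (assoc_half_eq hS)
    (gaussianLike_left ha0 ha1 hS hreg₁) (gaussianLike_right ha0 ha1 hS hreg₂) (by norm_num)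
    ⟨by linarith, ha1⟩ (half_abs_iteratedDeriv_pos hreg₁) (half_abs_iteratedDeriv_pos hreg₂)

theorem tendsto_integral_gibbs_of_two_maximizers (φ : BoundedContinuousFunction ℝ ℝ) :
    Tendsto (fun n : ℕ => ∫ ω, φ (magnetization ω / n) ∂(gibbs n (energy β h)))
      atTop (𝓝 ((weight (assoc β h) (1 / 2) * φ 0 + weight (assoc β h) a * φ (2 * a - 1)) /
        (weight (assoc β h) (1 / 2) + weight (assoc β h) a))) := by
  refine tendsto_integral_gibbs (partitionLimit_of_two_maximizers ha0 ha1 hS hreg₁ hreg₂) φ ?_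
  have h1 := (gaussianLike_left ha0 ha1 hS hreg₁).tendsto_sum_mul (by norm_num)
    (half_abs_iteratedDeriv_pos hreg₁) (ψ := fun x => φ (2 * x - 1))
    (fun x => φ.norm_coe_le_norm _) (by fun_prop)
  have h2 := (gaussianLike_right ha0 ha1 hS hreg₂).tendsto_sum_mul ⟨by linarith, ha1⟩
    (half_abs_iteratedDeriv_pos hreg₂) (ψ := fun x => φ (2 * x - 1))
    (fun x => φ.norm_coe_le_norm _) (by fun_prop)
  rw [← peakWeight_congr (assoc_half_eq hS)] at h2
  have h3 := h1.add h2
  simp only [← Finset.sum_add_distrib, ← add_mul, ← peakWeight_univ_eq_add] at h3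
  norm_num at h3 ⊢
  exact h3

variable {x ε : ℝ} (hx : x ∈ ({1 / 2, a} : Set ℝ)) (hε : 0 < ε) (hεa : ε < 2 * a - 1)

omit hreg₁ hreg₂ hS in
include hx in
lemma mem_Ioo_of_mem_pair : x ∈ Set.Ioo (0 : ℝ) 1 := by
  rcases hx with rfl | rfl
  · norm_num
  · exact ⟨by linarith, ha1⟩

omit ha0 ha1 hS in
include hx in
lemma isTwoRegular_of_mem_pair : IsTwoRegular (assoc β h) x := by
  rcases hx with rfl | rfl
  exacts [hreg₁, hreg₂]

include hx

lemma partitionLimit_of_mem_pair :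
    PartitionLimit (energy β h) x (weight (assoc β h) (1 / 2) + weight (assoc β h) a) := by
  have hZ := partitionLimit_of_two_maximizers ha0 ha1 hS hreg₁ hreg₂
  rcases hx with rfl | rfl
  · exact hZ
  · rwa [PartitionLimit, ← peakWeight_congr (assoc_half_eq hS)]

include hε hεa

/-- The condition `ε < 2a - 1` keeps the other maximizer out of the closed window. -/
lemma gaussianLike_nearFraction :
    GaussianLike x (weight (assoc β h) x) (|iteratedDeriv 2 (assoc β h) x| / 2)
      (peakWeight (energy β h) x (nearFraction x ε)) := by
  refine gaussianLike_assoc hS hx (mem_Ioo_of_mem_pair ha0 ha1 hx)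
    (isTwoRegular_of_mem_pair hreg₁ hreg₂ hx) (nearFraction_mem_nhds x hε) ?_
  rw [(isClosed_nearFraction x ε).closure_eq]
  rintro y ⟨hy, hyS⟩
  have hy' := abs_le.1 (show |2 * y - 1 - (2 * x - 1)| ≤ ε from hy)
  rcases hx with rfl | rfl <;> rcases hyS with rfl | rfl
  · rfl
  · linarith [hy'.2]
  · linarith [hy'.1]
  · rfl

theorem exists_abs_gibbs_real_window_sub_le : ∃ C : ℝ, ∀ n : ℕ, 2 ≤ n →
    |(gibbs n (energy β h)).real (window n (2 * x - 1) ε) -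
        weight (assoc β h) x / (weight (assoc β h) (1 / 2) + weight (assoc β h) a)|
      ≤ C * Real.log n ^ 3 / √(n : ℝ) := by
  obtain ⟨C, hC, hn⟩ := exists_abs_gibbs_real_sub_le
    (gaussianLike_nearFraction ha0 ha1 hS hreg₁ hreg₂ hx hε hεa) (mem_Ioo_of_mem_pair ha0 ha1 hx)
    (half_abs_iteratedDeriv_pos (isTwoRegular_of_mem_pair hreg₁ hreg₂ hx))
    (partitionLimit_of_mem_pair ha0 ha1 hS hreg₁ hreg₂ hx)
  have hlog : 0 < Real.log 2 := Real.log_pos one_lt_two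
  -- The error is in fact `O(1/√n)`; the logarithms enter only through `log n ≥ log 2`.
  refine ⟨C / Real.log 2 ^ 3, fun n h2 => ?_⟩
  rw [window_eq (by omega)]
  refine (hn n (by omega)).trans ?_
  gcongr
  rw [div_mul_eq_mul_div, le_div_iff₀ (by positivity)]
  gcongr
  exact_mod_cast h2

/-- For small `n` a window may contain no level `k/n` at all, so the conditional denominators are
bounded below only eventually. -/
lemma eventually_half_weight_le : ∀ᶠ n : ℕ in atTop, weight (assoc β h) x / 2
    ≤ ∑ k ∈ Finset.range (n + 1), peakWeight (energy β h) x (nearFraction x ε) n k := by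
  have hI := mem_Ioo_of_mem_pair ha0 ha1 hx
  have hr := isTwoRegular_of_mem_pair hreg₁ hreg₂ hx
  exact ((gaussianLike_nearFraction ha0 ha1 hS hreg₁ hreg₂ hx hε hεa).tendsto_sum hI
    (half_abs_iteratedDeriv_pos hr)).eventually_const_le (half_lt_self (weight_pos hI hr))

theorem exists_integral_cond_window_abs_pow_le (l : ℕ) : ∃ C : ℝ, ∀ᶠ n : ℕ in atTop,
    ∫ ω, |magnetization ω / n - (2 * x - 1)| ^ l
        ∂(ProbabilityTheory.cond (gibbs n (energy β h)) (window n (2 * x - 1) ε))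
      ≤ C / √(n : ℝ) ^ l := by
  have hI := mem_Ioo_of_mem_pair ha0 ha1 hx
  have hr := isTwoRegular_of_mem_pair hreg₁ hreg₂ hx
  obtain ⟨C, hC⟩ := exists_integral_cond_abs_pow_le
    (gaussianLike_nearFraction ha0 ha1 hS hreg₁ hreg₂ hx hε hεa) (half_abs_iteratedDeriv_pos hr)
    (half_pos (weight_pos hI hr)) l
  refine ⟨C, ?_⟩
  filter_upwards [eventually_half_weight_le ha0 ha1 hS hreg₁ hreg₂ hx hε hεa,
    eventually_gt_atTop 0] with n hn hn0
  rw [window_eq hn0.ne']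
  exact hC n hn0 hn

theorem exists_wasserstein_cond_window_le : ∃ C : ℝ, ∀ᶠ n : ℕ in atTop,
    wasserstein
      ((ProbabilityTheory.cond (gibbs n (energy β h)) (window n (2 * x - 1) ε)).map
        (fluctuation (2 * x - 1)))
      (limitGaussian (assoc β h) x) ≤ ENNReal.ofReal (C / √(n : ℝ)) := by
  have hI := mem_Ioo_of_mem_pair ha0 ha1 hx
  have hr := isTwoRegular_of_mem_pair hreg₁ hreg₂ hx
  obtain ⟨C, hC⟩ := exists_wasserstein_cond_le
    (gaussianLike_nearFraction ha0 ha1 hS hreg₁ hreg₂ hx hε hεa) hI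
    (half_abs_iteratedDeriv_pos hr) (half_pos (weight_pos hI hr))
  refine ⟨C, ?_⟩
  filter_upwards [eventually_half_weight_le ha0 ha1 hS hreg₁ hreg₂ hx hε hεa,
    eventually_gt_atTop 0] with n hn hn0
  have := hC n hn0 hn
  rwa [← window_eq hn0.ne', two_mul_half_abs] at this

end TwoMaximizers

end CubicIsing

/-! ### The main theorem -/

open CubicIsing in
theorem mainTheorem11 :
    ∃ g : ℝ → ℝ, ContinuousOn g (Set.Ioi 0) ∧ ∀ β h : ℝ, 0 < β →
      -- off the curve
      (h ≠ g β → ∃ a : ℝ, 0 < a ∧ a < 1 ∧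
        maximizers (assoc β h) = {a} ∧ IsTwoRegular (assoc β h) a ∧
        (h < g β → a = 1 / 2) ∧ (g β < h → 1 / 2 < a) ∧
        -- weak law and exponential concentration
        (∀ φ : BoundedContinuousFunction ℝ ℝ,
          Tendsto (fun n : ℕ => ∫ ω, φ (magnetization ω / n) ∂(gibbs n (energy β h)))
            atTop (𝓝 (φ (2 * a - 1)))) ∧
        (∀ δ : ℝ, 0 < δ → ∃ c : ℝ, 0 < c ∧ ∀ᶠ n : ℕ in atTop,
          (gibbs n (energy β h)).real {ω | δ < |magnetization ω / n - (2 * a - 1)|}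
            ≤ Real.exp (-c * n)) ∧
        -- moment bounds and central limit theorem
        (∀ l : ℕ, ∃ C : ℝ, ∀ n : ℕ, 1 ≤ n →
          ∫ ω, |magnetization ω / n - (2 * a - 1)| ^ l ∂(gibbs n (energy β h))
            ≤ C / √(n : ℝ) ^ l) ∧
        (∃ C : ℝ, ∀ n : ℕ, 1 ≤ n →
          wasserstein ((gibbs n (energy β h)).map (fluctuation (2 * a - 1)))
            (limitGaussian (assoc β h) a) ≤ ENNReal.ofReal (C / √(n : ℝ))) ∧
        -- maximum likelihood estimators
        (a ≠ 1 / 2 →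
          (∀ est : (n : ℕ) → Config n → ℝ,
            (∀ n, IsMLE n cube (fun x => h * square x) (est n)) →
            TendstoInDistribution (fun (n : ℕ) ω => √(n : ℝ) * (est n ω - β)) atTop
              (id : ℝ → ℝ) (fun n => gibbs n (energy β h))
              (gaussianReal 0
                (|iteratedDeriv 2 (assoc β h) a| / (deriv cube a) ^ 2).toNNReal)) ∧
          (∀ est : (n : ℕ) → Config n → ℝ,
            (∀ n, IsMLE n square (fun x => β * cube x) (est n)) →
            TendstoInDistribution (fun (n : ℕ) ω => √(n : ℝ) * (est n ω - h)) atTop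
              (id : ℝ → ℝ) (fun n => gibbs n (energy β h))
              (gaussianReal 0
                (|iteratedDeriv 2 (assoc β h) a| / (deriv square a) ^ 2).toNNReal)))) ∧
      -- on the curve
      (h = g β → ∃ a : ℝ, 1 / 2 < a ∧ a < 1 ∧
        maximizers (assoc β h) = {1 / 2, a} ∧
        (∀ x ∈ ({1 / 2, a} : Set ℝ), IsTwoRegular (assoc β h) x) ∧
        -- weak law and exponential concentration
        (∀ φ : BoundedContinuousFunction ℝ ℝ,
          Tendsto (fun n : ℕ => ∫ ω, φ (magnetization ω / n) ∂(gibbs n (energy β h)))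
            atTop (𝓝 ((weight (assoc β h) (1 / 2) * φ 0 + weight (assoc β h) a * φ (2 * a - 1)) /
              (weight (assoc β h) (1 / 2) + weight (assoc β h) a)))) ∧
        (∀ δ : ℝ, 0 < δ → ∃ c : ℝ, 0 < c ∧ ∀ᶠ n : ℕ in atTop,
          (gibbs n (energy β h)).real
            {ω | ∀ x ∈ ({1 / 2, a} : Set ℝ), δ < |magnetization ω / n - (2 * x - 1)|}
            ≤ Real.exp (-c * n)) ∧
        -- around each of the two points
        (∀ x ∈ ({1 / 2, a} : Set ℝ), ∀ ε : ℝ, 0 < ε → ε < 2 * a - 1 →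
          (∃ C : ℝ, ∀ n : ℕ, 2 ≤ n →
            |(gibbs n (energy β h)).real (window n (2 * x - 1) ε) -
                weight (assoc β h) x / (weight (assoc β h) (1 / 2) + weight (assoc β h) a)|
              ≤ C * Real.log n ^ 3 / √(n : ℝ)) ∧
          (∀ l : ℕ, ∃ C : ℝ, ∀ᶠ n : ℕ in atTop,
            ∫ ω, |magnetization ω / n - (2 * x - 1)| ^ l
                ∂(cond (gibbs n (energy β h)) (window n (2 * x - 1) ε))
              ≤ C / √(n : ℝ) ^ l) ∧
          (∃ C : ℝ, ∀ᶠ n : ℕ in atTop,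
            wasserstein
              ((cond (gibbs n (energy β h)) (window n (2 * x - 1) ε)).map
                (fluctuation (2 * x - 1)))
              (limitGaussian (assoc β h) x) ≤ ENNReal.ofReal (C / √(n : ℝ))))) := by
  refine ⟨criticalCurve, continuous_criticalCurve.continuousOn, fun β h hβ => ⟨fun hne => ?_,
    fun heq => ?_⟩⟩
  · obtain ⟨a, ha, hS, hreg, hlt, hgt⟩ : ∃ a : ℝ, a ∈ Set.Ioo (0 : ℝ) 1 ∧
        maximizers (assoc β h) = {a} ∧ IsTwoRegular (assoc β h) a ∧
        (h < criticalCurve β → a = 1 / 2) ∧ (criticalCurve β < h → 1 / 2 < a) := by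
      rcases hne.lt_or_gt with hh | hh
      · obtain ⟨hS, hreg⟩ := maximizers_of_lt hβ hh
        exact ⟨1 / 2, by norm_num, hS, hreg, fun _ => rfl, fun h' => absurd h' hh.not_gt⟩
      · obtain ⟨a, ha0, ha1, hS, hreg⟩ := maximizers_of_gt hβ hh
        exact ⟨a, ⟨by linarith, ha1⟩, hS, hreg, fun h' => absurd h' hh.not_gt, fun _ => ha0⟩
    refine ⟨a, ha.1, ha.2, hS, hreg, hlt, hgt,
      tendsto_integral_gibbs_of_maximizers_eq_singleton hS ha hreg, fun δ hδ => ?_,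
      exists_integral_abs_pow_le hS ha hreg, exists_wasserstein_le hS ha hreg,
      fun ha2 => ⟨tendstoInDistribution_mle_cube hS ha hreg ha2,
        tendstoInDistribution_mle_square hS ha hreg ha2⟩⟩
    simpa using exists_gibbs_real_forall_lt_le_exp hS rfl
      (partitionLimit_of_maximizers_eq_singleton hS ha hreg) hδ
  · obtain ⟨a, ha0, ha1, hS, hreg₁, hreg₂⟩ := maximizers_of_eq hβ heq
    exact ⟨a, ha0, ha1, hS, fun x hx => isTwoRegular_of_mem_pair hreg₁ hreg₂ hx,
      tendsto_integral_gibbs_of_two_maximizers ha0 ha1 hS hreg₁ hreg₂,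
      fun δ hδ => exists_gibbs_real_forall_lt_le_exp hS (by simp)
        (partitionLimit_of_two_maximizers ha0 ha1 hS hreg₁ hreg₂) hδ,
      fun x hx ε hε hεa =>
        ⟨exists_abs_gibbs_real_window_sub_le ha0 ha1 hS hreg₁ hreg₂ hx hε hεa,
          exists_integral_cond_window_abs_pow_le ha0 ha1 hS hreg₁ hreg₂ hx hε hεa,
          exists_wasserstein_cond_window_le ha0 ha1 hS hreg₁ hreg₂ hx hε hεa⟩⟩
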